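/- Let $p$ be a prime, $q=p^l$ with $l\ge 1$, and let $m\ge 2$. Write $\mathrm{Tr}$ for the trace $\mathbb{F}_{q^m}\to\mathbb{F}_q$, and put $f_2(x)=\mathrm{Tr}(x)$, $g_2(y)=\mathrm{Tr}(y^2)$. Let $\mathcal{C}_{f_2,g_2}$ be the linear code over $\mathbb{F}_{q^m}$ generated by the $3$-row matrix whose columns are $(0,1,0)^{\top}$ and $(1,x,y)^{\top}$ for all $(x,y)\in\mathbb{F}_{q^m}^2$ with $f_2(x)+g_2(y)=0$. Let $\mathcal{C}^{(q)}$ be its $q$-ary subfield code: take any generator matrix of $\mathcal{C}_{f_2,g_2}$ and any basis of $\mathbb{F}_{q^m}$ over $\mathbb{F}_q$, and replace each entry of the matrix by the column vector of its coordinates with respect to the basis; the rows of the resulting matrix over $\mathbb{F}_q$ generate $\mathcal{C}^{(q)}$. Let $\mathcal{C}^{(q)\perp}$ be the dual of $\mathcal{C}^{(q)}$ for the standard inner product. An $[n,k,d]$ code has length $n$, dimension $k$ and minimum Hamming distance $d$; a code is a $t$-weight code if its nonzero codewords have exactly $t$ different Hamming weights. A weight distribution is written as a list of pairs $w:A$,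 meaning that exactly $A$ codewords have weight $w$; weights that are not listed do not occur. Then, for every choice of the generator matrix and of the basis: 1. Suppose $q$ and $m$ are even. (a) If $q=2$, then $\mathcal{C}^{(q)}$ is a three-weight $[2^{2m-1}+1,\,2m,\,2^{2m-2}]$ code with weight distribution $0:1$; $\ 2^{2m-2}:2^{2m-1}-2$; $\ 2^{2m-2}+1:2^{2m}-2^{2m-1}$; $\ 2^{2m-1}:1$. Its dual is a $[2^{2m-1}+1,\,2^{2m-1}-2m+1,\,3]$ code. (b) If $l\ge 2$, then $\mathcal{C}^{(q)}$ is a four-weight $[q^{2m-1}+1,\,2m+1,\,(q-2)q^{2m-2}]$ code with weight distribution $0:1$; $\ (q-2)q^{2m-2}:\frac{q(q-1)^2}{2}$; $\ (q-1)q^{2m-2}:q^{2m}-q^3+2q^2-2q$; $\ (q-1)q^{2m-2}+1:q^{2m+1}-q^{2m}$; $\ q^{2m-1}:\frac{(q-1)(q^2-q+2)}{2}$. Its dual is a $[q^{2m-1}+1,\,q^{2m-1}-2m,\,3]$ code. 2. Suppose $q$ is even and $m$ is odd. Then $\mathcal{C}^{(q)}$ is a five-weight $[q^{2m-1}+1,\,2m+1,\,(q-2)q^{2m-2}+1]$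 code with weight distribution $0:1$; $\ (q-2)q^{2m-2}+1:\frac{q(q-1)^2}{2}$; $\ (q-1)q^{2m-2}:q^{2m}-q$; $\ (q-1)q^{2m-2}+1:q^{2m+1}-q^{2m}-q^3+2q^2-q$; $\ q^{2m-1}:q-1$; $\ q^{2m-1}+1:\frac{q(q-1)^2}{2}$. (a) If $q=2$, the dual is a $[2^{2m-1}+1,\,2^{2m-1}-2m,\,4]$ code that is optimal with respect to the sphere-packing bound: no binary linear code of the same length and dimension has a minimum distance greater than $4$, and for every $d'>4$ the inequality $2^n\ge 2^k\sum_{i=0}^{\lfloor (d'-1)/2\rfloor}\binom{n}{i}$ fails for $n=2^{2m-1}+1$, $k=2^{2m-1}-2m$. (b) If $l\ge 2$, the dual is a $[q^{2m-1}+1,\,q^{2m-1}-2m,\,3]$ code. 3. Suppose $q$ and $m$ are odd. (a) If $p\mid m$, then $\mathcal{C}^{(q)}$ is a five-weight $[q^{2m-1}+1,\,2m+1,\,(q-1)q^{2m-2}-q^{\frac{3m-3}{2}}]$ code with weight distribution $0:1$; $\ (q-1)q^{2m-2}\pm q^{\frac{3m-3}{2}}:\frac{q^{m+2}-2q^{m+1}+q^m}{2}$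 for each of the two signs; $\ (q-1)q^{2m-2}:q^{2m}-q^{m+2}+2q^{m+1}-q^m-q$; $\ (q-1)q^{2m-2}+1:q^{2m+1}-q^{2m}$; $\ q^{2m-1}:q-1$. (b) If $p\nmid m$, then $\mathcal{C}^{(q)}$ is a five-weight $[q^{2m-1}+1,\,2m+1,\,(q-1)q^{2m-2}-q^{\frac{3m-3}{2}}+1]$ code with weight distribution $0:1$; $\ (q-1)q^{2m-2}\pm q^{\frac{3m-3}{2}}+1:\frac{q^{m+2}-2q^{m+1}+q^m}{2}$ for each of the two signs; $\ (q-1)q^{2m-2}:q^{2m}-q$; $\ (q-1)q^{2m-2}+1:q^{2m+1}-q^{2m}-q^{m+2}+2q^{m+1}-q^m$; $\ q^{2m-1}:q-1$. (c) In both cases the dual is a $[q^{2m-1}+1,\,q^{2m-1}-2m,\,3]$ code. 4. Suppose $q$ is odd and $m$ is even, and put $\varepsilon=(-1)^{\frac{lm(p-1)}{4}}$. (a) If $p\mid m$, then $\mathcal{C}^{(q)}$ is a five-weight $[q^{2m-1}+1,\,2m+1]$ code with weight distribution $0:1$; $\ (q-1)q^{2m-2}-\varepsilon q^{\frac{3m-4}{2}}:q^m(q-1)^2$;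 $\ (q-1)q^{2m-2}+\varepsilon(q-1)q^{\frac{3m-4}{2}}:q^{m+1}-q^m$; $\ (q-1)q^{2m-2}:q^{2m}-q^{m+2}+q^{m+1}-q$; $\ (q-1)q^{2m-2}+1:q^{2m+1}-q^{2m}$; $\ q^{2m-1}:q-1$. (b) If $p\nmid m$, then $\mathcal{C}^{(q)}$ is a five-weight $[q^{2m-1}+1,\,2m+1]$ code with weight distribution $0:1$; $\ (q-1)q^{2m-2}-\varepsilon q^{\frac{3m-4}{2}}+1:q^m(q-1)^2$; $\ (q-1)q^{2m-2}+\varepsilon(q-1)q^{\frac{3m-4}{2}}+1:q^{m+1}-q^m$; $\ (q-1)q^{2m-2}:q^{2m}-q$; $\ (q-1)q^{2m-2}+1:q^{2m+1}-q^{2m}-q^{m+2}+q^{m+1}$; $\ q^{2m-1}:q-1$. (c) In both cases the dual is a $[q^{2m-1}+1,\,q^{2m-1}-2m,\,3]$ code. -/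

import Mathlib

/-! Linear codes over a finite field `F`, with coordinates indexed by a finite type `ι`: they are
the `F`-subspaces of `ι → F`, and the length is the cardinality of `ι`. -/

/-- The number `A_w` of codewords of Hamming weight `w`. -/
noncomputable def weightCount {F ι : Type*} [Field F] [DecidableEq F] [Fintype ι]
    (C : Submodule F (ι → F)) (w : ℕ) : ℕ :=
  Set.ncard {c : ι → F | c ∈ C ∧ hammingNorm c = w}

/-- `d` is the minimum Hamming distance between two different codewords of `C`. -/
def IsMinDist {F ι : Type*} [Field F] [DecidableEq F] [Fintype ι]
    (C : Submodule F (ι → F)) (d : ℕ) : Prop :=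
  IsLeast {e : ℕ | ∃ x ∈ C, ∃ y ∈ C, x ≠ y ∧ hammingDist x y = e} d

/-- `C` is an `[n, k]` linear code. -/
def HasLengthDim {F ι : Type*} [Field F] [Fintype ι]
    (C : Submodule F (ι → F)) (n k : ℕ) : Prop :=
  Fintype.card ι = n ∧ Module.finrank F C = k

/-- `C` is an `[n, k, d]` linear code. -/
def HasParams {F ι : Type*} [Field F] [DecidableEq F] [Fintype ι]
    (C : Submodule F (ι → F)) (n k d : ℕ) : Prop :=
  HasLengthDim C n k ∧ IsMinDist C d

/-- `C` is a `t`-weight code: exactly `t` of the numbers `A_1, …, A_n` are nonzero. -/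
def IsWeightCode {F ι : Type*} [Field F] [DecidableEq F] [Fintype ι]
    (C : Submodule F (ι → F)) (t : ℕ) : Prop :=
  ((Finset.Icc 1 (Fintype.card ι)).filter (fun w => weightCount C w ≠ 0)).card = t

/-- The weight distribution of `C` is given by the table `T` with rows (weight, multiplicity):
the rows have different weights, each row `(w, A)` says that exactly `A` codewords have weight `w`,
and no codeword has a weight that is not listed. -/
def HasWeightTable {F ι : Type*} [Field F] [DecidableEq F] [Fintype ι]
    (C : Submodule F (ι → F)) (T : List (ℤ × ℤ)) : Prop :=
  (T.map Prod.fst).Nodup ∧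
  (∀ r ∈ T, ∃ w : ℕ, (w : ℤ) = r.1 ∧ (weightCount C w : ℤ) = r.2) ∧
  (∀ w : ℕ, (w : ℤ) ∉ T.map Prod.fst → weightCount C w = 0)

/-- The dual code with respect to the standard inner product. -/
def dualCode {F ι : Type*} [Field F] [Fintype ι]
    (C : Submodule F (ι → F)) : Submodule F (ι → F) where
  carrier := {x | ∀ c ∈ C, x ⬝ᵥ c = 0}
  zero_mem' := fun c _ => zero_dotProduct c
  add_mem' := fun {x y} hx hy c hc => by rw [add_dotProduct, hx c hc, hy c hc, add_zero]
  smul_mem' := fun a x hx c hc => by rw [smul_dotProduct, hx c hc, smul_zero]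

/-- The inequality of the sphere-packing bound for `q`-ary `[n, k, d]` codes. -/
def SpherePackingBound (q n k d : ℕ) : Prop :=
  q ^ k * ∑ i ∈ Finset.range ((d - 1) / 2 + 1), n.choose i * (q - 1) ^ i ≤ q ^ n

/-- `C` is an `[n, k, d]` code that is optimal with respect to the sphere-packing bound:
there is no `[n, k, d']` code with `d' > d`, and already the sphere-packing bound excludes the
parameters `[n, k, d']` for all `d' > d`. -/
def IsOptimalSpherePacking {F ι : Type*} [Field F] [Fintype F] [DecidableEq F] [Fintype ι]
    (C : Submodule F (ι → F)) (n k d : ℕ) : Prop :=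
  HasParams C n k d ∧
  (∀ d' : ℕ, d < d' → ¬ ∃ C' : Submodule F (Fin n → F), HasParams C' n k d') ∧
  (∀ d' : ℕ, d < d' → ¬ SpherePackingBound (Fintype.card F) n k d')

/-- `G` is a generator matrix of `C`: its rows form a basis of `C`. -/
def IsGeneratorMatrix {K ι κ : Type*} [Field K] (G : Matrix κ ι K)
    (C : Submodule K (ι → K)) : Prop :=
  LinearIndependent K G.row ∧ Submodule.span K (Set.range G.row) = C

/-- The subfield code obtained from a generator matrix `G` over `K` and a basis `B` of `K` over
`F`: each entry of `G` is replaced by the column vector of its coordinates with respect to `B`, and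
the rows of the resulting matrix generate the code over `F`. -/
noncomputable def subfieldCode {F K ι κ μ : Type*} [Field F] [Field K] [Algebra F K]
    (G : Matrix κ ι K) (B : Module.Basis μ F K) : Submodule F (ι → F) :=
  Submodule.span F
    (Set.range (Matrix.row (Matrix.of fun (r : κ × μ) (j : ι) => B.repr (G r.1 j) r.2)))

/-- The set `{(x, y) ∈ K² : f(x) + g(y) = 0}`. -/
abbrev solutionSet {F K : Type*} [Field F] (f g : K → F) : Type _ :=
  {z : K × K // f z.1 + g z.2 = 0}

/-- The `3`-row matrix whose columns are `(0, 1, 0)ᵀ` and `(1, x, y)ᵀ` for all `(x, y)` with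
`f(x) + g(y) = 0`. -/
def matrixG {F K : Type*} [Field F] [Field K] (f g : K → F) :
    Matrix (Fin 3) (Option (solutionSet f g)) K :=
  Matrix.of fun i j => match j with
    | none => ![0, 1, 0] i
    | some z => ![1, z.1.1, z.1.2] i

/-- The linear code `C_{f,g}` over `K` generated by the rows of `matrixG f g`. -/
def codeC {F K : Type*} [Field F] [Field K] (f g : K → F) :
    Submodule K (Option (solutionSet f g) → K) :=
  Submodule.span K (Set.range (matrixG f g).row)

/-- `f₂(x) = Tr_{K/F}(x)`. -/
noncomputable def f₂ (F K : Type*) [Field F] [Field K] [Algebra F K] : K → F :=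
  fun x => Algebra.trace F K x

/-- `g₂(y) = Tr_{K/F}(y²)`. -/
noncomputable def g₂ (F K : Type*) [Field F] [Field K] [Algebra F K] : K → F :=
  fun y => Algebra.trace F K (y ^ 2)

/-! ### Weight tables, minimum distance and dual codes -/

/-! Every F-linear functional on K has the form x ↦ Tr(αx), so the subfield code is the
coordinatewise trace of the K-code, whatever generator matrix and basis are used
(`subfieldCode_eq_range_encode`). Its words are indexed by (a, b, c) ∈ F × K × K: the extra
coordinate is Tr(b), and the coordinate at a point (x, y) of the solution set S is a + Tr(bx) +
Tr(cy). Weights are therefore obtained by counting zeros on S.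

If b ∉ F, then Tr(x) and Tr(bx) are independent and the number of zeros is always q^(2m-2). If b = β
∈ F, then Tr(βx) = -β Tr(y²) on S, and the number of zeros is q^(m-1) times the number of y with β
Tr(y²) = a + Tr(cy). The extra coordinate is then Tr(β) = mβ, which is why the tables depend on
whether p divides m. `card_hammingNorm_encode` reduces everything to these conic counts for β ≠ 0.

In characteristic 2, Tr(y²) = Tr(y)². The count is uniform for c ∉ F, and for c = γ ∈ F it is
governed by the roots of βs² - γs = a in F: one root if γ = 0, otherwise none or two, each for half
of the a.

In odd characteristic, completing the square turns the count into N(t) = #{z : Tr(z²) = t}, and for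
fixed β and c the argument t runs once through F as a does. No Gauss sum is needed: x² - y² = (x +
y)(x - y) gives the second moment of N (`sum_squareTraceCount_sq`). For m odd, nonsquares of F stay
nonsquares in K, so N(t) = q^(m-1) + χ(t)E with χ the quadratic character, and the moment gives E² =
q^(m-1). For m even, the case m = 2 follows from two moments and a sign argument modulo 4; the
general case follows by transitivity of the trace through the subfield of index 2.

The dimension comes from the number of triples encoded to the zero word; only q = 2 with m even has
a nontrivial kernel. Words of the dual are the F-linear relations between the columns. Two distinct
columns are always independent, and relations of length three or four are written down explicitly.
Optimality in the binary case is a pigeonhole argument on cosets. -/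

theorem finrank_dualCode {F ι : Type*} [Field F] [Fintype ι]
    (C : Submodule F (ι → F)) :
    Module.finrank F (dualCode C) = Fintype.card ι - Module.finrank F C := by
  classical
  have hnd : (Matrix.toBilin' (1 : Matrix ι ι F)).Nondegenerate :=
    Matrix.Nondegenerate.toBilin' (Matrix.nondegenerate_of_det_ne_zero (by simp))
  have happ : ∀ x y : ι → F, Matrix.toBilin' (1 : Matrix ι ι F) x y = x ⬝ᵥ y := fun x y => by
    rw [Matrix.toBilin'_apply', Matrix.one_mulVec]
  have heq : dualCode C = (Matrix.toBilin' (1 : Matrix ι ι F)).orthogonal C := by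
    ext x
    rw [LinearMap.BilinForm.mem_orthogonal_iff]
    refine forall₂_congr fun c _ => ?_
    rw [happ, dotProduct_comm]
  rw [heq, LinearMap.BilinForm.finrank_orthogonal hnd, Module.finrank_fintype_fun_eq_card]

section LinearCodes

variable {F ι : Type*} [Field F] [DecidableEq F] [Fintype ι]

theorem isMinDist_of_hammingNorm {C : Submodule F (ι → F)} {d : ℕ} (hd : 0 < d)
    (hex : ∃ c ∈ C, hammingNorm c = d) (hle : ∀ c ∈ C, c ≠ 0 → d ≤ hammingNorm c) :
    IsMinDist C d := by
  constructor
  · obtain ⟨c, hc, hcd⟩ := hex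
    refine ⟨c, hc, 0, C.zero_mem, ?_, by simpa using hcd⟩
    rintro rfl
    simp at hcd
    omega
  · rintro e ⟨x, hx, y, hy, hxy, rfl⟩
    rw [hammingDist_comm, hammingDist_eq_hammingNorm, neg_add_eq_sub]
    exact hle _ (C.sub_mem hx hy) (sub_ne_zero.mpr hxy)

theorem weightCount_ne_zero_iff [Finite F] {C : Submodule F (ι → F)} {w : ℕ} :
    weightCount C w ≠ 0 ↔ ∃ c ∈ C, hammingNorm c = w := by
  rw [weightCount, Ne, Set.ncard_eq_zero (Set.toFinite _), ← Ne, ← Set.nonempty_iff_ne_empty]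
  exact Iff.rfl

/-- The value at `w` of the distribution described by a table, as a sum over its rows. -/
def tableSum (T : List (ℤ × ℤ)) (w : ℤ) : ℤ :=
  (T.map fun r => if w = r.1 then r.2 else 0).sum

theorem tableSum_of_notMem {T : List (ℤ × ℤ)} {w : ℤ} (h : w ∉ T.map Prod.fst) :
    tableSum T w = 0 := by
  induction T with
  | nil => rfl
  | cons r T ih =>
    simp only [List.map_cons, List.mem_cons, not_or] at h
    have := ih h.2
    simp only [tableSum, List.map_cons, List.sum_cons, if_neg h.1, zero_add] at this ⊢
    exact this

theorem tableSum_of_mem {T : List (ℤ × ℤ)} (hT : (T.map Prod.fst).Nodup) {r : ℤ × ℤ}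
    (hr : r ∈ T) : tableSum T r.1 = r.2 := by
  induction T with
  | nil => simp at hr
  | cons s T ih =>
    rw [List.map_cons, List.nodup_cons] at hT
    have hcons : tableSum (s :: T) r.1 = (if r.1 = s.1 then s.2 else 0) + tableSum T r.1 := rfl
    rw [hcons]
    rcases List.mem_cons.mp hr with rfl | h
    · rw [if_pos rfl, tableSum_of_notMem hT.1, add_zero]
    · rw [ih hT.2 h, if_neg, zero_add]
      intro e
      exact hT.1 (e ▸ List.mem_map_of_mem h)

/-- Turns a whole table into one identity between functions of w, which can be checked by splitting
on the values of w. Distinctness of the weights is what allows a single multiplicity to be read off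
the sum. -/
theorem hasWeightTable_of_tableSum {C : Submodule F (ι → F)} {T : List (ℤ × ℤ)}
    (hT : (T.map Prod.fst).Nodup) (hnn : ∀ r ∈ T, 0 ≤ r.1)
    (h : ∀ w : ℕ, (weightCount C w : ℤ) = tableSum T w) : HasWeightTable C T := by
  refine ⟨hT, fun r hr => ⟨r.1.toNat, Int.toNat_of_nonneg (hnn r hr), ?_⟩, fun w hw => ?_⟩
  · rw [h, Int.toNat_of_nonneg (hnn r hr), tableSum_of_mem hT hr]
  · have := h w
    rw [tableSum_of_notMem hw] at this
    exact_mod_cast this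

theorem HasWeightTable.isWeightCode [Finite F] {C : Submodule F (ι → F)} {A : ℤ}
    {T : List (ℤ × ℤ)} (h : HasWeightTable C ((0, A) :: T)) (hne : ∀ r ∈ T, r.2 ≠ 0) {t : ℕ}
    (ht : T.length = t) : IsWeightCode C t := by
  classical
  obtain ⟨hnd, hrow, hout⟩ := h
  rw [List.map_cons, List.nodup_cons] at hnd
  have hinj : Set.InjOn (fun w : ℕ => (w : ℤ))
      ((Finset.Icc 1 (Fintype.card ι)).filter (fun w => weightCount C w ≠ 0)) :=
    Nat.cast_injective.injOn
  rw [IsWeightCode, ← Finset.card_image_of_injOn hinj, ← ht, ← List.length_map (f := Prod.fst),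
    ← List.toFinset_card_of_nodup hnd.2]
  congr 1
  ext v
  simp only [Finset.mem_image, Finset.mem_filter, Finset.mem_Icc, List.mem_toFinset]
  constructor
  · rintro ⟨w, ⟨⟨hw, -⟩, hwC⟩, rfl⟩
    by_contra hcon
    refine hwC (hout w ?_)
    rw [List.map_cons, List.mem_cons, not_or]
    exact ⟨by simp; omega, hcon⟩
  · intro hv
    obtain ⟨r, hr, rfl⟩ := List.mem_map.mp hv
    obtain ⟨w, hw, hwc⟩ := hrow r (List.mem_cons_of_mem _ hr)
    have hw0 : weightCount C w ≠ 0 := fun e => hne r hr (by rw [← hwc, e]; rfl)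
    refine ⟨w, ⟨⟨?_, ?_⟩, hw0⟩, hw⟩
    · rw [Nat.one_le_iff_ne_zero]
      rintro rfl
      exact hnd.1 (by simpa [← hw] using hv)
    · obtain ⟨c, -, rfl⟩ := weightCount_ne_zero_iff.mp hw0
      exact hammingNorm_le_card_fintype

theorem HasWeightTable.isMinDist [Finite F] {C : Submodule F (ι → F)} {A : ℤ}
    {T : List (ℤ × ℤ)} (h : HasWeightTable C ((0, A) :: T)) {d : ℕ} (hd : 0 < d)
    (hex : ∃ r ∈ T, r.1 = d ∧ r.2 ≠ 0) (hle : ∀ r ∈ T, (d : ℤ) ≤ r.1) : IsMinDist C d := by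
  obtain ⟨-, hrow, hout⟩ := h
  refine isMinDist_of_hammingNorm hd ?_ fun c hc hc0 => ?_
  · obtain ⟨r, hr, hrd, hr0⟩ := hex
    obtain ⟨w, hw, hwc⟩ := hrow r (List.mem_cons_of_mem _ hr)
    have : w = d := by exact_mod_cast hw.trans hrd
    subst this
    exact weightCount_ne_zero_iff.mp fun e => hr0 (by rw [← hwc, e]; rfl)
  · by_contra hlt
    refine weightCount_ne_zero_iff.mpr ⟨c, hc, rfl⟩ (hout _ ?_)
    simp only [List.map_cons, List.mem_cons, not_or]
    refine ⟨by simpa using hc0, fun hmem => ?_⟩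
    obtain ⟨r, hr, hrc⟩ := List.mem_map.mp hmem
    have := hle r hr
    rw [hrc] at this
    exact hlt (by exact_mod_cast this)

/-- If every `k` of the vectors `h i` are linearly independent, then a nonzero linear relation
between the `h i` involves more than `k` of them. -/
theorem lt_hammingNorm_of_sum_smul_eq_zero {V : Type*} [AddCommGroup V] [Module F V] {h : ι → V}
    {k : ℕ} (hk : k ≤ Fintype.card ι)
    (hind : ∀ s : Finset ι, s.card = k → ∀ x : ι → F, ∑ i ∈ s, x i • h i = 0 → ∀ i ∈ s, x i = 0)
    {x : ι → F} (hx : x ≠ 0) (hsum : ∑ i, x i • h i = 0) : k < hammingNorm x := by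
  by_contra hle
  -- The support is padded to exactly k indices, which `hk` makes possible, because `hind` only
  -- concerns sets of size k.
  obtain ⟨s, hs, hsk⟩ := Finset.exists_superset_card_eq (not_lt.mp hle) hk
  have hzero : ∀ i, i ∉ s → x i = 0 := fun i hi => by
    by_contra h0
    exact hi (hs (by simpa using h0))
  refine hx (funext fun i => ?_)
  by_cases hi : i ∈ s
  · refine hind s hsk x ?_ i hi
    rw [← hsum]
    exact Finset.sum_subset (Finset.subset_univ s) fun j _ hj => by rw [hzero j hj, zero_smul]
  · exact hzero i hi

theorem hammingNorm_indicator {s : Finset ι} [DecidableEq ι] {x : ι → F}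
    (hx : ∀ i ∈ s, x i ≠ 0) : hammingNorm (fun i => if i ∈ s then x i else 0) = s.card := by
  rw [hammingNorm]
  congr 1
  ext i
  simpa using hx i

/-- A binary `[n, k]` code with `2 ^ (n - k) < n.choose 2` has minimum distance at most `4`. -/
theorem not_isMinDist_of_lt_choose [Fintype F] (hF : Fintype.card F = 2)
    {C : Submodule F (ι → F)} {d : ℕ} (hd : 4 < d)
    (hlt : 2 ^ (Fintype.card ι - Module.finrank F C) < (Fintype.card ι).choose 2) :
    ¬ IsMinDist C d := by
  classical
  intro hmin
  let _ : Fintype ((ι → F) ⧸ C) := Fintype.ofFinite _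
  let ind : Finset ι → ι → F := fun s i => if i ∈ s then 1 else 0
  have hind : ∀ s, hammingNorm (ind s) = s.card := fun s =>
    hammingNorm_indicator (x := fun _ => (1 : F)) fun _ _ => one_ne_zero
  -- There are more pairs of positions than cosets of C, so two distinct words of weight 2 are
  -- congruent modulo C. Their difference is a nonzero codeword of weight at most 4.
  have hcard : (Finset.univ : Finset ((ι → F) ⧸ C)).card <
      ((Finset.univ : Finset ι).powersetCard 2).card := by
    rw [Finset.card_powersetCard, Finset.card_univ, Finset.card_univ,
      Module.card_eq_pow_finrank (K := F), hF, Submodule.finrank_quotient,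
      Module.finrank_fintype_fun_eq_card]
    exact hlt
  obtain ⟨s, hs, t, ht, hst, he⟩ := Finset.exists_ne_map_eq_of_card_lt_of_maps_to hcard
    (f := fun s => Submodule.Quotient.mk (p := C) (ind s)) fun _ _ => Finset.mem_univ _
  have hne : ind s ≠ ind t := fun e => hst <| by
    ext i
    have := congrFun e i
    by_cases h1 : i ∈ s <;> by_cases h2 : i ∈ t <;> simp_all [ind]
  have hle : hammingDist (ind s - ind t) 0 ≤ 4 := by
    rw [hammingDist_zero_right, ← neg_add_eq_sub, ← hammingDist_eq_hammingNorm]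
    refine (hammingDist_triangle _ 0 _).trans ?_
    rw [hammingDist_zero_right, hammingDist_zero_left, hind, hind,
      (Finset.mem_powersetCard.mp hs).2, (Finset.mem_powersetCard.mp ht).2]
  have := hmin.2 ⟨_, (Submodule.Quotient.eq C).mp he, 0, C.zero_mem, sub_ne_zero.mpr hne, rfl⟩
  omega

/-- For d' > 4 the packing radius is at least 2, and the single term n.choose 2 of the ball already
exceeds 2^(n-k). Nonexistence of better codes uses the same inequality through the coset argument.
-/
theorem isOptimalSpherePacking_four [Fintype F] (hF : Fintype.card F = 2)
    {C : Submodule F (ι → F)} {n k : ℕ} (hC : HasParams C n k 4) (hk : k ≤ n)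
    (hlt : 2 ^ (n - k) < n.choose 2) : IsOptimalSpherePacking C n k 4 := by
  refine ⟨hC, ?_, ?_⟩
  · rintro d hd ⟨C', ⟨hn', hk'⟩, hd'⟩
    refine not_isMinDist_of_lt_choose hF hd ?_ hd'
    rwa [hn', hk']
  · intro d hd h
    rw [SpherePackingBound, hF] at h
    have h1 : n.choose 2 ≤ ∑ i ∈ Finset.range ((d - 1) / 2 + 1), n.choose i * (2 - 1) ^ i := by
      have := Finset.single_le_sum (f := fun i => n.choose i * (2 - 1) ^ i)
        (fun _ _ => Nat.zero_le _) (Finset.mem_range.mpr (show 2 < (d - 1) / 2 + 1 by omega))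
      simpa using this
    have h2 : 2 ^ n = 2 ^ k * 2 ^ (n - k) := by rw [← pow_add, Nat.add_sub_cancel' hk]
    rw [h2] at h
    have := Nat.le_of_mul_le_mul_left h (by positivity)
    omega

end LinearCodes
/-! ### The subfield code as the image of a trace encoding -/

theorem exists_trace_mul_eq {F K : Type*} [Field F] [Field K] [Algebra F K] [FiniteDimensional F K]
    [Algebra.IsSeparable F K] (φ : K →ₗ[F] F) : ∃ a : K, ∀ x, φ x = Algebra.trace F K (a * x) := by
  obtain ⟨a, ha⟩ := ((Algebra.traceForm F K).toDual (traceForm_nondegenerate F K)).surjective φ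
  exact ⟨a, fun x => by rw [← ha, LinearMap.BilinForm.toDual_def, Algebra.traceForm_apply]⟩

theorem eq_zero_of_trace_mul_eq_zero {F K : Type*} [Field F] [Field K] [Algebra F K]
    [FiniteDimensional F K] [Algebra.IsSeparable F K] {a : K}
    (h : ∀ x, Algebra.trace F K (x * a) = 0) : a = 0 :=
  (traceForm_nondegenerate F K).2 a h

/-- A coordinate functional of the basis is x ↦ Tr(αx), so a row of the expanded matrix is the trace
of a K-multiple of a row of G. Conversely, the trace is an F-combination of the coordinate
functionals. The right side depends only on the K-code, hence not on G or B. -/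
theorem subfieldCode_eq_map_trace {F K ι κ μ : Type*} [Field F] [Field K] [Algebra F K]
    [FiniteDimensional F K] [Algebra.IsSeparable F K] [Fintype μ] (G : Matrix κ ι K)
    (B : Module.Basis μ F K) :
    subfieldCode G B = ((Submodule.span K (Set.range G.row)).restrictScalars F).map
      ((Algebra.trace F K).compLeft ι) := by
  apply le_antisymm
  · rw [subfieldCode, Submodule.span_le]
    rintro _ ⟨⟨r, j⟩, rfl⟩
    obtain ⟨a, ha⟩ := exists_trace_mul_eq (B.coord j)
    have hmem : a • G.row r ∈ Submodule.span K (Set.range G.row) :=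
      Submodule.smul_mem _ _ (Submodule.subset_span ⟨r, rfl⟩)
    exact ⟨a • G.row r, hmem, funext fun i => (ha _).symm⟩
  -- All functionals are treated at once so that the induction passes through scalars of K: φ
  -- applied to a·x is another functional applied to x.
  · have key : ∀ w ∈ Submodule.span K (Set.range G.row), ∀ φ : K →ₗ[F] F,
        φ.compLeft ι w ∈ subfieldCode G B := by
      intro w hw
      induction hw using Submodule.span_induction with
      | mem w hw =>
        obtain ⟨r, rfl⟩ := hw
        intro φ
        have : φ.compLeft ι (G.row r) = ∑ j, φ (B j) •
            Matrix.row (Matrix.of fun (r : κ × μ) (i : ι) => B.repr (G r.1 i) r.2) (r, j) := by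
          funext i
          have h := congrArg φ (B.sum_repr (G r i))
          rw [map_sum] at h
          simp only [LinearMap.compLeft_apply, Finset.sum_apply, Pi.smul_apply, Matrix.row_apply,
            Matrix.of_apply, smul_eq_mul, Function.comp_apply]
          rw [← h]
          exact Finset.sum_congr rfl fun j _ => by rw [map_smul, smul_eq_mul, mul_comm]
        rw [this]
        exact Submodule.sum_mem _ fun j _ =>
          Submodule.smul_mem _ _ (Submodule.subset_span ⟨(r, j), rfl⟩)
      | zero => intro φ; rw [map_zero]; exact Submodule.zero_mem _
      | add x y _ _ hx hy => intro φ; rw [map_add]; exact Submodule.add_mem _ (hx φ) (hy φ)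
      | smul a x _ hx => intro φ; exact hx (φ.comp (LinearMap.mulLeft F a))
    rintro _ ⟨w, hw, rfl⟩
    exact key w hw _

section Encoding

variable {F K : Type*} [Field F] [Field K] [Algebra F K]

/-- The bilinear form `a₁ a₂ + Tr(b₁ b₂) + Tr(c₁ c₂)` on `F × K × K`. -/
noncomputable def tracePairing (F K : Type*) [Field F] [Field K] [Algebra F K] :
    (F × K × K) →ₗ[F] (F × K × K) →ₗ[F] F :=
  LinearMap.mk₂ F
    (fun u v => u.1 * v.1 + Algebra.trace F K (u.2.1 * v.2.1) + Algebra.trace F K (u.2.2 * v.2.2))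
    (fun u u' v => by simp only [Prod.fst_add, Prod.snd_add, add_mul, map_add]; ring)
    (fun c u v => by
      simp only [Prod.smul_fst, Prod.smul_snd, smul_mul_assoc, map_smul, smul_eq_mul]; ring)
    (fun u v v' => by simp only [Prod.fst_add, Prod.snd_add, mul_add, map_add]; ring)
    (fun c u v => by
      simp only [Prod.smul_fst, Prod.smul_snd, mul_smul_comm, map_smul, smul_eq_mul]; ring)

theorem tracePairing_apply (u v : F × K × K) : tracePairing F K u v =
    u.1 * v.1 + Algebra.trace F K (u.2.1 * v.2.1) + Algebra.trace F K (u.2.2 * v.2.2) := rfl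

theorem eq_zero_of_tracePairing_eq_zero [FiniteDimensional F K] [Algebra.IsSeparable F K]
    {v : F × K × K} (h : ∀ u, tracePairing F K u v = 0) : v = 0 := by
  refine Prod.ext ?_ (Prod.ext ?_ ?_)
  · simpa [tracePairing_apply] using h (1, 0, 0)
  · exact eq_zero_of_trace_mul_eq_zero (F := F) fun x => by
      simpa [tracePairing_apply] using h (0, x, 0)
  · exact eq_zero_of_trace_mul_eq_zero (F := F) fun x => by
      simpa [tracePairing_apply] using h (0, 0, x)

/-- The columns of `matrixG f g`, with first coordinate in the small field. -/
def column (f g : K → F) : Option (solutionSet f g) → F × K × K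
  | none => (0, 1, 0)
  | some z => (1, z.1.1, z.1.2)

/-- The codeword of length `|S| + 1` that belongs to `(a, b, c)`. -/
noncomputable def encode (f g : K → F) : (F × K × K) →ₗ[F] (Option (solutionSet f g) → F) :=
  LinearMap.pi fun j => (tracePairing F K).flip (column f g j)

theorem encode_apply (f g : K → F) (u : F × K × K) (j : Option (solutionSet f g)) :
    encode f g u j = tracePairing F K u (column f g j) := rfl

theorem encode_none (f g : K → F) (u : F × K × K) :
    encode f g u none = Algebra.trace F K u.2.1 := by
  simp [encode_apply, tracePairing_apply, column]

theorem encode_some (f g : K → F) (u : F × K × K) (z : solutionSet f g) :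
    encode f g u (some z) =
      u.1 + Algebra.trace F K (u.2.1 * z.1.1) + Algebra.trace F K (u.2.2 * z.1.2) := by
  simp [encode_apply, tracePairing_apply, column]

/-- The first row has entries 0 and 1 only, so its coefficient matters only through its trace. This
is why the first component of a message lies in F and not in K. -/
theorem trace_compLeft_matrixG (f g : K → F) (a : Fin 3 → K) :
    (Algebra.trace F K).compLeft _ (∑ i, a i • (matrixG f g).row i) =
      encode f g (Algebra.trace F K (a 0), a 1, a 2) := by
  funext j
  cases j with
  | none =>
    rw [encode_none]
    simp [Fin.sum_univ_three, matrixG]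
  | some z =>
    rw [encode_some]
    simp [Fin.sum_univ_three, matrixG]

theorem subfieldCode_eq_range_encode [FiniteDimensional F K] [Algebra.IsSeparable F K]
    {κ μ : Type*} [Fintype μ] {f g : K → F} {G : Matrix κ (Option (solutionSet f g)) K}
    (hG : IsGeneratorMatrix G (codeC f g)) (B : Module.Basis μ F K) :
    subfieldCode G B = LinearMap.range (encode f g) := by
  rw [subfieldCode_eq_map_trace, hG.2, codeC]
  ext x
  constructor
  · rintro ⟨w, hw, rfl⟩
    obtain ⟨a, rfl⟩ := Submodule.mem_span_range_iff_exists_fun K |>.mp hw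
    exact ⟨_, (trace_compLeft_matrixG f g a).symm⟩
  · rintro ⟨⟨a, b, c⟩, rfl⟩
    obtain ⟨α, rfl⟩ := Algebra.trace_surjective F K a
    exact ⟨_, Submodule.mem_span_range_iff_exists_fun K |>.mpr ⟨![α, b, c], rfl⟩,
      trace_compLeft_matrixG f g ![α, b, c]⟩

/-- The product of x with the word of u is the pairing of u with ∑ x_j · column_j, and the pairing
is nondegenerate. -/
theorem mem_dualCode_range_encode [FiniteDimensional F K] [Algebra.IsSeparable F K]
    {f g : K → F} [Fintype (Option (solutionSet f g))] {x : Option (solutionSet f g) → F} :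
    x ∈ dualCode (LinearMap.range (encode f g)) ↔ ∑ j, x j • column f g j = 0 := by
  have key : ∀ u, x ⬝ᵥ encode f g u = tracePairing F K u (∑ j, x j • column f g j) := fun u => by
    rw [map_sum, dotProduct]
    exact Finset.sum_congr rfl fun j _ => by rw [map_smul, smul_eq_mul, encode_apply]
  constructor
  · intro h
    exact eq_zero_of_tracePairing_eq_zero fun u => by rw [← key]; exact h _ ⟨u, rfl⟩
  · rintro h _ ⟨u, rfl⟩
    rw [key, h, map_zero]

/-- The weight distribution of the range of a linear map, from that of its domain. -/
theorem card_ker_mul_weightCount {ι V : Type*} [DecidableEq F] [Fintype ι] [AddCommGroup V]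
    [Module F V] [Fintype V] [Finite F] (φ : V →ₗ[F] (ι → F)) (w : ℕ) :
    (Finset.univ.filter fun v => hammingNorm (φ v) = 0).card *
      weightCount (LinearMap.range φ) w =
      (Finset.univ.filter fun v => hammingNorm (φ v) = w).card := by
  classical
  let _ := Fintype.ofFinite F
  have hs : {c : ι → F | c ∈ LinearMap.range φ ∧ hammingNorm c = w} =
      ↑((Finset.univ.filter fun v => hammingNorm (φ v) = w).image φ) := by
    ext c
    simp only [Set.mem_ofPred_eq, Finset.coe_image, Finset.coe_filter, Finset.mem_univ, true_and,
      Set.mem_image]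
    constructor
    · rintro ⟨⟨v, rfl⟩, h⟩
      exact ⟨v, h, rfl⟩
    · rintro ⟨v, h, rfl⟩
      exact ⟨⟨v, rfl⟩, h⟩
  rw [weightCount, hs, Set.ncard_coe_finset, mul_comm]
  refine (Finset.card_eq_sum_card_image φ _).trans ?_ |>.symm
  rw [← smul_eq_mul, ← Finset.sum_const]
  refine Finset.sum_congr rfl fun c hc => ?_
  obtain ⟨v, hv, rfl⟩ := Finset.mem_image.mp hc
  have hv' : hammingNorm (φ v) = w := by simpa using hv
  -- Each codeword has as many preimages as the zero word.
  have h1 := AddMonoidHom.card_fiber_eq_of_mem_range φ (x := φ v) (y := 0) ⟨v, rfl⟩ ⟨0, map_zero φ⟩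
  rw [Finset.filter_filter]
  simp only [hammingNorm_eq_zero]
  rw [← h1]
  congr 1
  ext v'
  simp only [Finset.mem_filter, Finset.mem_univ, true_and]
  exact ⟨fun h => h.2, fun h => ⟨by rw [h, hv'], h⟩⟩

end Encoding
/-! ### Counting with traces -/

theorem card_fiber_mul_card {F V W : Type*} [Field F] [AddCommGroup V] [Module F V]
    [AddCommGroup W] [Module F W] [Fintype V] [Fintype W] [DecidableEq W] (f : V →ₗ[F] W)
    (hf : Function.Surjective f) (w : W) :
    (Finset.univ.filter fun v => f v = w).card * Fintype.card W = Fintype.card V := by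
  have h : ∀ w', (Finset.univ.filter fun v => f v = w').card =
      (Finset.univ.filter fun v => f v = w).card := fun w' =>
    AddMonoidHom.card_fiber_eq_of_mem_range f (hf w') (hf w)
  have hsum : Fintype.card V = ∑ w', (Finset.univ.filter fun v => f v = w').card :=
    Finset.card_eq_sum_card_fiberwise fun _ _ => Finset.mem_coe.mpr (Finset.mem_univ _)
  rw [hsum, Finset.sum_congr rfl fun w' _ => h w', Finset.sum_const, Finset.card_univ,
    smul_eq_mul, mul_comm]

theorem card_filter_prod {α β : Type*} [Fintype α] [Fintype β] (p : α → β → Prop)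
    [∀ a b, Decidable (p a b)] :
    (Finset.univ.filter fun z : α × β => p z.1 z.2).card =
      ∑ b, (Finset.univ.filter fun a => p a b).card := by
  simp only [Finset.card_filter]
  rw [Fintype.sum_prod_type_right]

theorem card_eq_pow_of_finrank {F K : Type*} [Field F] [Fintype F] [Field K]
    [Fintype K] [Algebra F K] {q m : ℕ} (hF : Fintype.card F = q)
    (hK : Module.finrank F K = m) :
    Fintype.card K = q ^ m := by
  rw [Module.card_eq_pow_finrank (K := F), hF, hK]

theorem trace_algebraMap_mul {F K : Type*} [Field F] [Field K] [Algebra F K] (β : F) (x : K) :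
    Algebra.trace F K (algebraMap F K β * x) = β * Algebra.trace F K x := by
  rw [← Algebra.smul_def, map_smul, smul_eq_mul]

section TraceCounts

variable {F K : Type*} [Field F] [Fintype F] [DecidableEq F] [Field K] [Fintype K] [Algebra F K]
  {q m : ℕ}

theorem card_trace_mul_eq (hF : Fintype.card F = q) (hK : Module.finrank F K = m) (hm : 1 ≤ m)
    {c : K} (hc : c ≠ 0) (t : F) :
    (Finset.univ.filter fun x => Algebra.trace F K (c * x) = t).card = q ^ (m - 1) := by
  have hq : 0 < q := hF ▸ Fintype.card_pos
  have hs : Function.Surjective ((Algebra.trace F K).comp (LinearMap.mulLeft F c)) := fun t => by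
    obtain ⟨x, rfl⟩ := Algebra.trace_surjective F K t
    exact ⟨c⁻¹ * x, by simp [hc]⟩
  have h := card_fiber_mul_card _ hs t
  rw [hF, card_eq_pow_of_finrank hF hK, ← Nat.sub_add_cancel hm, pow_succ] at h
  exact Nat.eq_of_mul_eq_mul_right hq h

theorem card_trace_eq (hF : Fintype.card F = q) (hK : Module.finrank F K = m) (hm : 1 ≤ m)
    (t : F) : (Finset.univ.filter fun x => Algebra.trace F K x = t).card = q ^ (m - 1) := by
  simpa using card_trace_mul_eq hF hK hm one_ne_zero t

/-- For b ∉ F the elements 1 and b are linearly independent over F, so nondegeneracy of the trace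
form makes x ↦ (Tr x, Tr bx) surjective onto F². All its fibres then have the same size. -/
theorem card_trace_eq_and_trace_mul_eq (hF : Fintype.card F = q) (hK : Module.finrank F K = m)
    (hm : 2 ≤ m) {b : K} (hb : b ∉ Set.range (algebraMap F K)) (s t : F) :
    (Finset.univ.filter fun x => Algebra.trace F K x = s ∧ Algebra.trace F K (b * x) = t).card =
      q ^ (m - 2) := by
  have hq : 0 < q := hF ▸ Fintype.card_pos
  let f : K →ₗ[F] F × F :=
    (Algebra.trace F K).prod ((Algebra.trace F K).comp (LinearMap.mulLeft F b))
  have hs : Function.Surjective f := by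
    rw [← LinearMap.range_eq_top]
    by_contra hne
    -- A proper image is killed by some φ ≠ 0, which makes φ(1,0) + φ(0,1)b orthogonal to all of K
    -- under the trace form, hence zero.
    obtain ⟨φ, hφ, hle⟩ := Submodule.exists_le_ker_of_lt_top _ (lt_top_iff_ne_top.mpr hne)
    have hφ' : ∀ x y, φ (x, y) = x * φ (1, 0) + y * φ (0, 1) := fun x y => by
      rw [← smul_eq_mul, ← smul_eq_mul, ← map_smul, ← map_smul, ← map_add]
      simp
    have hz : ∀ x, Algebra.trace F K (x * (algebraMap F K (φ (1, 0)) +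
        algebraMap F K (φ (0, 1)) * b)) = 0 := fun x => by
      have h1 : φ (f x) = 0 := hle ⟨x, rfl⟩
      have h2 : x * (algebraMap F K (φ (1, 0)) + algebraMap F K (φ (0, 1)) * b) =
          φ (1, 0) • x + φ (0, 1) • (b * x) := by
        rw [Algebra.smul_def, Algebra.smul_def]; ring
      change φ (Algebra.trace F K x, Algebra.trace F K (b * x)) = 0 at h1
      rw [hφ'] at h1
      rw [h2, map_add, map_smul, map_smul, smul_eq_mul, smul_eq_mul]
      linear_combination h1
    have h0 := eq_zero_of_trace_mul_eq_zero hz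
    have h01 : φ (0, 1) = 0 := by
      by_contra hne
      refine hb ⟨-φ (1, 0) / φ (0, 1), ?_⟩
      have : algebraMap F K (φ (0, 1)) ≠ 0 := by simpa using hne
      rw [map_div₀, map_neg]
      field_simp
      linear_combination -h0
    have h10 : φ (1, 0) = 0 := by simpa [h01] using h0
    exact hφ (LinearMap.ext fun z => by rw [← Prod.mk.eta (p := z), hφ', h01, h10]; simp)
  have h := card_fiber_mul_card f hs (s, t)
  rw [Fintype.card_prod, hF, card_eq_pow_of_finrank hF hK, ← Nat.sub_add_cancel hm, pow_add,
    sq] at h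
  have h' := Nat.eq_of_mul_eq_mul_right (by positivity) h
  rw [← h']
  congr 1
  ext x
  simp [f]

/-- The number of points of the solution set at which the codeword of `u` vanishes. -/
noncomputable def zeroCount (F K : Type*) [Field F] [DecidableEq F] [Field K] [Fintype K]
    [Algebra F K] (u : F × K × K) : ℕ :=
  (Finset.univ.filter fun z : K × K => f₂ F K z.1 + g₂ F K z.2 = 0 ∧
    u.1 + Algebra.trace F K (u.2.1 * z.1) + Algebra.trace F K (u.2.2 * z.2) = 0).card

/-- The number of `y` with `β Tr(y²) = a + Tr(cy)`. -/
noncomputable def conicCount (F K : Type*) [Field F] [DecidableEq F] [Field K] [Fintype K]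
    [Algebra F K] (β a : F) (c : K) : ℕ :=
  (Finset.univ.filter fun y : K =>
    β * Algebra.trace F K (y ^ 2) = a + Algebra.trace F K (c * y)).card

theorem zeroCount_of_notMem (hF : Fintype.card F = q) (hK : Module.finrank F K = m) (hm : 2 ≤ m)
    {b : K} (hb : b ∉ Set.range (algebraMap F K)) (a : F) (c : K) :
    zeroCount F K (a, b, c) = q ^ (2 * m - 2) := by
  rw [zeroCount, card_filter_prod fun x y => f₂ F K x + g₂ F K y = 0 ∧
    a + Algebra.trace F K (b * x) + Algebra.trace F K (c * y) = 0]
  have : ∀ y : K, (Finset.univ.filter fun x : K => f₂ F K x + g₂ F K y = 0 ∧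
      a + Algebra.trace F K (b * x) + Algebra.trace F K (c * y) = 0).card = q ^ (m - 2) := by
    intro y
    rw [← card_trace_eq_and_trace_mul_eq hF hK hm hb (-g₂ F K y)
      (-a - Algebra.trace F K (c * y))]
    congr 1
    ext x
    rw [Finset.mem_filter_univ, Finset.mem_filter_univ, f₂]
    refine and_congr ⟨fun h => ?_, fun h => ?_⟩ ⟨fun h => ?_, fun h => ?_⟩ <;>
      linear_combination h
  rw [Finset.sum_congr rfl fun y _ => this y, Finset.sum_const, Finset.card_univ,
    card_eq_pow_of_finrank hF hK, smul_eq_mul, ← pow_add]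
  congr 1
  omega

/-- On the solution set Tr(βx) = -β Tr(y²), so vanishing of the word is a condition on y alone. For
each admissible y, x runs through one fibre of the trace. -/
theorem zeroCount_algebraMap (hF : Fintype.card F = q) (hK : Module.finrank F K = m) (hm : 1 ≤ m)
    (β a : F) (c : K) :
    zeroCount F K (a, algebraMap F K β, c) = q ^ (m - 1) * conicCount F K β a c := by
  rw [zeroCount, card_filter_prod fun x y => f₂ F K x + g₂ F K y = 0 ∧
    a + Algebra.trace F K (algebraMap F K β * x) + Algebra.trace F K (c * y) = 0]
  have : ∀ y : K, (Finset.univ.filter fun x : K => f₂ F K x + g₂ F K y = 0 ∧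
      a + Algebra.trace F K (algebraMap F K β * x) + Algebra.trace F K (c * y) = 0).card =
      if β * Algebra.trace F K (y ^ 2) = a + Algebra.trace F K (c * y) then q ^ (m - 1) else 0 := by
    intro y
    split_ifs with h
    · rw [← card_trace_eq hF hK hm (-g₂ F K y)]
      congr 1
      ext x
      simp only [Finset.mem_filter, Finset.mem_univ, true_and, f₂, trace_algebraMap_mul, g₂,
        eq_neg_iff_add_eq_zero, and_iff_left_iff_imp]
      intro h'
      linear_combination β * h' - h
    · rw [Finset.card_eq_zero, Finset.filter_eq_empty_iff]
      rintro x - ⟨h1, h2⟩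
      rw [trace_algebraMap_mul] at h2
      rw [f₂, g₂] at h1
      exact h (by linear_combination β * h1 - h2)
  rw [Finset.sum_congr rfl fun y _ => this y, ← Finset.sum_filter, Finset.sum_const, smul_eq_mul,
    mul_comm, conicCount]

theorem card_solutionSet (hF : Fintype.card F = q) (hK : Module.finrank F K = m) (hm : 1 ≤ m) :
    Fintype.card (solutionSet (f₂ F K) (g₂ F K)) = q ^ (2 * m - 1) := by
  -- The zero triple vanishes everywhere, so its zero count is the size of the solution set.
  have h := zeroCount_algebraMap (K := K) hF hK hm 0 0 0
  rw [zeroCount] at h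
  simp only [map_zero, zero_mul, add_zero, and_true, conicCount] at h
  rw [Fintype.card_subtype, h, Finset.filter_true, Finset.card_univ,
    card_eq_pow_of_finrank hF hK, ← pow_add]
  congr 1
  omega

theorem card_option_solutionSet (hF : Fintype.card F = q) (hK : Module.finrank F K = m)
    (hm : 1 ≤ m) :
    Fintype.card (Option (solutionSet (f₂ F K) (g₂ F K))) = q ^ (2 * m - 1) + 1 := by
  rw [Fintype.card_option, card_solutionSet hF hK hm]

theorem hammingNorm_encode (hF : Fintype.card F = q) (hK : Module.finrank F K = m) (hm : 1 ≤ m)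
    (u : F × K × K) :
    (hammingNorm (encode (f₂ F K) (g₂ F K) u) : ℤ) = (q : ℤ) ^ (2 * m - 1) - zeroCount F K u +
      if Algebra.trace F K u.2.1 = 0 then 0 else 1 := by
  have h1 : hammingNorm (encode (f₂ F K) (g₂ F K) u) =
      (if Algebra.trace F K u.2.1 = 0 then 0 else 1) +
      (Finset.univ.filter fun z => ¬ encode (f₂ F K) (g₂ F K) u (some z) = 0).card := by
    rw [hammingNorm, Finset.card_filter, Fintype.sum_option, encode_none, ← Finset.card_filter]
    simp only [ne_eq, ite_not]
  have h2 : zeroCount F K u =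
      (Finset.univ.filter fun z => encode (f₂ F K) (g₂ F K) u (some z) = 0).card := by
    rw [zeroCount, ← Finset.card_map
      (Function.Embedding.subtype fun z : K × K => f₂ F K z.1 + g₂ F K z.2 = 0)]
    congr 1
    ext z
    simp [encode_some, and_comm]
  have h3 := Finset.card_filter_add_card_filter_not (s := Finset.univ)
    (fun z => encode (f₂ F K) (g₂ F K) u (some z) = 0)
  rw [← h2, Finset.card_univ, card_solutionSet hF hK hm] at h3
  rw [h1]
  have h4 : (zeroCount F K u : ℤ) + (Finset.univ.filter fun z =>
    ¬ encode (f₂ F K) (g₂ F K) u (some z) = 0).card = (q : ℤ) ^ (2 * m - 1) := by exact_mod_cast h3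
  push_cast
  linarith

end TraceCounts
/-! ### The weight distribution in terms of the sections of constant `b` -/

theorem card_filter_eq_of_const {α : Type*} [Fintype α] {f : α → ℤ} {d : ℤ} (hf : ∀ a, f a = d)
    (w : ℤ) :
    ((Finset.univ.filter fun a => f a = w).card : ℤ) = if w = d then (Fintype.card α : ℤ) else 0 := by
  split_ifs with h
  · rw [Finset.filter_true_of_mem fun a _ => (hf a).trans h.symm, Finset.card_univ]
  · rw [Finset.filter_false_of_mem fun a _ e => h (e.symm.trans (hf a)), Finset.card_empty,
      Nat.cast_zero]

theorem sum_range_add_sum_compl {α β : Type*} [Fintype α] [Fintype β] [DecidableEq β] {i : α → β}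
    (hi : Function.Injective i) [DecidablePred (· ∈ Set.range i)] (f : β → ℤ) :
    ∑ b, f b = ∑ a, f (i a) + ∑ b with b ∉ Set.range i, f b := by
  rw [← Finset.sum_filter_add_sum_filter_not Finset.univ (· ∈ Set.range i)]
  congr 1
  rw [← Finset.sum_image (f := f) (g := i) hi.injOn]
  congr 1
  ext b
  simp

section WeightDistribution

variable {F K : Type*} [Field F] [Fintype F] [DecidableEq F] [Field K] [Fintype K] [Algebra F K]
  {q m : ℕ}

/-- The number of `(a, c)` for which the punctured codeword of `(a, β, c)` has weight `w`. -/
noncomputable def sectionCount (F K : Type*) [Field F] [Fintype F] [DecidableEq F] [Field K]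
    [Fintype K] [Algebra F K] (q m : ℕ) (β : F) (w : ℤ) : ℤ :=
  (Finset.univ.filter fun u : F × K =>
    (q : ℤ) ^ (2 * m - 1) - (q : ℤ) ^ (m - 1) * conicCount F K β u.1 u.2 = w).card

theorem sectionCount_eq_sum (β : F) (w : ℤ) :
    sectionCount F K q m β w = ∑ c : K, ((Finset.univ.filter fun a : F =>
      (q : ℤ) ^ (2 * m - 1) - (q : ℤ) ^ (m - 1) * conicCount F K β a c = w).card : ℤ) := by
  rw [sectionCount, card_filter_prod fun (a : F) (c : K) =>
    (q : ℤ) ^ (2 * m - 1) - (q : ℤ) ^ (m - 1) * conicCount F K β a c = w]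
  push_cast
  rfl

/-- For β = 0 the condition is a + Tr(cy) = 0. With c = 0 the punctured word is the constant a, of
weight 0 or full weight; with c ≠ 0 the equation has q^(m-1) solutions for each of the q values of
a. -/
theorem sectionCount_zero (hF : Fintype.card F = q) (hK : Module.finrank F K = m) (hm : 1 ≤ m)
    (w : ℤ) : sectionCount F K q m 0 w = (if w = 0 then 1 else 0) +
      (if w = (q : ℤ) ^ (2 * m - 1) then (q : ℤ) - 1 else 0) +
      (if w = (q : ℤ) ^ (2 * m - 1) - (q : ℤ) ^ (2 * m - 2) then ((q : ℤ) ^ m - 1) * q else 0) := by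
  classical
  have hcast : ((q ^ m : ℕ) : ℤ) = (Fintype.card K : ℤ) := by rw [card_eq_pow_of_finrank hF hK]
  rw [sectionCount_eq_sum, ← Finset.add_sum_erase _ _ (Finset.mem_univ (0 : K))]
  congr 1
  · have h0 : ∀ a : F, conicCount F K 0 a (0 : K) = if a = 0 then q ^ m else 0 := fun a => by
      simp only [conicCount, zero_mul, map_zero, add_zero, eq_comm (a := (0 : F))]
      split_ifs with h
      · simp [h, card_eq_pow_of_finrank hF hK]
      · simp [h]
    rw [Finset.card_filter, Nat.cast_sum, ← Finset.add_sum_erase _ _ (Finset.mem_univ (0 : F))]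
    congr 1
    · rw [h0, if_pos rfl, Nat.cast_pow, ← pow_add, show m - 1 + m = 2 * m - 1 by omega, sub_self]
      simp only [eq_comm (a := (0 : ℤ))]
      split_ifs <;> rfl
    · rw [Finset.sum_congr rfl fun a ha => by rw [h0, if_neg (Finset.ne_of_mem_erase ha)],
        Finset.sum_const, Finset.card_erase_of_mem (Finset.mem_univ _), Finset.card_univ, hF]
      have : 1 ≤ q := hF ▸ Fintype.card_pos
      simp only [Nat.cast_zero, mul_zero, sub_zero, eq_comm (b := w), nsmul_eq_mul,
        Nat.cast_sub this, Nat.cast_one, Nat.cast_ite, mul_ite, mul_one]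
  · have h1 : ∀ c ∈ Finset.univ.erase (0 : K), ((Finset.univ.filter fun a : F =>
        (q : ℤ) ^ (2 * m - 1) - (q : ℤ) ^ (m - 1) * conicCount F K 0 a c = w).card : ℤ) =
        if w = (q : ℤ) ^ (2 * m - 1) - (q : ℤ) ^ (2 * m - 2) then (q : ℤ) else 0 := fun c hc => by
      rw [card_filter_eq_of_const, hF]
      intro a
      have : conicCount F K 0 a c = q ^ (m - 1) := by
        rw [← card_trace_mul_eq hF hK hm (Finset.ne_of_mem_erase hc) (-a), conicCount]
        congr 1
        ext y
        rw [Finset.mem_filter_univ, Finset.mem_filter_univ, zero_mul]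
        constructor <;> intro h <;> linear_combination -h
      rw [this, Nat.cast_pow, ← pow_add, show m - 1 + (m - 1) = 2 * m - 2 by omega]
    have : 1 ≤ Fintype.card K := Fintype.card_pos
    rw [Finset.sum_congr rfl h1, Finset.sum_const, Finset.card_erase_of_mem (Finset.mem_univ _),
      Finset.card_univ, nsmul_eq_mul, Nat.cast_sub this, ← hcast]
    push_cast
    rw [mul_ite, mul_zero]

theorem card_hammingNorm_encode_eq_sum (w : ℤ) :
    ((Finset.univ.filter fun u : F × K × K =>
      (hammingNorm (encode (f₂ F K) (g₂ F K) u) : ℤ) = w).card : ℤ) =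
      ∑ b : K, ((Finset.univ.filter fun v : F × K =>
        (hammingNorm (encode (f₂ F K) (g₂ F K) (v.1, b, v.2)) : ℤ) = w).card : ℤ) := by
  simp only [Finset.card_filter, Fintype.sum_prod_type, Nat.cast_sum]
  exact Finset.sum_comm

theorem card_section_of_notMem (hF : Fintype.card F = q) (hK : Module.finrank F K = m)
    (hm : 2 ≤ m) {b : K} (hb : b ∉ Set.range (algebraMap F K)) (w : ℤ) :
    ((Finset.univ.filter fun v : F × K =>
      (hammingNorm (encode (f₂ F K) (g₂ F K) (v.1, b, v.2)) : ℤ) = w).card : ℤ) =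
      if w = (q : ℤ) ^ (2 * m - 1) - (q : ℤ) ^ (2 * m - 2) +
        (if Algebra.trace F K b = 0 then 0 else 1) then (q : ℤ) ^ (m + 1) else 0 := by
  rw [card_filter_eq_of_const (d := (q : ℤ) ^ (2 * m - 1) - (q : ℤ) ^ (2 * m - 2) +
    (if Algebra.trace F K b = 0 then 0 else 1)) fun v => by
      rw [hammingNorm_encode hF hK (by omega), zeroCount_of_notMem hF hK hm hb]; push_cast; rfl]
  rw [Fintype.card_prod, hF, card_eq_pow_of_finrank hF hK, pow_succ']
  push_cast
  rfl

theorem card_section_algebraMap (hF : Fintype.card F = q) (hK : Module.finrank F K = m)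
    (hm : 1 ≤ m) (β : F) (w : ℤ) :
    ((Finset.univ.filter fun v : F × K =>
      (hammingNorm (encode (f₂ F K) (g₂ F K) (v.1, algebraMap F K β, v.2)) : ℤ) = w).card : ℤ) =
      sectionCount F K q m β (w - if (m : F) * β = 0 then 0 else 1) := by
  rw [sectionCount]
  congr 2
  ext v
  rw [Finset.mem_filter_univ, Finset.mem_filter_univ, hammingNorm_encode hF hK hm,
    zeroCount_algebraMap hF hK hm, Algebra.trace_algebraMap, hK, nsmul_eq_mul, eq_sub_iff_add_eq]
  push_cast
  rfl

/-- Triples are sorted by b: zero, a nonzero scalar β, or outside F. For scalars the extra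
coordinate is mβ, so all q - 1 sections with β ≠ 0 are shifted by 1 exactly when m ≠ 0 in F. Each b
∉ F gives q^(m+1) words of one weight, which depends only on whether Tr(b) vanishes. -/
theorem card_hammingNorm_encode (hF : Fintype.card F = q) (hK : Module.finrank F K = m)
    (hm : 2 ≤ m) {R : ℤ → ℤ} (hR : ∀ β : F, β ≠ 0 → ∀ w, sectionCount F K q m β w = R w) (w : ℤ) :
    ((Finset.univ.filter fun u : F × K × K =>
      (hammingNorm (encode (f₂ F K) (g₂ F K) u) : ℤ) = w).card : ℤ) =
      (if w = 0 then 1 else 0) + (if w = (q : ℤ) ^ (2 * m - 1) then (q : ℤ) - 1 else 0) +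
      (if w = (q : ℤ) ^ (2 * m - 1) - (q : ℤ) ^ (2 * m - 2) then
        if (m : F) = 0 then (q : ℤ) ^ (2 * m) - q ^ (m + 2) + q ^ (m + 1) - q
        else (q : ℤ) ^ (2 * m) - q else 0) +
      (if w = (q : ℤ) ^ (2 * m - 1) - (q : ℤ) ^ (2 * m - 2) + 1 then
        if (m : F) = 0 then (q : ℤ) ^ (2 * m + 1) - q ^ (2 * m)
        else (q : ℤ) ^ (2 * m + 1) - q ^ (2 * m) - q ^ (m + 2) + q ^ (m + 1) else 0) +
      ((q : ℤ) - 1) * R (w - if (m : F) = 0 then 0 else 1) := by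
  classical
  have hm1 : 1 ≤ m := by omega
  have hq : 1 ≤ q := hF ▸ Fintype.card_pos
  rw [card_hammingNorm_encode_eq_sum,
    sum_range_add_sum_compl (FaithfulSMul.algebraMap_injective F K),
    Finset.sum_congr rfl fun β _ => card_section_algebraMap hF hK hm1 β w,
    Finset.sum_congr rfl fun b hb => card_section_of_notMem hF hK hm
      (Finset.mem_filter.mp hb).2 w,
    ← Finset.add_sum_erase _ _ (Finset.mem_univ (0 : F)), mul_zero, if_pos rfl, sub_zero,
    sectionCount_zero hF hK hm1]
  have h1 : ∑ β ∈ Finset.univ.erase (0 : F),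
      sectionCount F K q m β (w - if (m : F) * β = 0 then 0 else 1) =
      ((q : ℤ) - 1) * R (w - if (m : F) = 0 then 0 else 1) := by
    have hc : ∀ β ∈ Finset.univ.erase (0 : F),
        sectionCount F K q m β (w - if (m : F) * β = 0 then 0 else 1) =
        R (w - if (m : F) = 0 then 0 else 1) := fun β hβ => by
      have hβ0 := Finset.ne_of_mem_erase hβ
      rw [hR β hβ0]
      simp only [mul_eq_zero, hβ0, or_false]
    rw [Finset.sum_congr rfl hc, Finset.sum_const,
      Finset.card_erase_of_mem (Finset.mem_univ _), Finset.card_univ, hF, nsmul_eq_mul,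
      Nat.cast_sub hq, Nat.cast_one]
  set A : ℤ := (q : ℤ) ^ (2 * m - 1) - (q : ℤ) ^ (2 * m - 2) with hA
  -- The elements outside F with zero or nonzero trace are counted by subtracting the scalars, whose
  -- trace is mβ, from the full fibres of the trace.
  have hcount : ∀ p : F → Prop, ∀ [DecidablePred p],
      ((Finset.univ.filter fun b : K => p (Algebra.trace F K b)).card : ℤ) =
      (Finset.univ.filter fun β : F => p ((m : F) * β)).card +
      ((Finset.univ.filter (fun b : K => b ∉ Set.range (algebraMap F K))).filter
        fun b => p (Algebra.trace F K b)).card := by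
    intro p _
    simp only [Finset.card_filter, Nat.cast_sum]
    rw [sum_range_add_sum_compl (FaithfulSMul.algebraMap_injective F K)]
    congr 1
    refine Finset.sum_congr rfl fun β _ => ?_
    rw [Algebra.trace_algebraMap, hK, nsmul_eq_mul]
  have h2 : ∀ w, ∑ b with b ∉ Set.range (algebraMap F K),
      (if w = A + (if Algebra.trace F K b = 0 then 0 else 1) then (q : ℤ) ^ (m + 1) else 0) =
      (if w = A then (q : ℤ) ^ (m + 1) * ((Finset.univ.filter
        (fun b : K => b ∉ Set.range (algebraMap F K))).filter
          fun b => Algebra.trace F K b = 0).card else 0) +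
      (if w = A + 1 then (q : ℤ) ^ (m + 1) * ((Finset.univ.filter
        (fun b : K => b ∉ Set.range (algebraMap F K))).filter
          fun b => ¬ Algebra.trace F K b = 0).card else 0) := by
    intro w
    rw [← Finset.sum_filter_add_sum_filter_not _ fun b => Algebra.trace F K b = 0]
    congr 1
    · rw [Finset.sum_congr rfl fun b hb => by rw [if_pos (Finset.mem_filter.mp hb).2, add_zero],
        Finset.sum_const, nsmul_eq_mul, mul_ite, mul_zero, mul_comm]
    · rw [Finset.sum_congr rfl fun b hb => by rw [if_neg (Finset.mem_filter.mp hb).2],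
        Finset.sum_const, nsmul_eq_mul, mul_ite, mul_zero, mul_comm]
  have hu := hcount fun t => t = 0
  have hv := hcount fun t => ¬ t = 0
  have hker : ((Finset.univ.filter fun b : K => Algebra.trace F K b = 0).card : ℤ) =
      (q : ℤ) ^ (m - 1) := by rw [card_trace_eq hF hK hm1]; push_cast; rfl
  have htot : ((Finset.univ.filter fun b : K => ¬ Algebra.trace F K b = 0).card : ℤ) =
      (q : ℤ) ^ m - (q : ℤ) ^ (m - 1) := by
    rw [← hker, eq_sub_iff_add_eq', ← Nat.cast_add, Finset.card_filter_add_card_filter_not,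
      Finset.card_univ, card_eq_pow_of_finrank hF hK]
    push_cast; rfl
  rw [hker] at hu
  rw [htot] at hv
  have e1 : (q : ℤ) ^ (2 * m) = q ^ (m + 1) * q ^ (m - 1) := by rw [← pow_add]; congr 1; omega
  have e2 : (q : ℤ) ^ (2 * m + 1) = q ^ (m + 1) * q ^ m := by rw [← pow_add]; congr 1; omega
  have e3 : (q : ℤ) ^ (m + 2) = q ^ (m + 1) * q := by rw [← pow_succ]
  rw [h1, h2]
  by_cases hm0 : (m : F) = 0
  · simp only [hm0, zero_mul, not_true_eq_false, Finset.filter_true, Finset.filter_false,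
      Finset.card_univ, hF, Finset.card_empty, if_true] at hu hv ⊢
    have hu' := eq_sub_of_add_eq' hu.symm
    have hv' := eq_sub_of_add_eq' hv.symm
    rw [hu', hv', e2, e1, e3]
    split_ifs <;> (push_cast; ring1)
  · have hz : (Finset.univ.filter fun β : F => (m : F) * β = 0).card = 1 := by
      simp [hm0, Finset.filter_eq']
    have hnz : ((Finset.univ.filter fun β : F => ¬ (m : F) * β = 0).card : ℤ) = q - 1 := by
      rw [eq_sub_iff_add_eq', ← Nat.cast_one, ← hz, ← Nat.cast_add,
        Finset.card_filter_add_card_filter_not, Finset.card_univ, hF]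
    rw [hz] at hu
    rw [hnz] at hv
    have hu' := eq_sub_of_add_eq' hu.symm
    have hv' := eq_sub_of_add_eq' hv.symm
    rw [hu', hv', e2, e1, e3]
    simp only [hm0, if_false]
    split_ifs <;> (push_cast; ring1)

end WeightDistribution
/-! ### Sections in characteristic two -/

theorem card_filter_eq_sum_values {α β : Type*} [Fintype α] [DecidableEq β] {N : α → β}
    {s : Finset β} (hN : ∀ a, N a ∈ s) (g : β → ℤ) (w : ℤ) :
    ((Finset.univ.filter fun a => g (N a) = w).card : ℤ) =
      ∑ v ∈ s, if w = g v then ((Finset.univ.filter fun a => N a = v).card : ℤ) else 0 := by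
  rw [Finset.card_eq_sum_card_fiberwise (f := N) (t := s) fun a _ => hN a, Nat.cast_sum]
  refine Finset.sum_congr rfl fun v _ => ?_
  split_ifs with h
  · congr 2
    ext a
    simp only [Finset.mem_filter, Finset.mem_univ, true_and, and_iff_right_iff_imp]
    rintro rfl
    exact h.symm
  · rw [Finset.filter_filter, Finset.filter_false_of_mem, Finset.card_empty, Nat.cast_zero]
    rintro a - ⟨h1, rfl⟩
    exact h h1.symm

/-- The trace is a sum of conjugates and squaring is additive. Hence in characteristic 2 the
quadratic form Tr(y²) is the square of a linear form, and the conic count depends on y only through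
Tr(y) and Tr(cy). -/
theorem trace_sq_of_charP_two {F K : Type*} [Field F] [Field K] [Finite K] [Algebra F K]
    [CharP F 2] (y : K) : Algebra.trace F K (y ^ 2) = Algebra.trace F K y ^ 2 := by
  have : CharP K 2 := charP_of_injective_algebraMap (FaithfulSMul.algebraMap_injective F K) 2
  apply FaithfulSMul.algebraMap_injective F K
  rw [RingHom.map_pow, FiniteField.algebraMap_trace_eq_sum_pow, FiniteField.algebraMap_trace_eq_sum_pow,
    sum_pow_char 2]
  exact Finset.sum_congr rfl fun i _ => by rw [← pow_mul, ← pow_mul, mul_comm]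

section EvenSections

variable {F K : Type*} [Field F] [Fintype F] [DecidableEq F] [Field K] [Fintype K] [Algebra F K]
  [CharP F 2] {q m : ℕ}

theorem conicCount_eq_sum_of_charP_two (β a : F) (c : K) : conicCount F K β a c =
    ∑ s, (Finset.univ.filter fun y : K => Algebra.trace F K y = s ∧
      Algebra.trace F K (c * y) = β * s ^ 2 - a).card := by
  rw [conicCount, Finset.card_eq_sum_card_fiberwise (f := Algebra.trace F K) (t := Finset.univ)
    fun _ _ => Finset.mem_coe.mpr (Finset.mem_univ _)]
  refine Finset.sum_congr rfl fun s _ => ?_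
  congr 1
  ext y
  simp only [Finset.mem_filter, Finset.mem_univ, true_and, trace_sq_of_charP_two]
  constructor
  · rintro ⟨h, rfl⟩
    exact ⟨rfl, by linear_combination -h⟩
  · rintro ⟨rfl, h⟩
    exact ⟨by linear_combination -h, rfl⟩

theorem conicCount_of_notMem (hF : Fintype.card F = q) (hK : Module.finrank F K = m)
    (hm : 2 ≤ m) {c : K} (hc : c ∉ Set.range (algebraMap F K)) (β a : F) :
    conicCount F K β a c = q ^ (m - 1) := by
  rw [conicCount_eq_sum_of_charP_two, Finset.sum_congr rfl fun s _ =>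
    card_trace_eq_and_trace_mul_eq hF hK hm hc s _, Finset.sum_const, Finset.card_univ, hF,
    smul_eq_mul, ← pow_succ']
  congr 1
  omega

theorem conicCount_algebraMap (hF : Fintype.card F = q) (hK : Module.finrank F K = m)
    (hm : 1 ≤ m) (β a γ : F) : conicCount F K β a (algebraMap F K γ) =
      q ^ (m - 1) * (Finset.univ.filter fun s => β * s ^ 2 - γ * s = a).card := by
  rw [conicCount_eq_sum_of_charP_two, Finset.card_filter, Finset.mul_sum]
  refine Finset.sum_congr rfl fun s _ => ?_
  split_ifs with h
  · rw [← card_trace_eq hF hK hm s, mul_one]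
    congr 1
    ext y
    simp only [Finset.mem_filter, Finset.mem_univ, true_and, trace_algebraMap_mul,
      and_iff_left_iff_imp]
    rintro rfl
    linear_combination -h
  · rw [mul_zero, Finset.card_eq_zero, Finset.filter_eq_empty_iff]
    rintro y - ⟨rfl, h2⟩
    rw [trace_algebraMap_mul] at h2
    exact h (by linear_combination -h2)

theorem card_quadratic_roots_of_linear_eq_zero {β : F} (hβ : β ≠ 0) (a : F) :
    (Finset.univ.filter fun s : F => β * s ^ 2 - 0 * s = a).card = 1 := by
  obtain ⟨r, hr⟩ := (bijective_frobenius F 2).2 (a / β)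
  rw [frobenius_def] at hr
  rw [Finset.card_eq_one]
  refine ⟨r, ?_⟩
  ext s
  rw [Finset.mem_filter_univ, Finset.mem_singleton]
  constructor
  · intro h
    apply (bijective_frobenius F 2).1
    rw [frobenius_def, frobenius_def, hr, eq_div_iff hβ]
    linear_combination h
  · rintro rfl
    rw [hr, zero_mul, sub_zero, mul_div_cancel₀ _ hβ]

theorem card_quadratic_roots_eq_zero_or_two {β γ : F} (hβ : β ≠ 0) (hγ : γ ≠ 0) (a : F) :
    (Finset.univ.filter fun s : F => β * s ^ 2 - γ * s = a).card = 0 ∨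
      (Finset.univ.filter fun s : F => β * s ^ 2 - γ * s = a).card = 2 := by
  rcases (Finset.univ.filter fun s : F => β * s ^ 2 - γ * s = a).eq_empty_or_nonempty with h | h
  · exact Or.inl (by rw [h, Finset.card_empty])
  · right
    obtain ⟨r, hr⟩ := h
    rw [Finset.mem_filter_univ] at hr
    -- The sum of the two roots is γ/β, and signs do not matter in characteristic 2.
    have hne : r ≠ r + γ / β := by simp [hβ, hγ]
    refine Eq.trans ?_ (Finset.card_pair hne)
    congr 1
    ext s
    rw [Finset.mem_filter_univ, Finset.mem_insert, Finset.mem_singleton]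
    have h2 : (2 : F) = 0 := CharTwo.two_eq_zero
    have key : β * s ^ 2 - γ * s - a = β * ((s - r) * (s - (r + γ / β))) := by
      field_simp
      linear_combination hr + (β * r * s - β * r ^ 2) * h2
    rw [← sub_eq_zero, key, mul_eq_zero, or_iff_right hβ, mul_eq_zero, sub_eq_zero, sub_eq_zero]

/-- Every s ∈ F is a root for exactly one a, so the root counts add up to q. Since each is 0 or 2,
both values occur q/2 times. -/
theorem card_filter_card_quadratic_roots {β γ : F} (hβ : β ≠ 0) (hγ : γ ≠ 0)
    {h : ℕ} (hh : 2 * h = Fintype.card F) :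
    (Finset.univ.filter fun a =>
      (Finset.univ.filter fun s : F => β * s ^ 2 - γ * s = a).card = 0).card = h ∧
    (Finset.univ.filter fun a =>
      (Finset.univ.filter fun s : F => β * s ^ 2 - γ * s = a).card = 2).card = h := by
  have h1 : Fintype.card F =
      ∑ a, (Finset.univ.filter fun s : F => β * s ^ 2 - γ * s = a).card :=
    Finset.card_eq_sum_card_fiberwise fun _ _ => Finset.mem_coe.mpr (Finset.mem_univ _)
  have h2 : ∑ a, (Finset.univ.filter fun s : F => β * s ^ 2 - γ * s = a).card =
      (Finset.univ.filter fun a =>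
      (Finset.univ.filter fun s : F => β * s ^ 2 - γ * s = a).card = 2).card * 2 := by
    rw [← smul_eq_mul, ← Finset.sum_const, Finset.sum_filter]
    refine Finset.sum_congr rfl fun a _ => ?_
    rcases card_quadratic_roots_eq_zero_or_two hβ hγ a with e | e <;> rw [e] <;> rfl
  have h3 := Finset.card_filter_add_card_filter_not (s := Finset.univ)
    (fun a => (Finset.univ.filter fun s : F => β * s ^ 2 - γ * s = a).card = 2)
  have h4 : (Finset.univ.filter fun a =>
      ¬ (Finset.univ.filter fun s : F => β * s ^ 2 - γ * s = a).card = 2) =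
      (Finset.univ.filter fun a =>
      (Finset.univ.filter fun s : F => β * s ^ 2 - γ * s = a).card = 0) := by
    ext a
    rw [Finset.mem_filter_univ, Finset.mem_filter_univ]
    rcases card_quadratic_roots_eq_zero_or_two hβ hγ a with e | e <;> omega
  rw [h4, Finset.card_univ] at h3
  omega

/-- The q^m - q elements c ∉ F together with c = 0 give the middle weight for every a. Each of the q
- 1 nonzero γ ∈ F splits the values of a into halves with no root and with two roots. -/
theorem sectionCount_of_charP_two (hF : Fintype.card F = q) (hK : Module.finrank F K = m)
    (hm : 2 ≤ m) {h : ℕ} (hh : 2 * h = q) {β : F} (hβ : β ≠ 0) (w : ℤ) :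
    sectionCount F K q m β w =
      (if w = (q : ℤ) ^ (2 * m - 1) - (q : ℤ) ^ (2 * m - 2) then (q : ℤ) ^ (m + 1) - q ^ 2 + q
        else 0) +
      ((if w = (q : ℤ) ^ (2 * m - 1) then ((q : ℤ) - 1) * h else 0) +
      (if w = (q : ℤ) ^ (2 * m - 1) - 2 * (q : ℤ) ^ (2 * m - 2) then ((q : ℤ) - 1) * h else 0)) := by
  classical
  have hm1 : 1 ≤ m := by omega
  have hpow : (q : ℤ) ^ (m - 1) * q ^ (m - 1) = q ^ (2 * m - 2) := by
    rw [← pow_add]; congr 1; omega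
  have hcard := card_eq_pow_of_finrank hF hK
  rw [sectionCount_eq_sum, sum_range_add_sum_compl (FaithfulSMul.algebraMap_injective F K),
    ← Finset.add_sum_erase _ _ (Finset.mem_univ (0 : F))]
  have h1 : ∀ c ∈ Finset.univ.filter (fun c : K => c ∉ Set.range (algebraMap F K)),
      ((Finset.univ.filter fun a : F => (q : ℤ) ^ (2 * m - 1) -
        (q : ℤ) ^ (m - 1) * conicCount F K β a c = w).card : ℤ) =
      if w = (q : ℤ) ^ (2 * m - 1) - (q : ℤ) ^ (2 * m - 2) then (q : ℤ) else 0 := fun c hc => by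
    rw [card_filter_eq_of_const, hF]
    intro a
    rw [conicCount_of_notMem hF hK hm (Finset.mem_filter.mp hc).2, ← hpow]
    push_cast; rfl
  have h2 : ((Finset.univ.filter fun a : F => (q : ℤ) ^ (2 * m - 1) -
        (q : ℤ) ^ (m - 1) * conicCount F K β a (algebraMap F K 0) = w).card : ℤ) =
      if w = (q : ℤ) ^ (2 * m - 1) - (q : ℤ) ^ (2 * m - 2) then (q : ℤ) else 0 := by
    rw [card_filter_eq_of_const, hF]
    intro a
    rw [conicCount_algebraMap hF hK hm1, card_quadratic_roots_of_linear_eq_zero hβ, ← hpow]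
    push_cast
    ring
  have h3 : ∀ γ ∈ Finset.univ.erase (0 : F), ((Finset.univ.filter fun a : F =>
        (q : ℤ) ^ (2 * m - 1) -
        (q : ℤ) ^ (m - 1) * conicCount F K β a (algebraMap F K γ) = w).card : ℤ) =
      (if w = (q : ℤ) ^ (2 * m - 1) then (h : ℤ) else 0) +
      (if w = (q : ℤ) ^ (2 * m - 1) - 2 * (q : ℤ) ^ (2 * m - 2) then (h : ℤ) else 0) := by
    intro γ hγ
    have hγ0 := Finset.ne_of_mem_erase hγ
    obtain ⟨c0, c2⟩ := card_filter_card_quadratic_roots hβ hγ0 (hh.trans hF.symm)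
    have := card_filter_eq_sum_values (s := {0, 2})
      (N := fun a => (Finset.univ.filter fun s : F => β * s ^ 2 - γ * s = a).card)
      (fun a => by simpa using card_quadratic_roots_eq_zero_or_two hβ hγ0 a)
      (fun v => (q : ℤ) ^ (2 * m - 1) - (q : ℤ) ^ (m - 1) * ((q : ℤ) ^ (m - 1) * (v : ℕ))) w
    rw [Finset.sum_pair (by decide), c0, c2] at this
    simp only [← mul_assoc, hpow, Nat.cast_zero, mul_zero, sub_zero, Nat.cast_two,
      mul_comm ((q : ℤ) ^ (2 * m - 2)) 2] at this
    rw [← this]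
    congr 2
    ext a
    rw [Finset.mem_filter_univ, Finset.mem_filter_univ, conicCount_algebraMap hF hK hm1, ← hpow]
    push_cast
    rw [mul_assoc]
  have h4 : ((Finset.univ.filter (fun c : K => c ∉ Set.range (algebraMap F K))).card : ℤ) =
      (q : ℤ) ^ m - q := by
    have h5 := sum_range_add_sum_compl (FaithfulSMul.algebraMap_injective F K) fun _ => 1
    simp only [Finset.sum_const, nsmul_eq_mul, mul_one, Finset.card_univ, hcard, hF] at h5
    push_cast at h5
    linarith
  have hq1 : 1 ≤ q := hF ▸ Fintype.card_pos
  rw [h2, Finset.sum_congr rfl h3, Finset.sum_congr rfl h1, Finset.sum_const, Finset.sum_const,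
    Finset.card_erase_of_mem (Finset.mem_univ _), Finset.card_univ, hF, nsmul_eq_mul,
    nsmul_eq_mul, h4, Nat.cast_sub hq1]
  split_ifs <;> (push_cast; ring1)

end EvenSections
/-! ### The distribution of `Tr(z²)` in odd characteristic -/

theorem ringChar_ne_two {F : Type*} [Field F] (h2 : (2 : F) ≠ 0) : ringChar F ≠ 2 := fun e =>
  h2 (by have := ringChar.Nat.cast_ringChar (R := F); rw [e] at this; exact_mod_cast this)

theorem two_ne_zero_of_algebra {F : Type*} (K : Type*) [Field F] [Field K] [Algebra F K]
    (h2 : (2 : F) ≠ 0) : (2 : K) ≠ 0 := by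
  rw [← map_ofNat (algebraMap F K) 2]
  exact (map_ne_zero _).mpr h2

/-- The number of `z` with `Tr(z²) = t`. -/
noncomputable def squareTraceCount (F K : Type*) [Field F] [DecidableEq F] [Field K] [Fintype K]
    [Algebra F K] (t : F) : ℕ :=
  (Finset.univ.filter fun z : K => Algebra.trace F K (z ^ 2) = t).card

/-- If s ∈ F has a square root r in K, then z ↦ rz multiplies Tr(z²) by s. -/
theorem squareTraceCount_mul {F K : Type*} [Field F] [DecidableEq F] [Field K]
    [Fintype K] [Algebra F K] {s : F} (hs : s ≠ 0) {r : K} (hr : r ^ 2 = algebraMap F K s) (t : F) :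
    squareTraceCount F K (s * t) = squareTraceCount F K t := by
  have hr0 : r ≠ 0 := by
    rintro rfl
    rw [zero_pow two_ne_zero] at hr
    exact hs (FaithfulSMul.algebraMap_injective F K (by rw [← hr, map_zero]))
  refine (Finset.card_equiv (Equiv.mulLeft₀ r hr0) fun z => ?_).symm
  rw [Finset.mem_filter_univ, Finset.mem_filter_univ, Equiv.mulLeft₀_apply, mul_pow, hr,
    trace_algebraMap_mul, mul_right_inj' hs]

theorem conicCount_eq_squareTraceCount {F K : Type*} [Field F] [DecidableEq F]
    [Field K] [Fintype K] [Algebra F K] (h2 : (2 : F) ≠ 0) {β : F} (hβ : β ≠ 0) (a : F) (c : K) :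
    conicCount F K β a c =
      squareTraceCount F K (a / β + Algebra.trace F K (c ^ 2) / (2 * β) ^ 2) := by
  -- Completing the square: z = y - c/(2β).
  refine Finset.card_equiv (Equiv.addRight (-(algebraMap F K (2 * β)⁻¹ * c))) fun y => ?_
  rw [Finset.mem_filter_univ, Finset.mem_filter_univ, Equiv.coe_addRight]
  have h : (y + -(algebraMap F K (2 * β)⁻¹ * c)) ^ 2 = y ^ 2 - algebraMap F K β⁻¹ * (c * y) +
      algebraMap F K ((2 * β)⁻¹ ^ 2) * c ^ 2 := by
    have h3 : algebraMap F K β⁻¹ = 2 * algebraMap F K (2 * β)⁻¹ := by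
      rw [← map_ofNat (algebraMap F K) 2, ← map_mul]
      congr 1
      field_simp
    rw [h3, map_pow]
    ring
  rw [h, map_add, map_sub, trace_algebraMap_mul, trace_algebraMap_mul]
  have h4 : (2 * β)⁻¹ ^ 2 * Algebra.trace F K (c ^ 2) =
      Algebra.trace F K (c ^ 2) / (2 * β) ^ 2 := by field_simp
  rw [h4, add_left_inj, sub_eq_iff_eq_add,
    ← mul_right_inj' hβ (b := Algebra.trace F K (y ^ 2)), mul_add, mul_div_cancel₀ _ hβ,
    mul_inv_cancel_left₀ hβ]

section SquareTrace

variable {F K : Type*} [Field F] [Fintype F] [DecidableEq F] [Field K] [Fintype K] [Algebra F K]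
  {q m : ℕ}

theorem sum_squareTraceCount (hF : Fintype.card F = q) (hK : Module.finrank F K = m) :
    ∑ t, squareTraceCount F K t = q ^ m := by
  rw [← card_eq_pow_of_finrank hF hK, ← Finset.card_univ]
  exact (Finset.card_eq_sum_card_fiberwise fun _ _ => Finset.mem_coe.mpr (Finset.mem_univ _)).symm

/-- The second moment counts the pairs with Tr(x²) = Tr(y²). As 2 is invertible, u = x - y and v = x
+ y are new coordinates in which this reads Tr(uv) = 0, linear in u for each v. This replaces the
evaluation of a Gauss sum. -/
theorem sum_squareTraceCount_sq (h2 : (2 : F) ≠ 0) (hF : Fintype.card F = q)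
    (hK : Module.finrank F K = m) (hm : 1 ≤ m) :
    ∑ t, (squareTraceCount F K t : ℤ) ^ 2 = (q : ℤ) ^ m + ((q : ℤ) ^ m - 1) * q ^ (m - 1) := by
  classical
  have h2K := two_ne_zero_of_algebra K h2
  have hcard := card_eq_pow_of_finrank hF hK
  have e1 : ∑ t, squareTraceCount F K t ^ 2 = (Finset.univ.filter fun z : K × K =>
      Algebra.trace F K (z.1 ^ 2) = Algebra.trace F K (z.2 ^ 2)).card := by
    rw [card_filter_prod fun x y : K => Algebra.trace F K (x ^ 2) = Algebra.trace F K (y ^ 2),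
      ← Finset.sum_fiberwise Finset.univ fun y : K => Algebra.trace F K (y ^ 2)]
    refine Finset.sum_congr rfl fun t _ => ?_
    rw [Finset.sum_congr rfl fun y hy => by rw [(Finset.mem_filter.mp hy).2], Finset.sum_const,
      smul_eq_mul, sq, squareTraceCount]
  let e : K × K ≃ K × K :=
    { toFun := fun z => (z.1 - z.2, z.1 + z.2)
      invFun := fun z => ((z.1 + z.2) / 2, (z.2 - z.1) / 2)
      left_inv := fun z => by ext <;> simp <;> field_simp <;> ring
      right_inv := fun z => by ext <;> simp <;> field_simp <;> ring }
  have e2 : (Finset.univ.filter fun z : K × K =>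
      Algebra.trace F K (z.1 ^ 2) = Algebra.trace F K (z.2 ^ 2)).card =
      (Finset.univ.filter fun z : K × K => Algebra.trace F K (z.2 * z.1) = 0).card := by
    refine Finset.card_equiv e fun z => ?_
    rw [Finset.mem_filter_univ, Finset.mem_filter_univ, ← sub_eq_zero, ← map_sub]
    change _ ↔ Algebra.trace F K ((z.1 + z.2) * (z.1 - z.2)) = 0
    rw [← sq_sub_sq]
  have e3 : (Finset.univ.filter fun z : K × K => Algebra.trace F K (z.2 * z.1) = 0).card =
      q ^ m + (q ^ m - 1) * q ^ (m - 1) := by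
    rw [card_filter_prod fun x y : K => Algebra.trace F K (y * x) = 0,
      ← Finset.add_sum_erase _ _ (Finset.mem_univ (0 : K)),
      Finset.sum_congr rfl fun y hy => card_trace_mul_eq hF hK hm (Finset.ne_of_mem_erase hy) 0,
      Finset.sum_const, Finset.card_erase_of_mem (Finset.mem_univ _), Finset.card_univ, hcard,
      smul_eq_mul]
    simp [hcard]
  have hq : 1 ≤ q ^ m := hcard ▸ Fintype.card_pos
  have := e1.trans (e2.trans e3)
  zify [hq] at this
  exact this

/-- For each of the q^m values of c, the argument a/β + Tr(c²)/(2β)² runs once through F as a does.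
-/
theorem sectionCount_of_two_ne_zero (h2 : (2 : F) ≠ 0) (hF : Fintype.card F = q)
    (hK : Module.finrank F K = m) {β : F} (hβ : β ≠ 0) (w : ℤ) :
    sectionCount F K q m β w = (q : ℤ) ^ m * ∑ t : F,
      if (q : ℤ) ^ (2 * m - 1) - (q : ℤ) ^ (m - 1) * squareTraceCount F K t = w then 1 else 0 := by
  have h : ∀ c : K, ((Finset.univ.filter fun a : F => (q : ℤ) ^ (2 * m - 1) -
      (q : ℤ) ^ (m - 1) * conicCount F K β a c = w).card : ℤ) = ∑ t : F,
      if (q : ℤ) ^ (2 * m - 1) - (q : ℤ) ^ (m - 1) * squareTraceCount F K t = w then 1 else 0 := by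
    intro c
    rw [Finset.card_filter, Nat.cast_sum]
    refine Eq.trans ?_ (Equiv.sum_comp ((Equiv.divRight₀ β hβ).trans
      (Equiv.addRight (Algebra.trace F K (c ^ 2) / (2 * β) ^ 2))) _)
    refine Finset.sum_congr rfl fun a _ => ?_
    rw [conicCount_eq_squareTraceCount h2 hβ]
    push_cast
    rfl
  rw [sectionCount_eq_sum, Finset.sum_congr rfl fun c _ => h c, Finset.sum_const,
    Finset.card_univ, card_eq_pow_of_finrank hF hK, nsmul_eq_mul]
  push_cast
  rfl

/-- Multiplication by a nonsquare exchanges the values 1 and -1, so on F \ {0} each is taken (q -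
1)/2 times. -/
theorem sum_quadraticChar_comp (h2 : (2 : F) ≠ 0) (hF : Fintype.card F = q) {h : ℕ}
    (hh : 2 * h + 1 = q) (f : ℤ → ℤ) :
    ∑ t : F, f (quadraticChar F t) = f 0 + h * (f 1 + f (-1)) := by
  have hchar := ringChar_ne_two h2
  obtain ⟨g, hg⟩ := quadraticChar_exists_neg_one hchar
  have hg0 : g ≠ 0 := by rintro rfl; simp at hg
  have hsum : ∑ t ∈ Finset.univ.erase (0 : F), f (quadraticChar F t) =
      ∑ t ∈ Finset.univ.erase (0 : F), f (-quadraticChar F t) := by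
    refine Finset.sum_equiv (Equiv.mulLeft₀ g hg0) (fun t => by simp [hg0]) fun t _ => ?_
    rw [Equiv.mulLeft₀_apply, map_mul, hg, neg_one_mul, neg_neg]
  have hadd : ∑ t ∈ Finset.univ.erase (0 : F), f (quadraticChar F t) +
      ∑ t ∈ Finset.univ.erase (0 : F), f (-quadraticChar F t) = 2 * h * (f 1 + f (-1)) := by
    rw [← Finset.sum_add_distrib, Finset.sum_congr rfl (g := fun _ => f 1 + f (-1)),
      Finset.sum_const, Finset.card_erase_of_mem (Finset.mem_univ _), Finset.card_univ, hF, ← hh,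
      nsmul_eq_mul, Nat.add_sub_cancel]
    · push_cast; rfl
    · intro t ht
      rcases quadraticChar_dichotomy (Finset.ne_of_mem_erase ht) with e | e <;> rw [e]
      rw [neg_neg, add_comm]
  rw [← Finset.add_sum_erase _ _ (Finset.mem_univ (0 : F)), quadraticChar_zero]
  linarith

end SquareTrace
/-! ### Sections in odd characteristic -/

/-- If g = r² in K, taking norms gives g^m = N(r)², and for odd m this makes g a square in F. -/
theorem not_isSquare_algebraMap {F K : Type*} [Field F] [Field K] [Algebra F K]
    (hK : Odd (Module.finrank F K)) {g : F} (hg : ¬ IsSquare g) :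
    ¬ IsSquare (algebraMap F K g) := by
  rintro ⟨r, hr⟩
  obtain ⟨k, hk⟩ := hK
  have h := congrArg (Algebra.norm F) hr
  rw [Algebra.norm_algebraMap, map_mul, hk, pow_succ] at h
  have hg0 : g ≠ 0 := by rintro rfl; exact hg ⟨0, by simp⟩
  refine hg ⟨Algebra.norm F r / g ^ k, ?_⟩
  field_simp
  linear_combination h

/-- By Cauchy's theorem the Galois group, of order m, contains an involution; L is its fixed field.
-/
theorem exists_subfield_of_even {F K : Type*} [Field F] [Field K] [Finite K] [Algebra F K] {m : ℕ}
    (hK : Module.finrank F K = m)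
    (hm : Even m) : ∃ L : IntermediateField F K, Module.finrank L K = 2 ∧
      Module.finrank F L = m / 2 := by
  have hdvd : 2 ∣ Nat.card Gal(K/F) := by
    rw [IsGalois.card_aut_eq_finrank, hK]
    exact hm.two_dvd
  obtain ⟨σ, hσ⟩ := exists_prime_orderOf_dvd_card' 2 hdvd
  refine ⟨IntermediateField.fixedField (Subgroup.zpowers σ), ?_, ?_⟩
  · rw [IntermediateField.finrank_fixedField_eq_card, Nat.card_zpowers, hσ]
  · have h := Module.finrank_mul_finrank F (IntermediateField.fixedField (Subgroup.zpowers σ)) K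
    rw [IntermediateField.finrank_fixedField_eq_card, Nat.card_zpowers, hσ, hK] at h
    omega

section OddSections

variable {F K : Type*} [Field F] [Fintype F] [DecidableEq F] [Field K] [Fintype K] [Algebra F K]
  {q m : ℕ}

/-- The count at t is the sum of 1 + χ(w) over Tr(w) = t, with χ the quadratic character of K. Since
g remains a nonsquare in K, w ↦ gw carries this fibre to the one over gt and reverses χ, so the
character terms cancel. -/
theorem squareTraceCount_add_mul (h2 : (2 : F) ≠ 0) (hF : Fintype.card F = q)
    (hK : Module.finrank F K = m) (hm : Odd m) {g : F} (hg : ¬ IsSquare g) (t : F) :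
    squareTraceCount F K t + squareTraceCount F K (g * t) = 2 * q ^ (m - 1) := by
  classical
  have hchar : ringChar K ≠ 2 := ringChar_ne_two (two_ne_zero_of_algebra K h2)
  have hg0 : g ≠ 0 := by rintro rfl; exact hg ⟨0, by simp⟩
  have hgK : algebraMap F K g ≠ 0 := (map_ne_zero _).mpr hg0
  have hχ : quadraticChar K (algebraMap F K g) = -1 :=
    quadraticChar_neg_one_iff_not_isSquare.mpr (not_isSquare_algebraMap (hK ▸ hm) hg)
  have key : ∀ t, (squareTraceCount F K t : ℤ) =
      ∑ w with Algebra.trace F K w = t, (1 + quadraticChar K w) := by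
    intro t
    rw [squareTraceCount, Finset.card_eq_sum_card_fiberwise (f := fun z => z ^ 2)
      (t := Finset.univ.filter fun w => Algebra.trace F K w = t) fun z hz => by simpa using hz,
      Nat.cast_sum]
    refine Finset.sum_congr rfl fun w hw => ?_
    rw [add_comm, ← quadraticChar_card_sqrts hchar]
    congr 2
    ext z
    simp only [Finset.mem_filter, Finset.mem_univ, true_and, Set.mem_toFinset, Set.mem_ofPred_eq]
    exact ⟨fun h => h.2, fun h => ⟨by rw [h]; simpa using hw, h⟩⟩
  have h1 : ∑ w with Algebra.trace F K w = g * t, (1 + quadraticChar K w) =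
      ∑ w with Algebra.trace F K w = t, (1 - quadraticChar K w) := by
    refine (Finset.sum_equiv (Equiv.mulLeft₀ _ hgK) (fun w => ?_) fun w _ => ?_).symm
    · rw [Finset.mem_filter_univ, Finset.mem_filter_univ, Equiv.mulLeft₀_apply,
        trace_algebraMap_mul, mul_right_inj' hg0]
    · rw [Equiv.mulLeft₀_apply, map_mul, hχ]
      ring
  have : (squareTraceCount F K t + squareTraceCount F K (g * t) : ℤ) = 2 * (q : ℤ) ^ (m - 1) := by
    rw [key, key, h1, ← Finset.sum_add_distrib, Finset.sum_congr rfl fun w _ =>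
      show _ = (2 : ℤ) by ring, Finset.sum_const, card_trace_eq hF hK hm.pos, nsmul_eq_mul, mul_comm]
    push_cast
    rfl
  exact_mod_cast this

/-- The count is constant on nonzero squares, and the relation between t and gt determines it at
nonsquares and at 0. One unknown E, the deviation at t = 1, remains. -/
theorem squareTraceCount_of_odd (h2 : (2 : F) ≠ 0) (hF : Fintype.card F = q)
    (hK : Module.finrank F K = m) (hm : Odd m) : ∃ E : ℤ, E ^ 2 = (q : ℤ) ^ (m - 1) ∧
      ∀ t : F, (squareTraceCount F K t : ℤ) = (q : ℤ) ^ (m - 1) + quadraticChar F t * E := by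
  have hchar := ringChar_ne_two h2
  obtain ⟨g, hg⟩ := FiniteField.exists_nonsquare hchar
  have hg0 : g ≠ 0 := by rintro rfl; exact hg ⟨0, by simp⟩
  have hadd := fun t => squareTraceCount_add_mul h2 hF hK hm hg t
  zify at hadd
  have hsq : ∀ t : F, t ≠ 0 → IsSquare t → squareTraceCount F K t = squareTraceCount F K 1 := by
    rintro t ht ⟨r, rfl⟩
    have := squareTraceCount_mul (K := K) ht (r := algebraMap F K r)
      (by rw [sq, map_mul]) 1
    rwa [mul_one] at this
  have hM : ∀ t : F, (squareTraceCount F K t : ℤ) = (q : ℤ) ^ (m - 1) +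
      quadraticChar F t * (squareTraceCount F K (1 : F) - (q : ℤ) ^ (m - 1)) := by
    intro t
    rcases eq_or_ne t 0 with rfl | ht
    · have := hadd 0
      rw [mul_zero] at this
      rw [quadraticChar_zero]
      linarith
    · by_cases hs : IsSquare t
      · rw [hsq t ht hs, (quadraticChar_one_iff_isSquare ht).mpr hs]
        ring
      · have hgt : IsSquare (g * t) := by
          rw [← quadraticChar_one_iff_isSquare (mul_ne_zero hg0 ht), map_mul,
            quadraticChar_neg_one_iff_not_isSquare.mpr hg,
            quadraticChar_neg_one_iff_not_isSquare.mpr hs]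
          rfl
        have := hadd t
        rw [hsq _ (mul_ne_zero hg0 ht) hgt] at this
        rw [quadraticChar_neg_one_iff_not_isSquare.mpr hs]
        linarith
  refine ⟨_, ?_, hM⟩
  set E : ℤ := squareTraceCount F K (1 : F) - (q : ℤ) ^ (m - 1)
  obtain ⟨h, hh⟩ : ∃ h, 2 * h + 1 = q := by
    obtain ⟨h, hh⟩ := Nat.odd_iff.mpr (FiniteField.odd_card_of_char_ne_two hchar)
    exact ⟨h, by omega⟩
  -- In the second moment the terms linear in E cancel, which leaves (q - 1)E² = (q - 1)q^(m-1).
  have hs := sum_squareTraceCount_sq h2 hF hK hm.pos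
  rw [Finset.sum_congr rfl fun t _ => by rw [hM t],
    sum_quadraticChar_comp h2 hF hh fun x => ((q : ℤ) ^ (m - 1) + x * E) ^ 2] at hs
  have hq : (q : ℤ) ^ m = q ^ (m - 1) * q := by
    rw [← pow_succ, Nat.sub_add_cancel hm.pos]
  have hhq : (2 : ℤ) * h + 1 = q := by exact_mod_cast hh
  have hh0 : (2 * h : ℤ) ≠ 0 := by
    have : 1 < q := hF ▸ Fintype.one_lt_card
    omega
  refine mul_left_cancel₀ hh0 ?_
  rw [hq, ← hhq] at hs
  rw [← hhq]
  linear_combination hs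

/-- The sign of E need not be known: the values χ(t) = 1 and χ(t) = -1 are equally frequent, so the
distribution is symmetric in ±E. -/
theorem sectionCount_of_odd (h2 : (2 : F) ≠ 0) (hF : Fintype.card F = q)
    (hK : Module.finrank F K = m) (hm : Odd m) {h : ℕ} (hh : 2 * h + 1 = q) {β : F} (hβ : β ≠ 0)
    (w : ℤ) : sectionCount F K q m β w = (q : ℤ) ^ m *
      ((if w = (q : ℤ) ^ (2 * m - 1) - (q : ℤ) ^ (2 * m - 2) then 1 else 0) +
      h * ((if w = (q : ℤ) ^ (2 * m - 1) - (q : ℤ) ^ (2 * m - 2) - (q : ℤ) ^ ((3 * m - 3) / 2)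
          then 1 else 0) +
        (if w = (q : ℤ) ^ (2 * m - 1) - (q : ℤ) ^ (2 * m - 2) + (q : ℤ) ^ ((3 * m - 3) / 2)
          then 1 else 0))) := by
  obtain ⟨E, hE, hM⟩ := squareTraceCount_of_odd (K := K) h2 hF hK hm
  obtain ⟨k, hk⟩ := hm
  have e1 : (q : ℤ) ^ (2 * m - 2) = q ^ (m - 1) * q ^ (m - 1) := by
    rw [← pow_add]; congr 1; omega
  have e2 : (q : ℤ) ^ ((3 * m - 3) / 2) = q ^ (m - 1) * q ^ k := by
    rw [← pow_add]; congr 1; omega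
  have e3 : E = (q : ℤ) ^ k ∨ E = -(q : ℤ) ^ k := by
    rw [← sq_eq_sq_iff_eq_or_eq_neg, hE, ← pow_mul]
    congr 1; omega
  rw [sectionCount_of_two_ne_zero h2 hF hK hβ, Finset.sum_congr rfl fun t _ => by rw [hM t],
    sum_quadraticChar_comp h2 hF hh fun x =>
      if (q : ℤ) ^ (2 * m - 1) - (q : ℤ) ^ (m - 1) * ((q : ℤ) ^ (m - 1) + x * E) = w then 1 else 0,
    e1, e2]
  simp only [eq_comm (b := w)]
  congr 2
  · congr 2; ring
  · congr 1
    rcases e3 with rfl | rfl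
    · congr 3 <;> ring
    · rw [add_comm]
      congr 3 <;> ring

/-- In a quadratic extension every nonzero element of F is a square, so the count takes one value M₁
on all t ≠ 0. The first two moments leave M₁ = q ± 1. The sign depends on whether Tr(z²) has a
nontrivial zero, that is, on whether -1 has the form (z²)^(q-1), and this is decided by q modulo 4.
-/
theorem squareTraceCount_of_quadratic (h2 : (2 : F) ≠ 0) (hF : Fintype.card F = q)
    (hK : Module.finrank F K = 2) (t : F) : (squareTraceCount F K t : ℤ) =
      q + ZMod.χ₄ q - if t = 0 then ZMod.χ₄ q * (q : ℤ) else 0 := by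
  have hcharF := ringChar_ne_two h2
  have hcharK : ringChar K ≠ 2 := ringChar_ne_two (two_ne_zero_of_algebra K h2)
  have hcard := card_eq_pow_of_finrank hF hK
  obtain ⟨h, hh⟩ : ∃ h, q = 2 * h + 1 :=
    Nat.odd_iff.mpr (hF ▸ FiniteField.odd_card_of_char_ne_two hcharF)
  have hq1 : 1 < q := hF ▸ Fintype.one_lt_card
  have hhalf : Fintype.card K / 2 = (q - 1) * (h + 1) := by
    rw [hcard, hh, Nat.add_sub_cancel]
    have : (2 * h + 1) ^ 2 = 2 * (2 * h * (h + 1)) + 1 := by ring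
    omega
  have hsq : ∀ s : F, s ≠ 0 → squareTraceCount F K s = squareTraceCount F K 1 := by
    intro s hs
    have : IsSquare (algebraMap F K s) := by
      rw [FiniteField.isSquare_iff hcharK ((map_ne_zero _).mpr hs), hhalf, pow_mul, ← map_pow,
        ← hF, FiniteField.pow_card_sub_one_eq_one s hs, map_one, one_pow]
    obtain ⟨r, hr⟩ := this
    have := squareTraceCount_mul (K := K) hs (r := r) (by rw [sq, hr]) 1
    rwa [mul_one] at this
  have htr : ∀ z : K, algebraMap F K (Algebra.trace F K z) = z + z ^ q := by
    intro z
    rw [FiniteField.algebraMap_trace_eq_sum_pow, hK, Finset.sum_range_succ, Finset.sum_range_one,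
      Nat.card_eq_fintype_card, hF, pow_zero, pow_one, pow_one]
  have hzero : ∀ z : K, Algebra.trace F K (z ^ 2) = 0 ↔ z ^ 2 + (z ^ 2) ^ q = 0 := fun z => by
    rw [← htr]
    exact (map_eq_zero (algebraMap F K)).symm
  set M₀ : ℤ := (squareTraceCount F K (0 : F) : ℤ) with hM₀
  set M₁ : ℤ := (squareTraceCount F K (1 : F) : ℤ) with hM₁
  have hsum : ∀ f : ℤ → ℤ, ∑ s : F, f (squareTraceCount F K s) = f M₀ + (q - 1) * f M₁ := by
    intro f
    rw [← Finset.add_sum_erase _ _ (Finset.mem_univ (0 : F)),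
      Finset.sum_congr rfl fun s hs => by rw [hsq s (Finset.ne_of_mem_erase hs)],
      Finset.sum_const, Finset.card_erase_of_mem (Finset.mem_univ _), Finset.card_univ, hF,
      nsmul_eq_mul, Nat.cast_sub hq1.le, Nat.cast_one]
  have s1 := sum_squareTraceCount (K := K) hF hK
  have s2 := sum_squareTraceCount_sq (K := K) h2 hF hK (by norm_num)
  zify at s1
  rw [hsum fun x => x] at s1
  rw [hsum fun x => x ^ 2] at s2
  have hqz : (1 : ℤ) < q := by exact_mod_cast hq1
  -- Eliminating M₀ from the two moments gives q(q - 1)(M₁ - q - 1)(M₁ - q + 1) = 0.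
  have hdich : M₁ = q + 1 ∨ M₁ = q - 1 := by
    have h0 : (q : ℤ) * (q - 1) * ((M₁ - q - 1) * (M₁ - q + 1)) = 0 := by
      have e : M₀ = (q : ℤ) ^ 2 - (q - 1) * M₁ := by linarith
      rw [e] at s2
      linear_combination s2
    rcases mul_eq_zero.mp h0 with h0 | h0
    · rcases mul_eq_zero.mp h0 with h0 | h0 <;> omega
    · rcases mul_eq_zero.mp h0 with h0 | h0
      · left; linarith
      · right; linarith
  have hM1 : M₁ = q + ZMod.χ₄ q := by
    rcases Nat.even_or_odd h with ⟨k, hk⟩ | ⟨k, hk⟩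
    · rw [ZMod.χ₄_nat_one_mod_four (by omega)]
      -- M₁ = q - 1 would force M₀ = 2q - 1 > 1, hence some z ≠ 0 with (z²)^(q-1) = -1. Here (q +
      -- 1)/2 is odd, and raising to this power gives z^(q²-1) = -1, a contradiction.
      refine hdich.resolve_right fun hM => ?_
      have hlt : 1 < squareTraceCount F K (0 : F) := by
        have : (1 : ℤ) < M₀ := by rw [hM] at s1; nlinarith
        rw [hM₀] at this
        exact_mod_cast this
      obtain ⟨z, hz, hz0⟩ := Finset.exists_mem_ne hlt 0
      rw [Finset.mem_filter_univ, hzero] at hz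
      have h1 : (z ^ 2) ^ (q - 1) = -1 := by
        have hz2 : z ^ 2 ≠ 0 := pow_ne_zero 2 hz0
        refine mul_left_cancel₀ hz2 ?_
        rw [← pow_succ', Nat.sub_add_cancel hq1.le]
        linear_combination hz
      have h3 : z ^ (Fintype.card K - 1) = 1 := FiniteField.pow_card_sub_one_eq_one z hz0
      have h4 : Fintype.card K - 1 = 2 * (q - 1) * (h + 1) := by
        rw [hcard, hh, Nat.add_sub_cancel]
        have : (2 * h + 1) ^ 2 = 2 * (2 * h) * (h + 1) + 1 := by ring
        omega
      rw [h4, pow_mul, pow_mul, h1, hk, Odd.neg_one_pow ⟨k, by omega⟩] at h3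
      exact two_ne_zero_of_algebra K h2 (by linear_combination -h3)
    · rw [ZMod.χ₄_nat_three_mod_four (by omega)]
      -- M₁ = q + 1 would force M₀ = 1. But a nonzero y of trace zero satisfies y^(q-1) = -1, and
      -- since (q + 1)/2 is even, Euler's criterion makes y a square z², so z is a second zero.
      refine hdich.resolve_left fun hM => ?_
      have hM0 : M₀ = 1 := by rw [hM] at s1; linarith
      have hone : squareTraceCount F K (0 : F) = 1 := by
        rw [hM₀] at hM0
        exact_mod_cast hM0
      have hker : 1 < (Finset.univ.filter fun z : K => Algebra.trace F K z = 0).card := by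
        rw [card_trace_eq hF hK (by norm_num)]
        simpa using hq1
      obtain ⟨y, hy, hy0⟩ := Finset.exists_mem_ne hker 0
      rw [Finset.mem_filter_univ] at hy
      have hy' := htr y
      rw [hy, map_zero] at hy'
      have h1 : y ^ (q - 1) = -1 := by
        refine mul_left_cancel₀ hy0 ?_
        rw [← pow_succ', Nat.sub_add_cancel hq1.le]
        linear_combination -hy'
      obtain ⟨z, rfl⟩ : IsSquare y := by
        rw [FiniteField.isSquare_iff hcharK hy0, hhalf, pow_mul, h1, hk]
        exact Even.neg_one_pow ⟨k + 1, by omega⟩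
      obtain ⟨x, hx⟩ := Finset.card_eq_one.mp hone
      have hz : z = x := Finset.mem_singleton.mp (hx ▸ by
        rw [Finset.mem_filter_univ, sq]; exact hy)
      have h0 : (0 : K) = x := Finset.mem_singleton.mp (hx ▸ by
        rw [Finset.mem_filter_univ]; simp)
      exact hy0 (by rw [hz, ← h0, zero_mul])
  split_ifs with ht
  · rw [ht, ← hM₀]
    have : M₀ = (q : ℤ) ^ 2 - (q - 1) * M₁ := by linarith
    have hc : ZMod.χ₄ (q : ZMod 4) ^ 2 = 1 := by
      rcases hdich with e | e <;>
      · have : ZMod.χ₄ (q : ZMod 4) = M₁ - q := by linarith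
        rw [this, e]; ring
    rw [this, hM1]
    ring
  · rw [hsq t ht, sub_zero, ← hM1]

/-- With [K : L] = 2, transitivity of the trace writes the count as a sum of quadratic counts over
the fibre Tr_{L/F}(s) = t. Only s = 0 is exceptional there, and it lies in the fibre exactly when t
= 0. -/
theorem squareTraceCount_of_even (h2 : (2 : F) ≠ 0) (hF : Fintype.card F = q)
    (hK : Module.finrank F K = m) (hm : Even m) (hm0 : 0 < m) (t : F) :
    (squareTraceCount F K t : ℤ) = (q : ℤ) ^ (m - 1) + ZMod.χ₄ (q ^ (m / 2) : ℕ) *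
      (q : ℤ) ^ (m / 2 - 1) - if t = 0 then ZMod.χ₄ (q ^ (m / 2) : ℕ) * (q : ℤ) ^ (m / 2) else 0 := by
  classical
  obtain ⟨L, hLK, hFL⟩ := exists_subfield_of_even hK hm
  obtain ⟨k, rfl⟩ := hm
  have hk : (k + k) / 2 = k := by omega
  rw [hk] at hFL ⊢
  let _ : Fintype L := Fintype.ofFinite L
  have hL : Fintype.card L = q ^ k := card_eq_pow_of_finrank hF hFL
  have hsum : squareTraceCount F K t =
      ∑ s : L with Algebra.trace F L s = t, squareTraceCount L K s := by
    rw [squareTraceCount, Finset.card_eq_sum_card_fiberwise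
      (f := fun z => Algebra.trace L K (z ^ 2))
      (t := Finset.univ.filter fun s : L => Algebra.trace F L s = t) fun z hz => by
        simpa [Algebra.trace_trace] using hz]
    refine Finset.sum_congr rfl fun s hs => ?_
    rw [squareTraceCount]
    congr 1
    ext z
    simp only [Finset.mem_filter, Finset.mem_univ, true_and, and_iff_right_iff_imp]
    rintro rfl
    rw [← Algebra.trace_trace (S := L)]
    simpa using hs
  have hz : ∑ s : L with Algebra.trace F L s = t,
      (if s = 0 then ZMod.χ₄ (q ^ k : ℕ) * ((q ^ k : ℕ) : ℤ) else 0) =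
      if t = 0 then ZMod.χ₄ (q ^ k : ℕ) * ((q ^ k : ℕ) : ℤ) else 0 := by
    rw [Finset.sum_ite_eq' ]
    simp [eq_comm]
  rw [hsum, Nat.cast_sum, Finset.sum_congr rfl fun s _ =>
    squareTraceCount_of_quadratic (two_ne_zero_of_algebra L h2) hL hLK s, Finset.sum_sub_distrib,
    Finset.sum_const, card_trace_eq hF hFL (by omega), hz, nsmul_eq_mul]
  have e1 : (q : ℤ) ^ (k + k - 1) = q ^ (k - 1) * q ^ k := by
    rw [← pow_add]; congr 1; omega
  rw [e1]
  push_cast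
  ring

theorem sectionCount_of_even (h2 : (2 : F) ≠ 0) (hF : Fintype.card F = q)
    (hK : Module.finrank F K = m) (hm : Even m) (hm0 : 0 < m) {β : F} (hβ : β ≠ 0)
    (w : ℤ) : sectionCount F K q m β w = (q : ℤ) ^ m *
      ((if w = (q : ℤ) ^ (2 * m - 1) - (q : ℤ) ^ (2 * m - 2) +
          ((q : ℤ) - 1) * (ZMod.χ₄ (q ^ (m / 2) : ℕ) * (q : ℤ) ^ ((3 * m - 4) / 2)) then 1 else 0) +
      (if w = (q : ℤ) ^ (2 * m - 1) - (q : ℤ) ^ (2 * m - 2) -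
          ZMod.χ₄ (q ^ (m / 2) : ℕ) * (q : ℤ) ^ ((3 * m - 4) / 2) then (q : ℤ) - 1 else 0)) := by
  have hM := squareTraceCount_of_even (K := K) h2 hF hK hm hm0
  obtain ⟨k, rfl⟩ := hm
  have hk : (k + k) / 2 = k := by omega
  rw [hk] at hM ⊢
  have e1 : (q : ℤ) ^ (2 * (k + k) - 2) = q ^ (k + k - 1) * q ^ (k + k - 1) := by
    rw [← pow_add]; congr 1; omega
  have e2 : (q : ℤ) ^ ((3 * (k + k) - 4) / 2) = q ^ (k + k - 1) * q ^ (k - 1) := by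
    rw [← pow_add]; congr 1; omega
  have e3 : (q : ℤ) ^ k = q ^ (k - 1) * q := by
    rw [← pow_succ]; congr 1; omega
  have hq1 : 1 ≤ q := hF ▸ Fintype.card_pos
  rw [sectionCount_of_two_ne_zero h2 hF hK hβ, ← Finset.add_sum_erase _ _ (Finset.mem_univ (0 : F)),
    Finset.sum_congr rfl fun t ht => by rw [hM t, if_neg (Finset.ne_of_mem_erase ht)],
    Finset.sum_const, Finset.card_erase_of_mem (Finset.mem_univ _), Finset.card_univ, hF,
    nsmul_eq_mul, Nat.cast_sub hq1, Nat.cast_one, hM 0, if_pos rfl, mul_ite, mul_one, mul_zero,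
    e1, e2, e3]
  simp only [eq_comm (b := w)]
  congr 2
  · congr 2; ring
  · congr 2; ring

end OddSections
/-! ### The dual code -/

section DualWords

variable {F K : Type*} [Field F] [Field K] [Algebra F K] {f g : K → F}

/-- Columns of points have first entry 1, so a relation between two of them has opposite
coefficients and forces the points to coincide. The column (0, 1, 0) is not proportional to any of
them. -/
theorem column_pair_independent {i j : Option (solutionSet f g)} (hij : i ≠ j) {a b : F}
    (h : a • column f g i + b • column f g j = 0) : a = 0 ∧ b = 0 := by
  have hbase : ∀ (z : solutionSet f g) (a b : F),
      a • column f g none + b • column f g (some z) = 0 → a = 0 ∧ b = 0 := by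
    intro z a b h
    have hb : b = 0 := by simpa [column] using congrArg Prod.fst h
    have ha := congrArg (fun v => v.2.1) h
    refine ⟨?_, hb⟩
    simpa [column, hb, Algebra.smul_def] using ha
  rcases i with _ | z <;> rcases j with _ | z'
  · exact absurd rfl hij
  · exact hbase z' a b h
  · exact (hbase z b a (by rw [add_comm, h])).symm
  · have h0 : a + b = 0 := by simpa [column] using congrArg Prod.fst h
    have hb : b = -a := (neg_eq_of_add_eq_zero_right h0).symm
    have h1 : a • z.1.1 + b • z'.1.1 = 0 := congrArg (fun v => v.2.1) h
    have h2 : a • z.1.2 + b • z'.1.2 = 0 := congrArg (fun v => v.2.2) h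
    simp only [hb, neg_smul, ← sub_eq_add_neg, ← smul_sub, smul_eq_zero, sub_eq_zero] at h1 h2
    have ha : a = 0 := by
      by_contra ha
      exact hij (congrArg some (Subtype.ext (Prod.ext (h1.resolve_left ha) (h2.resolve_left ha))))
    exact ⟨ha, by rw [hb, ha, neg_zero]⟩

theorem exists_relation_of_sum_eq_zero [Fintype (Option (solutionSet f g))] [DecidableEq F]
    {s : Finset (Option (solutionSet f g))} {x : Option (solutionSet f g) → F}
    (hx : ∀ i ∈ s, x i ≠ 0) (hsum : ∑ i ∈ s, x i • column f g i = 0) :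
    ∃ c : Option (solutionSet f g) → F, ∑ j, c j • column f g j = 0 ∧ hammingNorm c = s.card := by
  classical
  refine ⟨fun i => if i ∈ s then x i else 0, ?_, hammingNorm_indicator hx⟩
  simpa only [ite_smul, zero_smul, Finset.sum_ite_mem, Finset.univ_inter] using hsum

theorem exists_relation_three [Fintype (Option (solutionSet f g))] [DecidableEq F]
    {i j k : Option (solutionSet f g)} (hij : i ≠ j) (hik : i ≠ k) (hjk : j ≠ k) {a b c : F}
    (ha : a ≠ 0) (hb : b ≠ 0) (hc : c ≠ 0)
    (h : a • column f g i + b • column f g j + c • column f g k = 0) :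
    ∃ x : Option (solutionSet f g) → F, ∑ j, x j • column f g j = 0 ∧ hammingNorm x = 3 := by
  classical
  rw [← Finset.card_eq_three.mpr ⟨i, j, k, hij, hik, hjk, rfl⟩]
  refine exists_relation_of_sum_eq_zero
    (x := fun t => if t = i then a else if t = j then b else c) (fun t _ => ?_) ?_
  · split_ifs <;> assumption
  · rw [Finset.sum_insert (by simp [hij, hik]), Finset.sum_pair hjk, ← h]
    simp [hij.symm, hik.symm, hjk.symm, add_assoc]

theorem three_le_of_relation [Fintype (Option (solutionSet f g))] [DecidableEq F]
    (hcard : 2 ≤ Fintype.card (Option (solutionSet f g))) {x : Option (solutionSet f g) → F}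
    (hx : x ≠ 0) (hsum : ∑ j, x j • column f g j = 0) : 3 ≤ hammingNorm x := by
  classical
  refine lt_hammingNorm_of_sum_smul_eq_zero hcard (fun s hs y hy => ?_) hx hsum
  obtain ⟨i, j, hij, rfl⟩ := Finset.card_eq_two.mp hs
  rw [Finset.sum_pair hij] at hy
  simpa using column_pair_independent hij hy

theorem isMinDist_dualCode_range_encode [FiniteDimensional F K] [Algebra.IsSeparable F K]
    [Fintype (Option (solutionSet f g))] [DecidableEq F] {d : ℕ} (hd : 0 < d)
    (hex : ∃ x : Option (solutionSet f g) → F,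
      ∑ j, x j • column f g j = 0 ∧ hammingNorm x = d)
    (hle : ∀ x : Option (solutionSet f g) → F, x ≠ 0 → ∑ j, x j • column f g j = 0 →
      d ≤ hammingNorm x) :
    IsMinDist (dualCode (LinearMap.range (encode f g))) d := by
  refine isMinDist_of_hammingNorm hd ?_ fun c hc hc0 => hle c hc0 (mem_dualCode_range_encode.mp hc)
  obtain ⟨x, hx, hxd⟩ := hex
  exact ⟨x, mem_dualCode_range_encode.mpr hx, hxd⟩

end DualWords

section DualDistance

/-- The point `(x, 0)` of the solution set of `f₂` and `g₂`, for `x` of trace zero. -/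
def tracePoint {F K : Type*} [Field F] [Field K] [Algebra F K] {x : K}
    (hx : Algebra.trace F K x = 0) : solutionSet (f₂ F K) (g₂ F K) :=
  ⟨(x, 0), by simp [f₂, g₂, hx]⟩

theorem tracePoint_ne {F K : Type*} [Field F] [Field K] [Algebra F K] {x y : K}
    (hx : Algebra.trace F K x = 0) (hy : Algebra.trace F K y = 0) (h : x ≠ y) :
    some (tracePoint hx) ≠ some (tracePoint hy) := fun e =>
  h (congrArg (fun z => z.1.1) (Option.some_injective _ e))

variable {F K : Type*} [Field F] [Fintype F] [DecidableEq F] [Field K] [Fintype K] [Algebra F K]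
  {q m : ℕ}

theorem three_le_card_option_solutionSet (hF : Fintype.card F = q) (hK : Module.finrank F K = m)
    (hm : 2 ≤ m) : 3 ≤ Fintype.card (Option (solutionSet (f₂ F K) (g₂ F K))) := by
  rw [card_option_solutionSet hF hK (by omega)]
  have h1 : 2 ≤ q := hF ▸ Fintype.one_lt_card
  have h2 : q = q ^ 1 := (pow_one q).symm
  have h3 : q ^ 1 ≤ q ^ (2 * m - 1) := Nat.pow_le_pow_right (by omega) (by omega)
  omega

/-- Two sources of words of weight 3: if Tr(1) = m = 0, the points (0, 0) and (1, 0) differ by the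
extra column; if q ≥ 3, an F-line of trace-zero elements carries three collinear points. -/
theorem isMinDist_dual_three (hF : Fintype.card F = q) (hK : Module.finrank F K = m)
    (hm : 2 ≤ m) (h : (m : F) = 0 ∨ 3 ≤ q) :
    IsMinDist (dualCode (LinearMap.range (encode (f₂ F K) (g₂ F K)))) 3 := by
  classical
  have hcard := three_le_card_option_solutionSet hF hK hm
  have h0 : Algebra.trace F K 0 = 0 := map_zero _
  refine isMinDist_dualCode_range_encode (by norm_num) ?_
    fun x hx hs => three_le_of_relation (by omega) hx hs
  rcases h with hm0 | hq
  · have h1 : Algebra.trace F K 1 = 0 := by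
      rw [← map_one (algebraMap F K), Algebra.trace_algebraMap, hK, nsmul_eq_mul, hm0, zero_mul]
    refine exists_relation_three (Option.some_ne_none (tracePoint h0)).symm
      (Option.some_ne_none (tracePoint h1)).symm
      (tracePoint_ne h0 h1 zero_ne_one) (a := 1) (b := 1) (c := -1) one_ne_zero one_ne_zero
      (neg_ne_zero.mpr one_ne_zero) ?_
    simp [column, tracePoint]
  · have hker : 1 < (Finset.univ.filter fun x : K => Algebra.trace F K x = 0).card := by
      rw [card_trace_eq hF hK (by omega)]
      exact Nat.one_lt_pow (by omega) (by omega)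
    obtain ⟨d, hd, hd0⟩ := Finset.exists_mem_ne hker 0
    rw [Finset.mem_filter_univ] at hd
    -- The points 0, d, ζd get coefficients ζ - 1, -ζ, 1, which sum to zero and are all nonzero.
    obtain ⟨ζ, hζ⟩ : ∃ ζ, ζ ∉ ({0, 1} : Finset F) := by
      by_contra! hcon
      have := Finset.card_le_card fun ζ (_ : ζ ∈ Finset.univ) => hcon ζ
      rw [Finset.card_univ, hF] at this
      have := this.trans Finset.card_le_two
      omega
    simp only [Finset.mem_insert, Finset.mem_singleton, not_or] at hζ
    have hζd : Algebra.trace F K (ζ • d) = 0 := by rw [map_smul, hd, smul_zero]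
    refine exists_relation_three (tracePoint_ne h0 hd hd0.symm)
      (tracePoint_ne h0 hζd (smul_ne_zero hζ.1 hd0).symm)
      (tracePoint_ne hd hζd fun e => hζ.2 ?_) (a := ζ - 1) (b := -ζ) (c := 1)
      (sub_ne_zero.mpr hζ.2) (neg_ne_zero.mpr hζ.1) one_ne_zero ?_
    · have : (ζ - 1) • d = 0 := by rw [sub_smul, one_smul, ← e, sub_self]
      exact sub_eq_zero.mp ((smul_eq_zero.mp this).resolve_right hd0)
    · simp [column, tracePoint, show ζ - 1 + -ζ + 1 = 0 by ring]

/-- Over the field of two elements all coefficients are 1. Three points cannot cancel in the first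
entry, so a relation of length three would be the extra column plus two points with y = y' and x +
x' = 1. Both points lie on the solution set, so Tr(x) = Tr(x') and m = Tr(1) = 0. -/
theorem four_le_of_relation (hF : Fintype.card F = 2) (hK : Module.finrank F K = m) (hm : 2 ≤ m)
    (hm0 : (m : F) ≠ 0) {x : Option (solutionSet (f₂ F K) (g₂ F K)) → F} (hx : x ≠ 0)
    (hsum : ∑ j, x j • column (f₂ F K) (g₂ F K) j = 0) : 4 ≤ hammingNorm x := by
  classical
  have htwo : (2 : F) = 0 := by
    have := FiniteField.cast_card_eq_zero F
    rw [hF] at this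
    exact_mod_cast this
  have hone : ∀ a : F, a ≠ 0 → a = 1 := by
    intro a ha
    have := FiniteField.pow_card_sub_one_eq_one a ha
    rwa [hF, pow_one] at this
  have hbase : ∀ z z' : solutionSet (f₂ F K) (g₂ F K),
      column (f₂ F K) (g₂ F K) none + column (f₂ F K) (g₂ F K) (some z) +
        column (f₂ F K) (g₂ F K) (some z') ≠ 0 := by
    rintro ⟨⟨x, y⟩, hz⟩ ⟨⟨x', y'⟩, hz'⟩ h
    have h1 : 1 + x + x' = 0 := congrArg (fun v => v.2.1) h
    have h2 : 0 + y + y' = 0 := congrArg (fun v => v.2.2) h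
    have hy : y ^ 2 = y' ^ 2 := by linear_combination (y - y') * h2
    have ht : (m : F) + Algebra.trace F K x + Algebra.trace F K x' = 0 := by
      rw [← map_zero (Algebra.trace F K), ← h1, map_add, map_add, ← map_one (algebraMap F K),
        Algebra.trace_algebraMap, hK, nsmul_eq_mul, mul_one]
    simp only [f₂, g₂, hy] at hz hz'
    exact hm0 (by linear_combination ht - hz - hz' + Algebra.trace F K (y' ^ 2) * htwo)
  refine lt_hammingNorm_of_sum_smul_eq_zero (three_le_card_option_solutionSet hF hK hm)
    (fun s hs a ha => ?_) hx hsum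
  obtain ⟨i, j, k, hij, hik, hjk, rfl⟩ := Finset.card_eq_three.mp hs
  rw [Finset.sum_insert (by simp [hij, hik]), Finset.sum_pair hjk] at ha
  have hall : a i = 0 ∧ a j = 0 ∧ a k = 0 := by
    by_cases hi : a i = 0
    · rw [hi, zero_smul, zero_add] at ha
      exact ⟨hi, column_pair_independent hjk ha⟩
    by_cases hj : a j = 0
    · rw [hj, zero_smul, zero_add] at ha
      exact absurd (column_pair_independent hik ha).1 hi
    by_cases hk : a k = 0
    · rw [hk, zero_smul, add_zero] at ha
      exact absurd (column_pair_independent hij ha).1 hi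
    rw [hone _ hi, hone _ hj, hone _ hk, one_smul, one_smul, one_smul] at ha
    exfalso
    rcases i with _ | z <;> rcases j with _ | z' <;> rcases k with _ | z''
    · exact hij rfl
    · exact hij rfl
    · exact hik rfl
    · exact hbase z' z'' (by rw [← ha, add_assoc])
    · exact hjk rfl
    · exact hbase z z'' (by rw [← ha]; abel)
    · exact hbase z z' (by rw [← ha]; abel)
    · have h1 : (1 : F) + (1 + 1) = 0 := congrArg Prod.fst ha
      exact one_ne_zero (α := F) (by linear_combination h1 - htwo)
  simpa using hall

/-- For m ≥ 3 the trace kernel has at least four elements, and the points over 0, d, e, d + e sum to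
zero. -/
theorem isMinDist_dual_four (hF : Fintype.card F = 2) (hK : Module.finrank F K = m) (hm : 3 ≤ m)
    (hm0 : (m : F) ≠ 0) :
    IsMinDist (dualCode (LinearMap.range (encode (f₂ F K) (g₂ F K)))) 4 := by
  classical
  have htwo : (2 : F) = 0 := by
    have := FiniteField.cast_card_eq_zero F
    rw [hF] at this
    exact_mod_cast this
  have htwoK : (2 : K) = 0 := by rw [← map_ofNat (algebraMap F K) 2, htwo, map_zero]
  refine isMinDist_dualCode_range_encode (by norm_num) ?_
    fun x hx hs => four_le_of_relation hF hK (by omega) hm0 hx hs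
  have hker : 4 ≤ (Finset.univ.filter fun x : K => Algebra.trace F K x = 0).card := by
    rw [card_trace_eq hF hK (by omega)]
    exact Nat.pow_le_pow_right (n := 2) (i := 2) (by norm_num) (by omega)
  obtain ⟨d, hd, hd0⟩ := Finset.exists_mem_ne (lt_of_lt_of_le (by norm_num) hker) 0
  obtain ⟨e, he, hde⟩ : ∃ e ∈ Finset.univ.filter fun x : K => Algebra.trace F K x = 0,
      e ∉ ({0, d} : Finset K) := by
    by_contra! hcon
    have := (Finset.card_le_card fun e he => hcon e he).trans Finset.card_le_two
    omega
  simp only [Finset.mem_insert, Finset.mem_singleton, not_or] at hde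
  rw [Finset.mem_filter_univ] at hd he
  have h0 : Algebra.trace F K 0 = 0 := map_zero _
  have hs : Algebra.trace F K (d + e) = 0 := by rw [map_add, hd, he, add_zero]
  have hne : d + e ≠ 0 := fun h => hde.2 (by linear_combination h - d * htwoK)
  have n1 := tracePoint_ne h0 hd hd0.symm
  have n2 := tracePoint_ne h0 he (Ne.symm hde.1)
  have n3 := tracePoint_ne h0 hs hne.symm
  have n4 := tracePoint_ne hd he (Ne.symm hde.2)
  have n5 := tracePoint_ne hd hs (by simpa using hde.1)
  have n6 := tracePoint_ne he hs (by simpa using hd0)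
  have hc : ({some (tracePoint h0), some (tracePoint hd), some (tracePoint he),
      some (tracePoint hs)} : Finset (Option (solutionSet (f₂ F K) (g₂ F K)))).card = 4 := by
    rw [Finset.card_insert_of_notMem (by simp only [Finset.mem_insert, Finset.mem_singleton]; tauto),
      Finset.card_eq_three.mpr ⟨_, _, _, n4, n5, n6, rfl⟩]
  rw [← hc]
  refine exists_relation_of_sum_eq_zero (x := fun _ => 1) (fun _ _ => one_ne_zero) ?_
  rw [Finset.sum_insert (by simp only [Finset.mem_insert, Finset.mem_singleton]; tauto),
    Finset.sum_insert (by simp only [Finset.mem_insert, Finset.mem_singleton]; tauto),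
    Finset.sum_pair n6]
  simp only [one_smul, column, tracePoint, Prod.mk_add_mk, Prod.mk_eq_zero, add_zero, zero_add,
    and_true]
  exact ⟨by linear_combination 2 * htwo, by linear_combination (d + e) * htwoK⟩

end DualDistance
/-! ### The weight distributions -/

theorem hasParams_dual {F K : Type*} [Field F] [DecidableEq F] [Field K] [Fintype K]
    [Algebra F K] {q m : ℕ} {k k' d : ℕ}
    (hdim : HasLengthDim (LinearMap.range (encode (f₂ F K) (g₂ F K))) (q ^ (2 * m - 1) + 1) k)
    (hk : q ^ (2 * m - 1) + 1 - k = k')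
    (hd : IsMinDist (dualCode (LinearMap.range (encode (f₂ F K) (g₂ F K)))) d) :
    HasParams (dualCode (LinearMap.range (encode (f₂ F K) (g₂ F K)))) (q ^ (2 * m - 1) + 1) k' d :=
  ⟨⟨hdim.1, by rw [finrank_dualCode, hdim.1, hdim.2, hk]⟩, hd⟩

/-- Ensures that the natural-number subtraction in the dimension of the dual is not truncated. -/
theorem two_mul_le_pow {q m : ℕ} (hq : 2 ≤ q) (hm : 2 ≤ m) : 2 * m ≤ q ^ (2 * m - 1) := by
  have h : 2 * m - 1 < 2 ^ (2 * m - 1) := Nat.lt_two_pow_self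
  have h2 : 2 ^ (2 * m - 1) ≤ q ^ (2 * m - 1) := Nat.pow_le_pow_left hq _
  omega

section Tables

variable {F K : Type*} [Field F] [Fintype F] [DecidableEq F] [Field K] [Fintype K] [Algebra F K]
  {q m : ℕ}

/-- The left side of `h` counts triples and the table counts words; the factor q^e is the size of
the kernel. The dimension is then read off by rank-nullity. -/
theorem hasWeightTable_and_hasLengthDim_of_tableSum (hF : Fintype.card F = q)
    (hK : Module.finrank F K = m) (hm : 2 ≤ m) {R : ℤ → ℤ}
    (hR : ∀ β : F, β ≠ 0 → ∀ w, sectionCount F K q m β w = R w) (e : ℕ) {T : List (ℤ × ℤ)}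
    (hnd : (((0, 1) :: T).map Prod.fst).Nodup) (hnn : ∀ r ∈ T, 0 ≤ r.1)
    (h : ∀ w : ℤ, (if w = 0 then 1 else 0) +
      (if w = (q : ℤ) ^ (2 * m - 1) then (q : ℤ) - 1 else 0) +
      (if w = (q : ℤ) ^ (2 * m - 1) - (q : ℤ) ^ (2 * m - 2) then
        if (m : F) = 0 then (q : ℤ) ^ (2 * m) - q ^ (m + 2) + q ^ (m + 1) - q
        else (q : ℤ) ^ (2 * m) - q else 0) +
      (if w = (q : ℤ) ^ (2 * m - 1) - (q : ℤ) ^ (2 * m - 2) + 1 then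
        if (m : F) = 0 then (q : ℤ) ^ (2 * m + 1) - q ^ (2 * m)
        else (q : ℤ) ^ (2 * m + 1) - q ^ (2 * m) - q ^ (m + 2) + q ^ (m + 1) else 0) +
      ((q : ℤ) - 1) * R (w - if (m : F) = 0 then 0 else 1) =
      (q : ℤ) ^ e * tableSum ((0, 1) :: T) w) :
    HasWeightTable (LinearMap.range (encode (f₂ F K) (g₂ F K))) ((0, 1) :: T) ∧
      HasLengthDim (LinearMap.range (encode (f₂ F K) (g₂ F K))) (q ^ (2 * m - 1) + 1)
        (2 * m + 1 - e) := by
  classical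
  have hq : 1 < q := hF ▸ Fintype.one_lt_card
  have hP := fun w => (card_hammingNorm_encode (K := K) hF hK hm hR w).trans (h w)
  have hker : (Finset.univ.filter fun u : F × K × K =>
      hammingNorm (encode (f₂ F K) (g₂ F K) u) = 0).card = q ^ e := by
    -- At w = 0 the table contributes exactly 1, so the identity itself yields the size of the
    -- kernel.
    have := hP 0
    rw [tableSum_of_mem hnd (r := (0, 1)) (List.mem_cons_self), mul_one] at this
    exact_mod_cast this
  refine ⟨hasWeightTable_of_tableSum hnd ?_ fun w => ?_, card_option_solutionSet hF hK (by omega), ?_⟩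
  · intro r hr
    rcases List.mem_cons.mp hr with rfl | hr
    · exact le_rfl
    · exact hnn r hr
  · have h1 := card_ker_mul_weightCount (encode (f₂ F K) (g₂ F K)) w
    have h2 := hP w
    simp only [Nat.cast_inj] at h2
    rw [hker] at h1
    have h3 : ((q : ℤ) ^ e) ≠ 0 := by positivity
    refine mul_left_cancel₀ h3 (Eq.trans ?_ h2)
    exact_mod_cast h1
  · have h1 := LinearMap.finrank_range_add_finrank_ker (encode (f₂ F K) (g₂ F K))
    have h2 : Module.finrank F (F × K × K) = 2 * m + 1 := by
      rw [Module.finrank_prod, Module.finrank_prod, Module.finrank_self, hK]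
      omega
    have h3 : Fintype.card (LinearMap.ker (encode (f₂ F K) (g₂ F K))) = q ^ e := by
      rw [← hker, Fintype.card_subtype]
      congr 1
      ext u
      simp
    rw [Module.card_eq_pow_finrank (K := F), hF] at h3
    have h4 := Nat.pow_right_injective hq h3
    omega

/-- For q = 2 the weight q^(2m-1) - 2q^(2m-2) of the two-root sections is 0. The triple (0, 1, 1) is
encoded to the zero word, since Tr(y²) = Tr(y) and Tr(1) = m = 0. Hence e = 1 and the dimension
drops to 2m. -/
theorem params_of_even_even_two (hF : Fintype.card F = 2) (hK : Module.finrank F K = m)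
    (hm : 2 ≤ m) [CharP F 2] (hm0 : (m : F) = 0) :
    IsWeightCode (LinearMap.range (encode (f₂ F K) (g₂ F K))) 3 ∧
    HasParams (LinearMap.range (encode (f₂ F K) (g₂ F K))) (2 ^ (2 * m - 1) + 1) (2 * m)
      (2 ^ (2 * m - 2)) ∧
    HasWeightTable (LinearMap.range (encode (f₂ F K) (g₂ F K)))
      [(0, 1),
       (2 ^ (2 * m - 2), 2 ^ (2 * m - 1) - 2),
       (2 ^ (2 * m - 2) + 1, 2 ^ (2 * m) - 2 ^ (2 * m - 1)),
       (2 ^ (2 * m - 1), 1)] := by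
  have e1 : (2 : ℤ) ^ (2 * m - 1) = 2 * 2 ^ (2 * m - 2) := by
    rw [← pow_succ']; congr 1; omega
  have e2 : (2 : ℤ) ^ (2 * m) = 4 * 2 ^ (2 * m - 2) := by
    rw [show 2 * m = 2 + (2 * m - 2) by omega, pow_add]; norm_num
  have e3 : (2 : ℤ) ^ (2 * m + 1) = 8 * 2 ^ (2 * m - 2) := by
    rw [pow_succ, e2]; ring
  have hX : (4 : ℤ) ≤ 2 ^ (2 * m - 2) := by
    have := pow_le_pow_right₀ (a := (2 : ℤ)) (by norm_num) (show 2 ≤ 2 * m - 2 by omega)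
    linarith
  obtain ⟨ht, hd⟩ := hasWeightTable_and_hasLengthDim_of_tableSum hF hK hm
    (fun β hβ w => sectionCount_of_charP_two (h := 1) hF hK hm rfl hβ w) 1
    (T := [(2 ^ (2 * m - 2), 2 ^ (2 * m - 1) - 2),
       (2 ^ (2 * m - 2) + 1, 2 ^ (2 * m) - 2 ^ (2 * m - 1)),
       (2 ^ (2 * m - 1), 1)])
    (by
      -- Once the power is abstracted to X ≥ 4, comparing the weights is linear arithmetic.
      rw [e1]
      generalize (2 : ℤ) ^ (2 * m - 2) = X at *
      simp
      omega)
    (by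
      rw [e1]
      generalize (2 : ℤ) ^ (2 * m - 2) = X at *
      simp
      omega)
    (fun w => by
      simp only [hm0, if_true, tableSum, List.map_cons, List.map_nil, List.sum_cons, List.sum_nil]
      push_cast
      rw [e1, e2, e3, pow_succ _ (m + 1)]
      rw [show (2 : ℤ) * 2 ^ (2 * m - 2) - 2 ^ (2 * m - 2) = 2 ^ (2 * m - 2) by ring,
        sub_self, sub_zero]
      generalize (2 : ℤ) ^ (2 * m - 2) = X at *
      split_ifs <;> omega)
  refine ⟨ht.isWeightCode ?_ rfl, ⟨hd, ht.isMinDist (by positivity) ?_ ?_⟩, ht⟩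
  all_goals
    push_cast
    rw [e1]
    try rw [e2]
    generalize (2 : ℤ) ^ (2 * m - 2) = X at *
    simp
    omega

end Tables
-- Weight tables in even characteristic, outside the case q = 2 with m even
section EvenTables

variable {F K : Type*} [Field F] [Fintype F] [DecidableEq F] [Field K] [Fintype K] [Algebra F K]
  {q m : ℕ}

theorem params_of_even_even (hF : Fintype.card F = q) (hK : Module.finrank F K = m)
    (hm : 2 ≤ m) [CharP F 2] (hm0 : (m : F) = 0) {h : ℕ} (hh : 2 * h = q) (hq : 3 ≤ q) :
    IsWeightCode (LinearMap.range (encode (f₂ F K) (g₂ F K))) 4 ∧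
    HasParams (LinearMap.range (encode (f₂ F K) (g₂ F K))) (q ^ (2 * m - 1) + 1) (2 * m + 1)
      ((q - 2) * q ^ (2 * m - 2)) ∧
    HasWeightTable (LinearMap.range (encode (f₂ F K) (g₂ F K)))
      [(0, 1),
       (((q : ℤ) - 2) * q ^ (2 * m - 2), (q : ℤ) * (q - 1) ^ 2 / 2),
       (((q : ℤ) - 1) * q ^ (2 * m - 2), (q : ℤ) ^ (2 * m) - q ^ 3 + 2 * q ^ 2 - 2 * q),
       (((q : ℤ) - 1) * q ^ (2 * m - 2) + 1, (q : ℤ) ^ (2 * m + 1) - q ^ (2 * m)),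
       ((q : ℤ) ^ (2 * m - 1), ((q : ℤ) - 1) * (q ^ 2 - q + 2) / 2)] := by
  have hhz : (q : ℤ) = 2 * h := by exact_mod_cast hh.symm
  -- Both divisions by 2 are exact because q = 2h.
  have d1 : (q : ℤ) * (q - 1) ^ 2 / 2 = h * (q - 1) ^ 2 :=
    Int.ediv_eq_of_eq_mul_right two_ne_zero (by rw [hhz]; ring)
  have d2 : ((q : ℤ) - 1) * (q ^ 2 - q + 2) / 2 = (q - 1) + h * (q - 1) ^ 2 :=
    Int.ediv_eq_of_eq_mul_right two_ne_zero (by rw [hhz]; ring)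
  have hqz : (3 : ℤ) ≤ q := by exact_mod_cast hq
  have hhpos : (0 : ℤ) < h := by omega
  have e1 : (q : ℤ) ^ (2 * m - 1) = (q - 1) * q ^ (2 * m - 2) + q ^ (2 * m - 2) := by
    rw [show 2 * m - 1 = 2 * m - 2 + 1 by omega, pow_succ]; ring
  have e2 : ((q : ℤ) - 2) * q ^ (2 * m - 2) = (q - 1) * q ^ (2 * m - 2) - q ^ (2 * m - 2) := by
    ring
  have e3 : (q : ℤ) ^ (2 * m) = q ^ m * q ^ m := by rw [← pow_add]; congr 1; omega
  have hu : (q : ℤ) ^ 2 ≤ q ^ m := pow_le_pow_right₀ (by linarith) hm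
  have hX : (2 : ℤ) ≤ q ^ (2 * m - 2) := by
    have := pow_le_pow_right₀ (a := (q : ℤ)) (by linarith) (show 1 ≤ 2 * m - 2 by omega)
    rw [pow_one] at this
    linarith
  -- With X = q^(2m-2) and L = (q - 1)X, the bounds 2X ≤ L and X ≥ 2 give 0 < L - X < L < L + 1 < L
  -- + X, so the rows are distinct.
  have hL : 2 * (q : ℤ) ^ (2 * m - 2) ≤ (q - 1) * q ^ (2 * m - 2) := by nlinarith
  have hmult : (h : ℤ) * (q - 1) ^ 2 ≠ 0 ∧ (q : ℤ) ^ (2 * m) - q ^ 3 + 2 * q ^ 2 - 2 * q ≠ 0 ∧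
      (q : ℤ) ^ (2 * m + 1) - q ^ (2 * m) ≠ 0 ∧ (q - 1) + (h : ℤ) * (q - 1) ^ 2 ≠ 0 := by
    rw [pow_succ _ (2 * m), e3]
    generalize (q : ℤ) ^ m = u at *
    have h1 : (0 : ℤ) < (q - 1) ^ 2 := by nlinarith
    have hu0 : 0 < u := by nlinarith
    have h2 : (q : ℤ) ^ 2 * q ^ 2 ≤ u * u := mul_le_mul hu hu (by positivity) hu0.le
    refine ⟨ne_of_gt (by positivity), ne_of_gt ?_, ne_of_gt ?_, ne_of_gt ?_⟩
    · nlinarith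
    · nlinarith [mul_pos hu0 hu0]
    · nlinarith
  rw [d1, d2]
  obtain ⟨ht, hd⟩ := hasWeightTable_and_hasLengthDim_of_tableSum hF hK hm
    (fun β hβ w => sectionCount_of_charP_two (h := h) hF hK hm hh hβ w) 0
    (T := [(((q : ℤ) - 2) * q ^ (2 * m - 2), (h : ℤ) * (q - 1) ^ 2),
       (((q : ℤ) - 1) * q ^ (2 * m - 2), (q : ℤ) ^ (2 * m) - q ^ 3 + 2 * q ^ 2 - 2 * q),
       (((q : ℤ) - 1) * q ^ (2 * m - 2) + 1, (q : ℤ) ^ (2 * m + 1) - q ^ (2 * m)),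
       ((q : ℤ) ^ (2 * m - 1), (q - 1) + h * (q - 1) ^ 2)])
    (by
      rw [e1, e2]
      generalize ((q : ℤ) - 1) * q ^ (2 * m - 2) = L at *
      generalize (q : ℤ) ^ (2 * m - 2) = X at *
      simp
      omega)
    (by
      rw [e1, e2]
      generalize ((q : ℤ) - 1) * q ^ (2 * m - 2) = L at *
      generalize (q : ℤ) ^ (2 * m - 2) = X at *
      simp
      omega)
    (fun w => by
      simp only [hm0, if_true, tableSum, List.map_cons, List.map_nil, List.sum_cons, List.sum_nil]
      rw [e1, e2, e3, pow_succ _ (2 * m), e3, pow_succ _ (m + 1), pow_succ _ m, sub_zero,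
        show ∀ a b : ℤ, a + b - 2 * b = a - b by intros; ring, add_sub_cancel_right]
      generalize ((q : ℤ) - 1) * q ^ (2 * m - 2) = L at *
      generalize (q : ℤ) ^ (2 * m - 2) = X at *
      split_ifs <;> ring1)
  have hdist : (((q - 2) * q ^ (2 * m - 2) : ℕ) : ℤ) =
      (q - 1) * q ^ (2 * m - 2) - q ^ (2 * m - 2) := by
    rw [← e2]
    push_cast [show 2 ≤ q by omega]
    rfl
  refine ⟨ht.isWeightCode ?_ rfl, ⟨hd, ht.isMinDist ?_ ?_ ?_⟩, ht⟩
  · simpa only [List.forall_mem_cons, List.not_mem_nil, IsEmpty.forall_iff, implies_true, and_true]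
      using hmult
  · exact Nat.mul_pos (by omega) (by positivity)
  · exact ⟨_, List.mem_cons_self, by rw [hdist, e2], hmult.1⟩
  · rw [hdist, e1, e2]
    generalize ((q : ℤ) - 1) * q ^ (2 * m - 2) = L at *
    generalize (q : ℤ) ^ (2 * m - 2) = X at *
    simp
    omega

/-- Here Tr(β) = mβ ≠ 0 for β ≠ 0, so the sections of nonzero scalars are shifted by 1. The encoding
is injective even for q = 2, where the smallest nonzero weight is 1. -/
theorem params_of_even_odd (hF : Fintype.card F = q) (hK : Module.finrank F K = m)
    (hm : 3 ≤ m) [CharP F 2] (hm0 : (m : F) ≠ 0) {h : ℕ} (hh : 2 * h = q) :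
    IsWeightCode (LinearMap.range (encode (f₂ F K) (g₂ F K))) 5 ∧
    HasParams (LinearMap.range (encode (f₂ F K) (g₂ F K))) (q ^ (2 * m - 1) + 1) (2 * m + 1)
      ((q - 2) * q ^ (2 * m - 2) + 1) ∧
    HasWeightTable (LinearMap.range (encode (f₂ F K) (g₂ F K)))
      [(0, 1),
       (((q : ℤ) - 2) * q ^ (2 * m - 2) + 1, (q : ℤ) * (q - 1) ^ 2 / 2),
       (((q : ℤ) - 1) * q ^ (2 * m - 2), (q : ℤ) ^ (2 * m) - q),
       (((q : ℤ) - 1) * q ^ (2 * m - 2) + 1,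
         (q : ℤ) ^ (2 * m + 1) - q ^ (2 * m) - q ^ 3 + 2 * q ^ 2 - q),
       ((q : ℤ) ^ (2 * m - 1), (q : ℤ) - 1),
       ((q : ℤ) ^ (2 * m - 1) + 1, (q : ℤ) * (q - 1) ^ 2 / 2)] := by
  have hhz : (q : ℤ) = 2 * h := by exact_mod_cast hh.symm
  have d1 : (q : ℤ) * (q - 1) ^ 2 / 2 = h * (q - 1) ^ 2 :=
    Int.ediv_eq_of_eq_mul_right two_ne_zero (by rw [hhz]; ring)
  have hq : 1 < q := hF ▸ Fintype.one_lt_card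
  have hqz : (2 : ℤ) ≤ q := by exact_mod_cast hq
  have hhpos : (0 : ℤ) < h := by omega
  have e1 : (q : ℤ) ^ (2 * m - 1) = (q - 1) * q ^ (2 * m - 2) + q ^ (2 * m - 2) := by
    rw [show 2 * m - 1 = 2 * m - 2 + 1 by omega, pow_succ]; ring
  have e2 : ((q : ℤ) - 2) * q ^ (2 * m - 2) = (q - 1) * q ^ (2 * m - 2) - q ^ (2 * m - 2) := by
    ring
  have e3 : (q : ℤ) ^ (2 * m) = q ^ m * q ^ m := by rw [← pow_add]; congr 1; omega
  have hu : (q : ℤ) ^ 2 ≤ q ^ m := pow_le_pow_right₀ (by linarith) (by omega)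
  have hX : (2 : ℤ) ≤ q ^ (2 * m - 2) := by
    have := pow_le_pow_right₀ (a := (q : ℤ)) (by linarith) (show 1 ≤ 2 * m - 2 by omega)
    rw [pow_one] at this
    linarith
  have hL : (q : ℤ) ^ (2 * m - 2) ≤ (q - 1) * q ^ (2 * m - 2) := by nlinarith
  have hmult : (h : ℤ) * (q - 1) ^ 2 ≠ 0 ∧ (q : ℤ) ^ (2 * m) - q ≠ 0 ∧
      (q : ℤ) ^ (2 * m + 1) - q ^ (2 * m) - q ^ 3 + 2 * q ^ 2 - q ≠ 0 ∧ (q - 1 : ℤ) ≠ 0 ∧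
      (h : ℤ) * (q - 1) ^ 2 ≠ 0 := by
    rw [pow_succ _ (2 * m), e3]
    generalize (q : ℤ) ^ m = u at *
    have h1 : (0 : ℤ) < (q - 1) ^ 2 := by nlinarith
    have hu0 : 0 < u := by nlinarith
    have h2 : (q : ℤ) ^ 2 * q ^ 2 ≤ u * u := mul_le_mul hu hu (by positivity) hu0.le
    have h3 : (q : ℤ) ^ 2 ≤ u * u := by nlinarith
    refine ⟨ne_of_gt (by positivity), ne_of_gt (by nlinarith), ne_of_gt ?_,
      ne_of_gt (by linarith), ne_of_gt (by positivity)⟩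
    -- With u = q^m this product is the third multiplicity in factored form.
    have h4 : 0 < ((q : ℤ) - 1) * (u * u - q * (q - 1)) := mul_pos (by linarith) (by nlinarith)
    linarith
  rw [d1]
  obtain ⟨ht, hd⟩ := hasWeightTable_and_hasLengthDim_of_tableSum hF hK (by omega)
    (fun β hβ w => sectionCount_of_charP_two (h := h) hF hK (by omega) hh hβ w) 0
    (T := [(((q : ℤ) - 2) * q ^ (2 * m - 2) + 1, (h : ℤ) * (q - 1) ^ 2),
       (((q : ℤ) - 1) * q ^ (2 * m - 2), (q : ℤ) ^ (2 * m) - q),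
       (((q : ℤ) - 1) * q ^ (2 * m - 2) + 1,
         (q : ℤ) ^ (2 * m + 1) - q ^ (2 * m) - q ^ 3 + 2 * q ^ 2 - q),
       ((q : ℤ) ^ (2 * m - 1), (q : ℤ) - 1),
       ((q : ℤ) ^ (2 * m - 1) + 1, (h : ℤ) * (q - 1) ^ 2)])
    (by
      rw [e1, e2]
      generalize ((q : ℤ) - 1) * q ^ (2 * m - 2) = L at *
      generalize (q : ℤ) ^ (2 * m - 2) = X at *
      simp
      omega)
    (by
      rw [e1, e2]
      generalize ((q : ℤ) - 1) * q ^ (2 * m - 2) = L at *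
      generalize (q : ℤ) ^ (2 * m - 2) = X at *
      simp
      omega)
    (fun w => by
      simp only [hm0, if_false, tableSum, List.map_cons, List.map_nil, List.sum_cons, List.sum_nil,
        sub_eq_iff_eq_add (a := w)]
      rw [e1, e2, e3, pow_succ _ (2 * m), e3, pow_succ _ (m + 1), pow_succ _ m,
        show ∀ a b : ℤ, a + b - 2 * b = a - b by intros; ring, add_sub_cancel_right]
      generalize ((q : ℤ) - 1) * q ^ (2 * m - 2) = L at *
      generalize (q : ℤ) ^ (2 * m - 2) = X at *
      split_ifs <;> ring1)
  have hdist : (((q - 2) * q ^ (2 * m - 2) + 1 : ℕ) : ℤ) =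
      (q - 1) * q ^ (2 * m - 2) - q ^ (2 * m - 2) + 1 := by
    rw [← e2]
    push_cast [show 2 ≤ q by omega]
    rfl
  refine ⟨ht.isWeightCode ?_ rfl, ⟨hd, ht.isMinDist (Nat.succ_pos _) ?_ ?_⟩, ht⟩
  · simpa only [List.forall_mem_cons, List.not_mem_nil, IsEmpty.forall_iff, implies_true, and_true]
      using hmult
  · exact ⟨_, List.mem_cons_self, by rw [hdist, e2], hmult.1⟩
  · rw [hdist, e1, e2]
    generalize ((q : ℤ) - 1) * q ^ (2 * m - 2) = L at *
    generalize (q : ℤ) ^ (2 * m - 2) = X at *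
    simp
    omega

end EvenTables
-- Weight tables in odd characteristic
-- For m = 2k + 1 the exponents are 3k and 4k, so the powers differ by the factor q^k ≥ 3. These
-- gaps keep the weights of the tables apart.
theorem oddPowers_le {q : ℤ} {m : ℕ} (hq : 3 ≤ q) (hm : 3 ≤ m) (hmo : Odd m) :
    3 ≤ q ^ ((3 * m - 3) / 2) ∧ 3 * q ^ ((3 * m - 3) / 2) ≤ q ^ (2 * m - 2) ∧
      2 * q ^ (2 * m - 2) ≤ (q - 1) * q ^ (2 * m - 2) := by
  obtain ⟨k, rfl⟩ := hmo
  have hpow : ∀ n, 1 ≤ n → 3 ≤ q ^ n := fun n hn => by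
    have := pow_le_pow_right₀ (show 1 ≤ q by linarith) hn
    rw [pow_one] at this
    linarith
  have h1 := hpow ((3 * (2 * k + 1) - 3) / 2) (by omega)
  have h2 := hpow k (by omega)
  have h3 := hpow (2 * (2 * k + 1) - 2) (by omega)
  have h4 : q ^ (2 * (2 * k + 1) - 2) = q ^ k * q ^ ((3 * (2 * k + 1) - 3) / 2) := by
    rw [← pow_add]; congr 1; omega
  refine ⟨h1, ?_, by nlinarith⟩
  rw [h4]
  exact mul_le_mul_of_nonneg_right h2 (by linarith)

/-- For m = 2k the exponents are 3k - 2 and 4k - 2, so the powers differ by the factor q^k ≥ q. -/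
theorem evenPowers_le {q : ℤ} {m : ℕ} (hq : 3 ≤ q) (hm : 2 ≤ m) (hme : Even m) :
    3 ≤ q ^ ((3 * m - 4) / 2) ∧
      (q - 1) * q ^ ((3 * m - 4) / 2) + q ^ ((3 * m - 4) / 2) ≤ q ^ (2 * m - 2) ∧
      2 * q ^ ((3 * m - 4) / 2) ≤ (q - 1) * q ^ ((3 * m - 4) / 2) ∧
      2 * q ^ (2 * m - 2) ≤ (q - 1) * q ^ (2 * m - 2) := by
  obtain ⟨k, rfl⟩ := hme
  have hpow : ∀ n, 1 ≤ n → q ≤ q ^ n := fun n hn => by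
    have := pow_le_pow_right₀ (show 1 ≤ q by linarith) hn
    rwa [pow_one] at this
  have h1 := hpow ((3 * (k + k) - 4) / 2) (by omega)
  have h2 := hpow k (by omega)
  have h3 := hpow (2 * (k + k) - 2) (by omega)
  have h4 : q ^ (2 * (k + k) - 2) = q ^ k * q ^ ((3 * (k + k) - 4) / 2) := by
    rw [← pow_add]; congr 1; omega
  refine ⟨by linarith, ?_, by nlinarith, by nlinarith⟩
  rw [h4]
  have := mul_le_mul_of_nonneg_right h2 (show 0 ≤ q ^ ((3 * (k + k) - 4) / 2) by linarith)
  linarith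

section OddTables

variable {F K : Type*} [Field F] [Fintype F] [DecidableEq F] [Field K] [Fintype K] [Algebra F K]
  {q m : ℕ}

theorem params_of_odd_odd_of_eq_zero (h2 : (2 : F) ≠ 0) (hF : Fintype.card F = q)
    (hK : Module.finrank F K = m) (hm : 3 ≤ m) (hmo : Odd m) (hm0 : (m : F) = 0) {h : ℕ}
    (hh : 2 * h + 1 = q) :
    IsWeightCode (LinearMap.range (encode (f₂ F K) (g₂ F K))) 5 ∧
    HasParams (LinearMap.range (encode (f₂ F K) (g₂ F K))) (q ^ (2 * m - 1) + 1) (2 * m + 1)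
      ((q - 1) * q ^ (2 * m - 2) - q ^ ((3 * m - 3) / 2)) ∧
    HasWeightTable (LinearMap.range (encode (f₂ F K) (g₂ F K)))
      [(0, 1),
       (((q : ℤ) - 1) * q ^ (2 * m - 2) - q ^ ((3 * m - 3) / 2),
         ((q : ℤ) ^ (m + 2) - 2 * q ^ (m + 1) + q ^ m) / 2),
       (((q : ℤ) - 1) * q ^ (2 * m - 2),
         (q : ℤ) ^ (2 * m) - q ^ (m + 2) + 2 * q ^ (m + 1) - q ^ m - q),
       (((q : ℤ) - 1) * q ^ (2 * m - 2) + 1,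
         (q : ℤ) ^ (2 * m + 1) - q ^ (2 * m)),
       (((q : ℤ) - 1) * q ^ (2 * m - 2) + q ^ ((3 * m - 3) / 2),
         ((q : ℤ) ^ (m + 2) - 2 * q ^ (m + 1) + q ^ m) / 2),
       ((q : ℤ) ^ (2 * m - 1), (q : ℤ) - 1)] := by
  have hhz : (q : ℤ) = 2 * h + 1 := by exact_mod_cast hh.symm
  have hq : 1 < q := hF ▸ Fintype.one_lt_card
  have hqz : (3 : ℤ) ≤ q := by omega
  have hhpos : (0 : ℤ) < h := by omega
  -- The numerator is q^m (q - 1)², and q - 1 = 2h.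
  have d1 : ((q : ℤ) ^ (m + 2) - 2 * q ^ (m + 1) + q ^ m) / 2 = (q : ℤ) ^ m * ((q - 1) * h) :=
    Int.ediv_eq_of_eq_mul_right two_ne_zero (by
      rw [pow_add, pow_add, hhz]
      ring)
  have e1 : (q : ℤ) ^ (2 * m - 1) = (q - 1) * q ^ (2 * m - 2) + q ^ (2 * m - 2) := by
    rw [show 2 * m - 1 = 2 * m - 2 + 1 by omega, pow_succ]; ring
  have e3 : (q : ℤ) ^ (2 * m) = q ^ m * q ^ m := by rw [← pow_add]; congr 1; omega
  have hu : (q : ℤ) ^ 3 ≤ q ^ m := pow_le_pow_right₀ (by linarith) hm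
  obtain ⟨hY, hX, hL⟩ := oddPowers_le hqz hm hmo
  have hmult : (q : ℤ) ^ m * ((q - 1) * h) ≠ 0 ∧
      (q : ℤ) ^ (2 * m) - q ^ (m + 2) + 2 * q ^ (m + 1) - q ^ m - q ≠ 0 ∧
      (q : ℤ) ^ (2 * m + 1) - q ^ (2 * m) ≠ 0 ∧
      (q : ℤ) ^ m * ((q - 1) * h) ≠ 0 ∧ (q : ℤ) - 1 ≠ 0 := by
    rw [pow_succ _ (2 * m), e3, pow_succ _ (m + 1), pow_succ _ m]
    clear d1 e1 e3 hY hX hL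
    generalize (q : ℤ) ^ m = u at *
    have hu0 : 0 < u := by nlinarith [pow_pos (show (0 : ℤ) < q by linarith) 3]
    have huq : (q : ℤ) ≤ u := by nlinarith [pow_pos (show (0 : ℤ) < q by linarith) 2]
    have h1 : (0 : ℤ) < u * ((q - 1) * h) := mul_pos hu0 (mul_pos (by linarith) hhpos)
    refine ⟨h1.ne', ne_of_gt ?_, ne_of_gt ?_, h1.ne', ne_of_gt (by linarith)⟩
    -- From u ≥ q³ one gets u² - q²u ≥ 2u, which outweighs the negative terms u and q.
    · have h4 : (q : ℤ) ^ 3 * u ≤ u * u := mul_le_mul_of_nonneg_right hu hu0.le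
      have h5 : u * 2 ≤ u * ((q : ℤ) ^ 2 * (q - 1)) :=
        mul_le_mul_of_nonneg_left (by nlinarith) hu0.le
      nlinarith
    · nlinarith [mul_pos hu0 hu0]
  rw [d1]
  obtain ⟨ht, hd⟩ := hasWeightTable_and_hasLengthDim_of_tableSum hF hK (by omega)
    (fun β hβ w => sectionCount_of_odd (h := h) h2 hF hK hmo hh hβ w) 0
    (T := [(((q : ℤ) - 1) * q ^ (2 * m - 2) - q ^ ((3 * m - 3) / 2),
         (q : ℤ) ^ m * ((q - 1) * h)),
       (((q : ℤ) - 1) * q ^ (2 * m - 2),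
         (q : ℤ) ^ (2 * m) - q ^ (m + 2) + 2 * q ^ (m + 1) - q ^ m - q),
       (((q : ℤ) - 1) * q ^ (2 * m - 2) + 1,
         (q : ℤ) ^ (2 * m + 1) - q ^ (2 * m)),
       (((q : ℤ) - 1) * q ^ (2 * m - 2) + q ^ ((3 * m - 3) / 2),
         (q : ℤ) ^ m * ((q - 1) * h)),
       ((q : ℤ) ^ (2 * m - 1), (q : ℤ) - 1)])
    (by
      rw [e1]
      generalize ((q : ℤ) - 1) * q ^ (2 * m - 2) = L at *
      generalize (q : ℤ) ^ (2 * m - 2) = X at *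
      generalize (q : ℤ) ^ ((3 * m - 3) / 2) = Y at *
      simp
      omega)
    (by
      rw [e1]
      generalize ((q : ℤ) - 1) * q ^ (2 * m - 2) = L at *
      generalize (q : ℤ) ^ (2 * m - 2) = X at *
      generalize (q : ℤ) ^ ((3 * m - 3) / 2) = Y at *
      simp
      omega)
    (fun w => by
      simp only [hm0, if_true, tableSum, List.map_cons, List.map_nil, List.sum_cons, List.sum_nil]
      rw [e1, pow_succ _ (2 * m), e3, pow_succ _ (m + 1), pow_succ _ m, add_sub_cancel_right, sub_zero]
      generalize ((q : ℤ) - 1) * q ^ (2 * m - 2) = L at *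
      generalize (q : ℤ) ^ (2 * m - 2) = X at *
      generalize (q : ℤ) ^ ((3 * m - 3) / 2) = Y at *
      split_ifs <;> ring1)
  have hdist : (((q - 1) * q ^ (2 * m - 2) - q ^ ((3 * m - 3) / 2) : ℕ) : ℤ) =
      (q - 1) * q ^ (2 * m - 2) - q ^ ((3 * m - 3) / 2) := by
    have hcast : (((q - 1) * q ^ (2 * m - 2) : ℕ) : ℤ) = (q - 1) * q ^ (2 * m - 2) := by
      push_cast [hq.le]
      rfl
    -- The minimum distance is stated with natural-number subtraction, which this makes exact.
    have hle : q ^ ((3 * m - 3) / 2) ≤ (q - 1) * q ^ (2 * m - 2) := by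
      zify [hq.le]
      linarith
    push_cast [Nat.cast_sub hle, hcast]
    rfl
  refine ⟨ht.isWeightCode ?_ rfl, ⟨hd, ht.isMinDist ?_ ?_ ?_⟩, ht⟩
  · simpa only [List.forall_mem_cons, List.not_mem_nil, IsEmpty.forall_iff, implies_true, and_true]
      using hmult
  · zify
    rw [hdist]
    linarith
  · exact ⟨_, List.mem_cons_self, by rw [hdist], hmult.1⟩
  · rw [hdist, e1]
    generalize ((q : ℤ) - 1) * q ^ (2 * m - 2) = L at *
    generalize (q : ℤ) ^ (2 * m - 2) = X at *
    generalize (q : ℤ) ^ ((3 * m - 3) / 2) = Y at *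
    simp
    omega

theorem params_of_odd_odd_of_ne_zero (h2 : (2 : F) ≠ 0) (hF : Fintype.card F = q)
    (hK : Module.finrank F K = m) (hm : 3 ≤ m) (hmo : Odd m) (hm0 : (m : F) ≠ 0) {h : ℕ}
    (hh : 2 * h + 1 = q) :
    IsWeightCode (LinearMap.range (encode (f₂ F K) (g₂ F K))) 5 ∧
    HasParams (LinearMap.range (encode (f₂ F K) (g₂ F K))) (q ^ (2 * m - 1) + 1) (2 * m + 1)
      ((q - 1) * q ^ (2 * m - 2) - q ^ ((3 * m - 3) / 2) + 1) ∧
    HasWeightTable (LinearMap.range (encode (f₂ F K) (g₂ F K)))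
      [(0, 1),
       (((q : ℤ) - 1) * q ^ (2 * m - 2) - q ^ ((3 * m - 3) / 2) + 1,
         ((q : ℤ) ^ (m + 2) - 2 * q ^ (m + 1) + q ^ m) / 2),
       (((q : ℤ) - 1) * q ^ (2 * m - 2),
         (q : ℤ) ^ (2 * m) - q),
       (((q : ℤ) - 1) * q ^ (2 * m - 2) + 1,
         (q : ℤ) ^ (2 * m + 1) - q ^ (2 * m) - q ^ (m + 2) + 2 * q ^ (m + 1) - q ^ m),
       (((q : ℤ) - 1) * q ^ (2 * m - 2) + q ^ ((3 * m - 3) / 2) + 1,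
         ((q : ℤ) ^ (m + 2) - 2 * q ^ (m + 1) + q ^ m) / 2),
       ((q : ℤ) ^ (2 * m - 1), (q : ℤ) - 1)] := by
  have hhz : (q : ℤ) = 2 * h + 1 := by exact_mod_cast hh.symm
  have hq : 1 < q := hF ▸ Fintype.one_lt_card
  have hqz : (3 : ℤ) ≤ q := by omega
  have hhpos : (0 : ℤ) < h := by omega
  have d1 : ((q : ℤ) ^ (m + 2) - 2 * q ^ (m + 1) + q ^ m) / 2 = (q : ℤ) ^ m * ((q - 1) * h) :=
    Int.ediv_eq_of_eq_mul_right two_ne_zero (by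
      rw [pow_add, pow_add, hhz]
      ring)
  have e1 : (q : ℤ) ^ (2 * m - 1) = (q - 1) * q ^ (2 * m - 2) + q ^ (2 * m - 2) := by
    rw [show 2 * m - 1 = 2 * m - 2 + 1 by omega, pow_succ]; ring
  have e3 : (q : ℤ) ^ (2 * m) = q ^ m * q ^ m := by rw [← pow_add]; congr 1; omega
  have hu : (q : ℤ) ^ 3 ≤ q ^ m := pow_le_pow_right₀ (by linarith) hm
  obtain ⟨hY, hX, hL⟩ := oddPowers_le hqz hm hmo
  have hmult : (q : ℤ) ^ m * ((q - 1) * h) ≠ 0 ∧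
      (q : ℤ) ^ (2 * m) - q ≠ 0 ∧
      (q : ℤ) ^ (2 * m + 1) - q ^ (2 * m) - q ^ (m + 2) + 2 * q ^ (m + 1) - q ^ m ≠ 0 ∧
      (q : ℤ) ^ m * ((q - 1) * h) ≠ 0 ∧ (q : ℤ) - 1 ≠ 0 := by
    rw [pow_succ _ (2 * m), e3, pow_succ _ (m + 1), pow_succ _ m]
    clear d1 e1 e3 hY hX hL
    generalize (q : ℤ) ^ m = u at *
    have hu0 : 0 < u := by nlinarith [pow_pos (show (0 : ℤ) < q by linarith) 3]
    have huq : (q : ℤ) ≤ u := by nlinarith [pow_pos (show (0 : ℤ) < q by linarith) 2]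
    have h1 : (0 : ℤ) < u * ((q - 1) * h) := mul_pos hu0 (mul_pos (by linarith) hhpos)
    refine ⟨h1.ne', ne_of_gt ?_, ne_of_gt ?_, h1.ne', ne_of_gt (by linarith)⟩
    · nlinarith
    · have h4 : 0 < ((q : ℤ) - 1) * (u * (u - (q - 1))) :=
        mul_pos (by linarith) (mul_pos hu0 (by nlinarith))
      linarith
  rw [d1]
  obtain ⟨ht, hd⟩ := hasWeightTable_and_hasLengthDim_of_tableSum hF hK (by omega)
    (fun β hβ w => sectionCount_of_odd (h := h) h2 hF hK hmo hh hβ w) 0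
    (T := [(((q : ℤ) - 1) * q ^ (2 * m - 2) - q ^ ((3 * m - 3) / 2) + 1,
         (q : ℤ) ^ m * ((q - 1) * h)),
       (((q : ℤ) - 1) * q ^ (2 * m - 2),
         (q : ℤ) ^ (2 * m) - q),
       (((q : ℤ) - 1) * q ^ (2 * m - 2) + 1,
         (q : ℤ) ^ (2 * m + 1) - q ^ (2 * m) - q ^ (m + 2) + 2 * q ^ (m + 1) - q ^ m),
       (((q : ℤ) - 1) * q ^ (2 * m - 2) + q ^ ((3 * m - 3) / 2) + 1,
         (q : ℤ) ^ m * ((q - 1) * h)),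
       ((q : ℤ) ^ (2 * m - 1), (q : ℤ) - 1)])
    (by
      rw [e1]
      generalize ((q : ℤ) - 1) * q ^ (2 * m - 2) = L at *
      generalize (q : ℤ) ^ (2 * m - 2) = X at *
      generalize (q : ℤ) ^ ((3 * m - 3) / 2) = Y at *
      simp
      omega)
    (by
      rw [e1]
      generalize ((q : ℤ) - 1) * q ^ (2 * m - 2) = L at *
      generalize (q : ℤ) ^ (2 * m - 2) = X at *
      generalize (q : ℤ) ^ ((3 * m - 3) / 2) = Y at *
      simp
      omega)
    (fun w => by
      simp only [hm0, if_false, tableSum, List.map_cons, List.map_nil, List.sum_cons, List.sum_nil,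
        sub_eq_iff_eq_add (a := w)]
      rw [e1, pow_succ _ (2 * m), e3, pow_succ _ (m + 1), pow_succ _ m, add_sub_cancel_right]
      generalize ((q : ℤ) - 1) * q ^ (2 * m - 2) = L at *
      generalize (q : ℤ) ^ (2 * m - 2) = X at *
      generalize (q : ℤ) ^ ((3 * m - 3) / 2) = Y at *
      split_ifs <;> ring1)
  have hdist : (((q - 1) * q ^ (2 * m - 2) - q ^ ((3 * m - 3) / 2) + 1 : ℕ) : ℤ) =
      (q - 1) * q ^ (2 * m - 2) - q ^ ((3 * m - 3) / 2) + 1 := by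
    have hcast : (((q - 1) * q ^ (2 * m - 2) : ℕ) : ℤ) = (q - 1) * q ^ (2 * m - 2) := by
      push_cast [hq.le]
      rfl
    have hle : q ^ ((3 * m - 3) / 2) ≤ (q - 1) * q ^ (2 * m - 2) := by
      zify [hq.le]
      linarith
    push_cast [Nat.cast_sub hle, hcast]
    rfl
  refine ⟨ht.isWeightCode ?_ rfl, ⟨hd, ht.isMinDist ?_ ?_ ?_⟩, ht⟩
  · simpa only [List.forall_mem_cons, List.not_mem_nil, IsEmpty.forall_iff, implies_true, and_true]
      using hmult
  · exact Nat.succ_pos _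
  · exact ⟨_, List.mem_cons_self, by rw [hdist], hmult.1⟩
  · rw [hdist, e1]
    generalize ((q : ℤ) - 1) * q ^ (2 * m - 2) = L at *
    generalize (q : ℤ) ^ (2 * m - 2) = X at *
    generalize (q : ℤ) ^ ((3 * m - 3) / 2) = Y at *
    simp
    omega

theorem params_of_odd_even_of_eq_zero (h2 : (2 : F) ≠ 0) (hF : Fintype.card F = q)
    (hK : Module.finrank F K = m) (hm : 2 ≤ m) (hme : Even m) (hm0 : (m : F) = 0) (hq : 3 ≤ q) {e : ℕ}
    (he : ZMod.χ₄ (q ^ (m / 2) : ℕ) = (-1) ^ e) :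
    IsWeightCode (LinearMap.range (encode (f₂ F K) (g₂ F K))) 5 ∧
    HasLengthDim (LinearMap.range (encode (f₂ F K) (g₂ F K))) (q ^ (2 * m - 1) + 1) (2 * m + 1) ∧
    HasWeightTable (LinearMap.range (encode (f₂ F K) (g₂ F K)))
      [(0, 1),
       (((q : ℤ) - 1) * q ^ (2 * m - 2) + q ^ ((3 * m - 4) / 2) * (-1) ^ (e + 1),
         (q : ℤ) ^ m * (q - 1) ^ 2),
       (((q : ℤ) - 1) * q ^ (2 * m - 2)
         + (q - 1) * q ^ ((3 * m - 4) / 2) * (-1) ^ e,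
         (q : ℤ) ^ (m + 1) - q ^ m),
       (((q : ℤ) - 1) * q ^ (2 * m - 2),
         (q : ℤ) ^ (2 * m) - q ^ (m + 2) + q ^ (m + 1) - q),
       (((q : ℤ) - 1) * q ^ (2 * m - 2) + 1,
         (q : ℤ) ^ (2 * m + 1) - q ^ (2 * m)),
       ((q : ℤ) ^ (2 * m - 1), (q : ℤ) - 1)] := by
  have hqz : (3 : ℤ) ≤ q := by exact_mod_cast hq
  have e1 : (q : ℤ) ^ (2 * m - 1) = (q - 1) * q ^ (2 * m - 2) + q ^ (2 * m - 2) := by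
    rw [show 2 * m - 1 = 2 * m - 2 + 1 by omega, pow_succ]; ring
  have e3 : (q : ℤ) ^ (2 * m) = q ^ m * q ^ m := by rw [← pow_add]; congr 1; omega
  have hu : (q : ℤ) ^ 2 ≤ q ^ m := pow_le_pow_right₀ (by linarith) hm
  obtain ⟨hY, hX, hZ, hL⟩ := evenPowers_le hqz hm hme
  have hmult : (q : ℤ) ^ m * (q - 1) ^ 2 ≠ 0 ∧ (q : ℤ) ^ (m + 1) - q ^ m ≠ 0 ∧
      (q : ℤ) ^ (2 * m) - q ^ (m + 2) + q ^ (m + 1) - q ≠ 0 ∧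
      (q : ℤ) ^ (2 * m + 1) - q ^ (2 * m) ≠ 0 ∧
      (q : ℤ) - 1 ≠ 0 := by
    rw [pow_succ _ (2 * m), e3, pow_succ _ (m + 1), pow_succ _ m]
    clear e1 e3 hY hX hZ hL
    generalize (q : ℤ) ^ m = u at *
    have huq : (q : ℤ) < u := by nlinarith
    have hu0 : 0 < u := by linarith
    have h1 : (0 : ℤ) < u * (q - 1) ^ 2 := mul_pos hu0 (pow_pos (by linarith) 2)
    refine ⟨h1.ne', ne_of_gt (by nlinarith), ne_of_gt ?_, ne_of_gt ?_, ne_of_gt (by linarith)⟩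
    · nlinarith
    · nlinarith [mul_pos hu0 hu0]
  have w1 : (q : ℤ) ^ ((3 * m - 4) / 2) * (-1) ^ (e + 1) =
      -((-1) ^ e * q ^ ((3 * m - 4) / 2)) := by rw [pow_succ]; ring
  have w2 : ((q : ℤ) - 1) * q ^ ((3 * m - 4) / 2) * (-1) ^ e =
      (q - 1) * ((-1) ^ e * q ^ ((3 * m - 4) / 2)) := by ring
  -- Both signs are handled together. The two signed products are resolved jointly, because once
  -- they are abstracted to independent integers nothing else records that they share a sign.
  have hsign : ((-1) ^ e * (q : ℤ) ^ ((3 * m - 4) / 2) = q ^ ((3 * m - 4) / 2) ∧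
      ((q : ℤ) - 1) * ((-1) ^ e * q ^ ((3 * m - 4) / 2)) = (q - 1) * q ^ ((3 * m - 4) / 2)) ∨
      ((-1) ^ e * (q : ℤ) ^ ((3 * m - 4) / 2) = -q ^ ((3 * m - 4) / 2) ∧
      ((q : ℤ) - 1) * ((-1) ^ e * q ^ ((3 * m - 4) / 2)) = -((q - 1) * q ^ ((3 * m - 4) / 2))) := by
    rcases neg_one_pow_eq_or ℤ e with h | h <;> rw [h]
    · left; constructor <;> ring
    · right; constructor <;> ring
  rw [w1, w2, ← sub_eq_add_neg]
  obtain ⟨ht, hd⟩ := hasWeightTable_and_hasLengthDim_of_tableSum hF hK hm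
    (fun β hβ w => sectionCount_of_even h2 hF hK hme (by omega) hβ w) 0
    (T := [(((q : ℤ) - 1) * q ^ (2 * m - 2) - (-1) ^ e * q ^ ((3 * m - 4) / 2),
         (q : ℤ) ^ m * (q - 1) ^ 2),
       (((q : ℤ) - 1) * q ^ (2 * m - 2)
         + (q - 1) * ((-1) ^ e * q ^ ((3 * m - 4) / 2)),
         (q : ℤ) ^ (m + 1) - q ^ m),
       (((q : ℤ) - 1) * q ^ (2 * m - 2),
         (q : ℤ) ^ (2 * m) - q ^ (m + 2) + q ^ (m + 1) - q),
       (((q : ℤ) - 1) * q ^ (2 * m - 2) + 1,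
         (q : ℤ) ^ (2 * m + 1) - q ^ (2 * m)),
       ((q : ℤ) ^ (2 * m - 1), (q : ℤ) - 1)])
    (by
      rw [e1]
      clear w1 w2
      generalize ((q : ℤ) - 1) * ((-1) ^ e * q ^ ((3 * m - 4) / 2)) = W at *
      generalize ((-1) ^ e * (q : ℤ) ^ ((3 * m - 4) / 2)) = V at *
      generalize ((q : ℤ) - 1) * q ^ ((3 * m - 4) / 2) = Z at *
      generalize (q : ℤ) ^ ((3 * m - 4) / 2) = Y at *
      generalize ((q : ℤ) - 1) * q ^ (2 * m - 2) = L at *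
      generalize (q : ℤ) ^ (2 * m - 2) = X at *
      simp
      omega)
    (by
      rw [e1]
      clear w1 w2
      generalize ((q : ℤ) - 1) * ((-1) ^ e * q ^ ((3 * m - 4) / 2)) = W at *
      generalize ((-1) ^ e * (q : ℤ) ^ ((3 * m - 4) / 2)) = V at *
      generalize ((q : ℤ) - 1) * q ^ ((3 * m - 4) / 2) = Z at *
      generalize (q : ℤ) ^ ((3 * m - 4) / 2) = Y at *
      generalize ((q : ℤ) - 1) * q ^ (2 * m - 2) = L at *
      generalize (q : ℤ) ^ (2 * m - 2) = X at *
      simp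
      omega)
    (fun w => by
      simp only [hm0, if_true, tableSum, List.map_cons, List.map_nil, List.sum_cons, List.sum_nil]
      rw [he, e1, pow_succ _ (2 * m), e3, pow_succ _ (m + 1), pow_succ _ m, add_sub_cancel_right, sub_zero]
      clear w1 w2
      generalize ((q : ℤ) - 1) * ((-1) ^ e * q ^ ((3 * m - 4) / 2)) = W at *
      generalize ((-1) ^ e * (q : ℤ) ^ ((3 * m - 4) / 2)) = V at *
      generalize ((q : ℤ) - 1) * q ^ ((3 * m - 4) / 2) = Z at *
      generalize (q : ℤ) ^ ((3 * m - 4) / 2) = Y at *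
      generalize ((q : ℤ) - 1) * q ^ (2 * m - 2) = L at *
      generalize (q : ℤ) ^ (2 * m - 2) = X at *
      split_ifs <;> ring1)
  refine ⟨ht.isWeightCode ?_ rfl, hd, ht⟩
  simpa only [List.forall_mem_cons, List.not_mem_nil, IsEmpty.forall_iff, implies_true, and_true]
    using hmult

theorem params_of_odd_even_of_ne_zero (h2 : (2 : F) ≠ 0) (hF : Fintype.card F = q)
    (hK : Module.finrank F K = m) (hm : 2 ≤ m) (hme : Even m) (hm0 : (m : F) ≠ 0) (hq : 3 ≤ q) {e : ℕ}
    (he : ZMod.χ₄ (q ^ (m / 2) : ℕ) = (-1) ^ e) :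
    IsWeightCode (LinearMap.range (encode (f₂ F K) (g₂ F K))) 5 ∧
    HasLengthDim (LinearMap.range (encode (f₂ F K) (g₂ F K))) (q ^ (2 * m - 1) + 1) (2 * m + 1) ∧
    HasWeightTable (LinearMap.range (encode (f₂ F K) (g₂ F K)))
      [(0, 1),
       (((q : ℤ) - 1) * q ^ (2 * m - 2) + q ^ ((3 * m - 4) / 2) * (-1) ^ (e + 1) + 1,
         (q : ℤ) ^ m * (q - 1) ^ 2),
       (((q : ℤ) - 1) * q ^ (2 * m - 2)
         + (q - 1) * q ^ ((3 * m - 4) / 2) * (-1) ^ e + 1,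
         (q : ℤ) ^ (m + 1) - q ^ m),
       (((q : ℤ) - 1) * q ^ (2 * m - 2),
         (q : ℤ) ^ (2 * m) - q),
       (((q : ℤ) - 1) * q ^ (2 * m - 2) + 1,
         (q : ℤ) ^ (2 * m + 1) - q ^ (2 * m) - q ^ (m + 2) + q ^ (m + 1)),
       ((q : ℤ) ^ (2 * m - 1), (q : ℤ) - 1)] := by
  have hqz : (3 : ℤ) ≤ q := by exact_mod_cast hq
  have e1 : (q : ℤ) ^ (2 * m - 1) = (q - 1) * q ^ (2 * m - 2) + q ^ (2 * m - 2) := by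
    rw [show 2 * m - 1 = 2 * m - 2 + 1 by omega, pow_succ]; ring
  have e3 : (q : ℤ) ^ (2 * m) = q ^ m * q ^ m := by rw [← pow_add]; congr 1; omega
  have hu : (q : ℤ) ^ 2 ≤ q ^ m := pow_le_pow_right₀ (by linarith) hm
  obtain ⟨hY, hX, hZ, hL⟩ := evenPowers_le hqz hm hme
  have hmult : (q : ℤ) ^ m * (q - 1) ^ 2 ≠ 0 ∧ (q : ℤ) ^ (m + 1) - q ^ m ≠ 0 ∧
      (q : ℤ) ^ (2 * m) - q ≠ 0 ∧
      (q : ℤ) ^ (2 * m + 1) - q ^ (2 * m) - q ^ (m + 2) + q ^ (m + 1) ≠ 0 ∧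
      (q : ℤ) - 1 ≠ 0 := by
    rw [pow_succ _ (2 * m), e3, pow_succ _ (m + 1), pow_succ _ m]
    clear e1 e3 hY hX hZ hL
    generalize (q : ℤ) ^ m = u at *
    have huq : (q : ℤ) < u := by nlinarith
    have hu0 : 0 < u := by linarith
    have h1 : (0 : ℤ) < u * (q - 1) ^ 2 := mul_pos hu0 (pow_pos (by linarith) 2)
    refine ⟨h1.ne', ne_of_gt (by nlinarith), ne_of_gt ?_, ne_of_gt ?_, ne_of_gt (by linarith)⟩
    · nlinarith
    -- This is the fourth multiplicity in factored form, with u = q^m > q.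
    · have h4 : 0 < ((q : ℤ) - 1) * (u * (u - q)) :=
        mul_pos (by linarith) (mul_pos hu0 (by nlinarith))
      linarith
  have w1 : (q : ℤ) ^ ((3 * m - 4) / 2) * (-1) ^ (e + 1) =
      -((-1) ^ e * q ^ ((3 * m - 4) / 2)) := by rw [pow_succ]; ring
  have w2 : ((q : ℤ) - 1) * q ^ ((3 * m - 4) / 2) * (-1) ^ e =
      (q - 1) * ((-1) ^ e * q ^ ((3 * m - 4) / 2)) := by ring
  have hsign : ((-1) ^ e * (q : ℤ) ^ ((3 * m - 4) / 2) = q ^ ((3 * m - 4) / 2) ∧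
      ((q : ℤ) - 1) * ((-1) ^ e * q ^ ((3 * m - 4) / 2)) = (q - 1) * q ^ ((3 * m - 4) / 2)) ∨
      ((-1) ^ e * (q : ℤ) ^ ((3 * m - 4) / 2) = -q ^ ((3 * m - 4) / 2) ∧
      ((q : ℤ) - 1) * ((-1) ^ e * q ^ ((3 * m - 4) / 2)) = -((q - 1) * q ^ ((3 * m - 4) / 2))) := by
    rcases neg_one_pow_eq_or ℤ e with h | h <;> rw [h]
    · left; constructor <;> ring
    · right; constructor <;> ring
  rw [w1, w2, ← sub_eq_add_neg]
  obtain ⟨ht, hd⟩ := hasWeightTable_and_hasLengthDim_of_tableSum hF hK hm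
    (fun β hβ w => sectionCount_of_even h2 hF hK hme (by omega) hβ w) 0
    (T := [(((q : ℤ) - 1) * q ^ (2 * m - 2) - (-1) ^ e * q ^ ((3 * m - 4) / 2) + 1,
         (q : ℤ) ^ m * (q - 1) ^ 2),
       (((q : ℤ) - 1) * q ^ (2 * m - 2)
         + (q - 1) * ((-1) ^ e * q ^ ((3 * m - 4) / 2)) + 1,
         (q : ℤ) ^ (m + 1) - q ^ m),
       (((q : ℤ) - 1) * q ^ (2 * m - 2),
         (q : ℤ) ^ (2 * m) - q),
       (((q : ℤ) - 1) * q ^ (2 * m - 2) + 1,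
         (q : ℤ) ^ (2 * m + 1) - q ^ (2 * m) - q ^ (m + 2) + q ^ (m + 1)),
       ((q : ℤ) ^ (2 * m - 1), (q : ℤ) - 1)])
    (by
      rw [e1]
      clear w1 w2
      generalize ((q : ℤ) - 1) * ((-1) ^ e * q ^ ((3 * m - 4) / 2)) = W at *
      generalize ((-1) ^ e * (q : ℤ) ^ ((3 * m - 4) / 2)) = V at *
      generalize ((q : ℤ) - 1) * q ^ ((3 * m - 4) / 2) = Z at *
      generalize (q : ℤ) ^ ((3 * m - 4) / 2) = Y at *
      generalize ((q : ℤ) - 1) * q ^ (2 * m - 2) = L at *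
      generalize (q : ℤ) ^ (2 * m - 2) = X at *
      simp
      omega)
    (by
      rw [e1]
      clear w1 w2
      generalize ((q : ℤ) - 1) * ((-1) ^ e * q ^ ((3 * m - 4) / 2)) = W at *
      generalize ((-1) ^ e * (q : ℤ) ^ ((3 * m - 4) / 2)) = V at *
      generalize ((q : ℤ) - 1) * q ^ ((3 * m - 4) / 2) = Z at *
      generalize (q : ℤ) ^ ((3 * m - 4) / 2) = Y at *
      generalize ((q : ℤ) - 1) * q ^ (2 * m - 2) = L at *
      generalize (q : ℤ) ^ (2 * m - 2) = X at *
      simp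
      omega)
    (fun w => by
      simp only [hm0, if_false, tableSum, List.map_cons, List.map_nil, List.sum_cons, List.sum_nil,
        sub_eq_iff_eq_add (a := w)]
      rw [he, e1, pow_succ _ (2 * m), e3, pow_succ _ (m + 1), pow_succ _ m, add_sub_cancel_right]
      clear w1 w2
      generalize ((q : ℤ) - 1) * ((-1) ^ e * q ^ ((3 * m - 4) / 2)) = W at *
      generalize ((-1) ^ e * (q : ℤ) ^ ((3 * m - 4) / 2)) = V at *
      generalize ((q : ℤ) - 1) * q ^ ((3 * m - 4) / 2) = Z at *
      generalize (q : ℤ) ^ ((3 * m - 4) / 2) = Y at *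
      generalize ((q : ℤ) - 1) * q ^ (2 * m - 2) = L at *
      generalize (q : ℤ) ^ (2 * m - 2) = X at *
      split_ifs <;> ring1)
  refine ⟨ht.isWeightCode ?_ rfl, hd, ht⟩
  simpa only [List.forall_mem_cons, List.not_mem_nil, IsEmpty.forall_iff, implies_true, and_true]
    using hmult

end OddTables
-- The sign ε and the full theorem
-- χ₄ is multiplicative with χ₄(p) = (-1)^((p-1)/2), and l · (m/2) · (p-1)/2 = lm(p-1)/4 with every
-- division exact.
theorem χ₄_prime_pow_eq {p l m : ℕ} (hp : Odd p) (hm : Even m) :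
    ZMod.χ₄ ((p ^ l) ^ (m / 2) : ℕ) = (-1) ^ (l * m * (p - 1) / 4) := by
  obtain ⟨k, rfl⟩ := hm
  obtain ⟨j, rfl⟩ := hp
  rw [← pow_mul, Nat.cast_pow, map_pow, ZMod.χ₄_eq_neg_one_pow (by omega), ← pow_mul]
  congr 1
  rw [show (2 * j + 1) / 2 = j by omega, show (k + k) / 2 = k by omega, Nat.add_sub_cancel,
    show l * (k + k) * (2 * j) = 4 * (j * (l * k)) by ring, Nat.mul_div_cancel_left _ (by norm_num)]

theorem theorem5 (p l m q : ℕ) (hp : p.Prime) (hl : 1 ≤ l) (hq : q = p ^ l) (hm : 2 ≤ m)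
    {F K : Type*} [Field F] [Fintype F] [DecidableEq F] [Field K] [Fintype K] [Algebra F K]
    (hF : Fintype.card F = q) (hK : Module.finrank F K = m)
    {k : ℕ} (G : Matrix (Fin k) (Option (solutionSet (f₂ F K) (g₂ F K))) K)
    (hG : IsGeneratorMatrix G (codeC (f₂ F K) (g₂ F K)))
    (B : Module.Basis (Fin m) F K) (C : Submodule F (Option (solutionSet (f₂ F K) (g₂ F K)) → F))
    (hC : C = subfieldCode G B) :
    -- `q` and `m` even
    (Even q → Even m →
      (q = 2 →
        IsWeightCode C 3 ∧
        HasParams C (2 ^ (2 * m - 1) + 1) (2 * m) (2 ^ (2 * m - 2)) ∧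
        HasWeightTable C
          [(0, 1),
           (2 ^ (2 * m - 2), 2 ^ (2 * m - 1) - 2),
           (2 ^ (2 * m - 2) + 1, 2 ^ (2 * m) - 2 ^ (2 * m - 1)),
           (2 ^ (2 * m - 1), 1)] ∧
        HasParams (dualCode C) (2 ^ (2 * m - 1) + 1) (2 ^ (2 * m - 1) - 2 * m + 1) 3) ∧
      (2 ≤ l →
        IsWeightCode C 4 ∧
        HasParams C (q ^ (2 * m - 1) + 1) (2 * m + 1) ((q - 2) * q ^ (2 * m - 2)) ∧
        HasWeightTable C
          [(0, 1),
           (((q : ℤ) - 2) * q ^ (2 * m - 2), (q : ℤ) * (q - 1) ^ 2 / 2),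
           (((q : ℤ) - 1) * q ^ (2 * m - 2), (q : ℤ) ^ (2 * m) - q ^ 3 + 2 * q ^ 2 - 2 * q),
           (((q : ℤ) - 1) * q ^ (2 * m - 2) + 1, (q : ℤ) ^ (2 * m + 1) - q ^ (2 * m)),
           ((q : ℤ) ^ (2 * m - 1), ((q : ℤ) - 1) * (q ^ 2 - q + 2) / 2)] ∧
        HasParams (dualCode C) (q ^ (2 * m - 1) + 1) (q ^ (2 * m - 1) - 2 * m) 3)) ∧
    -- `q` even and `m` odd
    (Even q → Odd m →
      (IsWeightCode C 5 ∧
        HasParams C (q ^ (2 * m - 1) + 1) (2 * m + 1) ((q - 2) * q ^ (2 * m - 2) + 1) ∧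
        HasWeightTable C
          [(0, 1),
           (((q : ℤ) - 2) * q ^ (2 * m - 2) + 1, (q : ℤ) * (q - 1) ^ 2 / 2),
           (((q : ℤ) - 1) * q ^ (2 * m - 2), (q : ℤ) ^ (2 * m) - q),
           (((q : ℤ) - 1) * q ^ (2 * m - 2) + 1,
             (q : ℤ) ^ (2 * m + 1) - q ^ (2 * m) - q ^ 3 + 2 * q ^ 2 - q),
           ((q : ℤ) ^ (2 * m - 1), (q : ℤ) - 1),
           ((q : ℤ) ^ (2 * m - 1) + 1, (q : ℤ) * (q - 1) ^ 2 / 2)]) ∧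
      (q = 2 →
        IsOptimalSpherePacking (dualCode C)
          (2 ^ (2 * m - 1) + 1) (2 ^ (2 * m - 1) - 2 * m) 4) ∧
      (2 ≤ l →
        HasParams (dualCode C) (q ^ (2 * m - 1) + 1) (q ^ (2 * m - 1) - 2 * m) 3)) ∧
    -- `q` and `m` odd
    (Odd q → Odd m →
      (p ∣ m →
        IsWeightCode C 5 ∧
        HasParams C (q ^ (2 * m - 1) + 1) (2 * m + 1)
          ((q - 1) * q ^ (2 * m - 2) - q ^ ((3 * m - 3) / 2)) ∧
        HasWeightTable C
          [(0, 1),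
           (((q : ℤ) - 1) * q ^ (2 * m - 2) - q ^ ((3 * m - 3) / 2),
             ((q : ℤ) ^ (m + 2) - 2 * q ^ (m + 1) + q ^ m) / 2),
           (((q : ℤ) - 1) * q ^ (2 * m - 2),
             (q : ℤ) ^ (2 * m) - q ^ (m + 2) + 2 * q ^ (m + 1) - q ^ m - q),
           (((q : ℤ) - 1) * q ^ (2 * m - 2) + 1, (q : ℤ) ^ (2 * m + 1) - q ^ (2 * m)),
           (((q : ℤ) - 1) * q ^ (2 * m - 2) + q ^ ((3 * m - 3) / 2),
             ((q : ℤ) ^ (m + 2) - 2 * q ^ (m + 1) + q ^ m) / 2),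
           ((q : ℤ) ^ (2 * m - 1), (q : ℤ) - 1)]) ∧
      (¬ p ∣ m →
        IsWeightCode C 5 ∧
        HasParams C (q ^ (2 * m - 1) + 1) (2 * m + 1)
          ((q - 1) * q ^ (2 * m - 2) - q ^ ((3 * m - 3) / 2) + 1) ∧
        HasWeightTable C
          [(0, 1),
           (((q : ℤ) - 1) * q ^ (2 * m - 2) - q ^ ((3 * m - 3) / 2) + 1,
             ((q : ℤ) ^ (m + 2) - 2 * q ^ (m + 1) + q ^ m) / 2),
           (((q : ℤ) - 1) * q ^ (2 * m - 2), (q : ℤ) ^ (2 * m) - q),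
           (((q : ℤ) - 1) * q ^ (2 * m - 2) + 1,
             (q : ℤ) ^ (2 * m + 1) - q ^ (2 * m) - q ^ (m + 2) + 2 * q ^ (m + 1) - q ^ m),
           (((q : ℤ) - 1) * q ^ (2 * m - 2) + q ^ ((3 * m - 3) / 2) + 1,
             ((q : ℤ) ^ (m + 2) - 2 * q ^ (m + 1) + q ^ m) / 2),
           ((q : ℤ) ^ (2 * m - 1), (q : ℤ) - 1)]) ∧
      HasParams (dualCode C) (q ^ (2 * m - 1) + 1) (q ^ (2 * m - 1) - 2 * m) 3) ∧
    -- `q` odd and `m` even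
    (Odd q → Even m →
      (p ∣ m →
        IsWeightCode C 5 ∧
        HasLengthDim C (q ^ (2 * m - 1) + 1) (2 * m + 1) ∧
        HasWeightTable C
          [(0, 1),
           (((q : ℤ) - 1) * q ^ (2 * m - 2)
               + q ^ ((3 * m - 4) / 2) * (-1) ^ ((l * m * (p - 1) + 4) / 4),
             (q : ℤ) ^ m * (q - 1) ^ 2),
           (((q : ℤ) - 1) * q ^ (2 * m - 2)
               + (q - 1) * q ^ ((3 * m - 4) / 2) * (-1) ^ (l * m * (p - 1) / 4),
             (q : ℤ) ^ (m + 1) - q ^ m),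
           (((q : ℤ) - 1) * q ^ (2 * m - 2),
             (q : ℤ) ^ (2 * m) - q ^ (m + 2) + q ^ (m + 1) - q),
           (((q : ℤ) - 1) * q ^ (2 * m - 2) + 1, (q : ℤ) ^ (2 * m + 1) - q ^ (2 * m)),
           ((q : ℤ) ^ (2 * m - 1), (q : ℤ) - 1)]) ∧
      (¬ p ∣ m →
        IsWeightCode C 5 ∧
        HasLengthDim C (q ^ (2 * m - 1) + 1) (2 * m + 1) ∧
        HasWeightTable C
          [(0, 1),
           (((q : ℤ) - 1) * q ^ (2 * m - 2)
               + q ^ ((3 * m - 4) / 2) * (-1) ^ ((l * m * (p - 1) + 4) / 4) + 1,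
             (q : ℤ) ^ m * (q - 1) ^ 2),
           (((q : ℤ) - 1) * q ^ (2 * m - 2)
               + (q - 1) * q ^ ((3 * m - 4) / 2) * (-1) ^ (l * m * (p - 1) / 4) + 1,
             (q : ℤ) ^ (m + 1) - q ^ m),
           (((q : ℤ) - 1) * q ^ (2 * m - 2), (q : ℤ) ^ (2 * m) - q),
           (((q : ℤ) - 1) * q ^ (2 * m - 2) + 1,
             (q : ℤ) ^ (2 * m + 1) - q ^ (2 * m) - q ^ (m + 2) + q ^ (m + 1)),
           ((q : ℤ) ^ (2 * m - 1), (q : ℤ) - 1)]) ∧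
      HasParams (dualCode C) (q ^ (2 * m - 1) + 1) (q ^ (2 * m - 1) - 2 * m) 3) := by
  have hCp : CharP F p := by
    have := Fact.mk hp
    exact charP_of_card_eq_prime_pow (hF.trans hq)
  have hmp : (m : F) = 0 ↔ p ∣ m := CharP.cast_eq_zero_iff F p m
  have hq1 : 1 < q := hF ▸ Fintype.one_lt_card
  have hbig := two_mul_le_pow hq1 hm
  have hrange : C = LinearMap.range (encode (f₂ F K) (g₂ F K)) :=
    hC.trans (subfieldCode_eq_range_encode hG B)
  have hp2 : Even q → p = 2 := fun h => by
    rw [hq] at h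
    exact (Nat.prime_dvd_prime_iff_eq Nat.prime_two hp).mp
      (Nat.prime_two.dvd_of_dvd_pow h.two_dvd) |>.symm
  have hodd : Odd q → p ≠ 2 := fun h e => by
    rw [hq, e] at h
    exact Nat.not_odd_iff_even.mpr (Even.pow_of_ne_zero even_two (by omega)) h
  have h2F : Odd q → (2 : F) ≠ 0 := fun h e => by
    have h2 : p ∣ 2 := (CharP.cast_eq_zero_iff F p 2).mp (by exact_mod_cast e)
    exact hodd h ((Nat.prime_dvd_prime_iff_eq hp Nat.prime_two).mp h2)
  have hq4 : p = 2 → 2 ≤ l → 3 ≤ q := fun h hl2 => by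
    have : 2 ^ 2 ≤ 2 ^ l := Nat.pow_le_pow_right (by norm_num) hl2
    rw [hq, h]
    omega
  have hhalf : Even q → ∃ h, 2 * h = q := fun ⟨h, hh⟩ => ⟨h, by omega⟩
  have hhalf' : Odd q → ∃ h, 2 * h + 1 = q := fun ⟨h, hh⟩ => ⟨h, hh.symm⟩
  have hthree : Odd q → 3 ≤ q := fun ⟨h, hh⟩ => by omega
  subst hrange
  refine ⟨fun hqe hme => ⟨fun hq2 => ?_, fun hl2 => ?_⟩, fun hqe hmo => ?_, fun hqo hmo => ?_,
    fun hqo hme => ?_⟩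
  · obtain rfl := hp2 hqe
    have hm0 := hmp.mpr hme.two_dvd
    obtain ⟨h1, h2, h3⟩ := params_of_even_even_two (hF.trans hq2) hK hm hm0
    rw [hq2] at hbig
    exact ⟨h1, h2, h3, hasParams_dual h2.1 (by omega)
      (isMinDist_dual_three hF hK hm (Or.inl hm0))⟩
  · obtain rfl := hp2 hqe
    have hm0 := hmp.mpr hme.two_dvd
    obtain ⟨h, hh⟩ := hhalf hqe
    obtain ⟨h1, h2, h3⟩ := params_of_even_even hF hK hm hm0 hh (hq4 rfl hl2)
    exact ⟨h1, h2, h3, hasParams_dual h2.1 (by omega)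
      (isMinDist_dual_three hF hK hm (Or.inl hm0))⟩
  · obtain rfl := hp2 hqe
    have hm0 : (m : F) ≠ 0 := fun e =>
      Nat.not_even_iff_odd.mpr hmo (even_iff_two_dvd.mpr (hmp.mp e))
    have hm3 : 3 ≤ m := by obtain ⟨k, hk⟩ := hmo; omega
    obtain ⟨h, hh⟩ := hhalf hqe
    obtain ⟨h1, h2, h3⟩ := params_of_even_odd hF hK hm3 hm0 hh
    refine ⟨⟨h1, h2, h3⟩, fun hq2 => ?_, fun hl2 => hasParams_dual h2.1 (by omega)
      (isMinDist_dual_three hF hK hm (Or.inr (hq4 rfl hl2)))⟩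
    rw [hq2] at h2 hbig
    refine isOptimalSpherePacking_four (hF.trans hq2) (hasParams_dual h2.1 (by omega)
      (isMinDist_dual_four (hF.trans hq2) hK hm3 hm0)) (by omega) ?_
    -- The redundancy is 2m + 1, so with N = 2^(2m-1) the claim is 4N < N(N + 1)/2, which holds
    -- because N ≥ 32 for m ≥ 3.
    rw [show 2 ^ (2 * m - 1) + 1 - (2 ^ (2 * m - 1) - 2 * m) = 2 * m - 1 + 2 by omega, pow_add,
      Nat.choose_two_right, Nat.add_sub_cancel]
    have h32 : 2 ^ 5 ≤ 2 ^ (2 * m - 1) := Nat.pow_le_pow_right (by norm_num) (by omega)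
    generalize 2 ^ (2 * m - 1) = N at *
    rw [Nat.lt_div_iff_mul_lt (by norm_num)]
    have := Nat.mul_le_mul_right N h32
    rw [Nat.add_mul]
    omega
  · have hm3 : 3 ≤ m := by obtain ⟨k, hk⟩ := hmo; omega
    obtain ⟨h, hh⟩ := hhalf' hqo
    have hd := isMinDist_dual_three (K := K) hF hK hm (Or.inr (hthree hqo))
    refine ⟨fun hpm => params_of_odd_odd_of_eq_zero (h2F hqo) hF hK hm3 hmo (hmp.mpr hpm) hh,
      fun hpm => params_of_odd_odd_of_ne_zero (h2F hqo) hF hK hm3 hmo (mt hmp.mp hpm) hh, ?_⟩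
    by_cases hpm : p ∣ m
    · exact hasParams_dual (params_of_odd_odd_of_eq_zero (h2F hqo) hF hK hm3 hmo
        (hmp.mpr hpm) hh).2.1.1 (by omega) hd
    · exact hasParams_dual (params_of_odd_odd_of_ne_zero (h2F hqo) hF hK hm3 hmo
        (mt hmp.mp hpm) hh).2.1.1 (by omega) hd
  · have he : ZMod.χ₄ (q ^ (m / 2) : ℕ) = (-1) ^ (l * m * (p - 1) / 4) := by
      rw [hq]
      exact χ₄_prime_pow_eq (hp.odd_of_ne_two (hodd hqo)) hme
    have hd := isMinDist_dual_three (K := K) hF hK hm (Or.inr (hthree hqo))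
    -- The exponent (lm(p-1) + 4)/4 is one more than lm(p-1)/4, so it stands for the sign -ε.
    rw [Nat.add_div_right _ (by norm_num : 0 < 4)]
    have h0 := fun hpm => params_of_odd_even_of_eq_zero (K := K) (h2F hqo) hF hK hm hme
      (hmp.mpr hpm) (hthree hqo) he
    have h1 := fun hpm => params_of_odd_even_of_ne_zero (K := K) (h2F hqo) hF hK hm hme
      (mt hmp.mp hpm) (hthree hqo) he
    refine ⟨h0, h1, ?_⟩
    by_cases hpm : p ∣ m
    · exact hasParams_dual (h0 hpm).2.1 (by omega) hd
    · exact hasParams_dual (h1 hpm).2.1 (by omega) hd
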